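/- Let $\nu\in\mathbb{N}$, $X=\mathbb{R}^\nu$, $\langle x\rangle=(1+|x|^2)^{1/2}$, let $\mathcal{H}^{1}$ be the first order $L^2$-Sobolev space on $X$ and $\mathcal{H}^{-1}$ its adjoint space with respect to the $L^2$ scalar product. Let $\mathcal{U}$ be the set of $C^\infty$ vector fields $u:X\to X$ which are bounded together with all their derivatives and satisfy $x\cdot u(x)>0$ for all $x\neq 0$. For $u\in\mathcal{U}$ let $A_u$ be the closure in $L^2(X)$ of the operator $\frac12\big(u(p)\cdot q+q\cdot u(p)\big)$ with domain $C_c^\infty(X)$, where $q$ is multiplication by $x$ and $p=-i\nabla$. If the unitary group $e^{i\tau A_u}$ exists (that is, $A_u$ is self-adjoint) and induces $C_0$-groups in $\mathcal{H}^1$ and $\mathcal{H}^{-1}$, put $V_\tau=e^{i\tau A_u}Ve^{-i\tau A_u}$ for a bounded operator $V:\mathcal{H}^1\to\mathcal{H}^{-1}$. In this case one says that $V\in C^1(A_u,\mathcal{H}^1,\mathcal{H}^{-1})$ if $\tau\mapsto V_\tau f\in\mathcal{H}^{-1}$ is of class $C^1$ on $\mathbb{R}$ for every $f\in\mathcal{H}^1$,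 and that $V\in C^{1,1}(A_u,\mathcal{H}^1,\mathcal{H}^{-1})$ if $$\int_0^1\|V_\tau+V_{-\tau}-2V\|_{B(\mathcal{H}^1,\mathcal{H}^{-1})}\,\frac{d\tau}{\tau^2}<\infty .$$ Let $u(x)=x\langle x\rangle^{-\nu-1}$. Then $u\in\mathcal{U}$, and for every symmetric bounded operator $V:\mathcal{H}^1\to\mathcal{H}^{-1}$ which is a multiplication operator (i.e. $V\theta(q)=\theta(q)V$ for all $\theta\in C_c^\infty(X)$, so that $V$ is multiplication by a distribution, also denoted $V$): 1. if the distribution $x\mapsto|x|V(x)$ is in $\mathcal{H}^{-1}$, then $V\in C^1(A_u,\mathcal{H}^1,\mathcal{H}^{-1})$ (in particular $e^{i\tau A_u}$ exists and induces $C_0$-groups in $\mathcal{H}^{\pm1}$); 2. if there is $\mu>0$ such that the distribution $x\mapsto\langle x\rangle^{1+\mu}V(x)$ is in $\mathcal{H}^{-1}$, then $V\in C^{1,1}(A_u,\mathcal{H}^1,\mathcal{H}^{-1})$ (with the same addition). Here, for $w=|x|$ or $w=\langle x\rangle^{1+\mu}$, the distribution $T=wV$ is the one with $\varphi T=V(w\varphi)$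 for all $\varphi\in C_c^\infty(X)$; note that $w\varphi\in\mathcal{H}^1$. -/

import Mathlib

open MeasureTheory Filter Topology
open scoped SchwartzMap ENNReal ContDiff

noncomputable section

namespace ConjClass

/-! ### Configuration space, `L²` and Sobolev spaces -/

/-- The Euclidean space `X = ℝ^ν`. -/
abbrev X (ν : ℕ) : Type := EuclideanSpace ℝ (Fin ν)

/-- The Hilbert space `L²(X)`. -/
abbrev L2 (ν : ℕ) : Type := Lp ℂ 2 (volume : Measure (X ν))

/-- The Sobolev space of order `s`, as a subspace of the tempered distributions. -/
def sobSubmodule (ν : ℕ) (s : ℝ) : Submodule ℂ 𝓢'(X ν, ℂ) where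
  carrier := {f | TemperedDistribution.MemSobolev s 2 f}
  add_mem' := fun hf hg => hf.add hg
  zero_mem' := TemperedDistribution.memSobolev_fun_zero _ _ s 2
  smul_mem' := fun c _ hf => hf.smul c

/-- The Sobolev space `H^s(X)`. It is a type of its own so that it carries the Sobolev norm
defined below, and not the topology of the tempered distributions. -/
def Sob (ν : ℕ) (s : ℝ) : Type := sobSubmodule ν s

namespace Sob

variable {ν : ℕ} {s : ℝ}

instance : AddCommGroup (Sob ν s) := inferInstanceAs (AddCommGroup (sobSubmodule ν s))

instance : Module ℂ (Sob ν s) := inferInstanceAs (Module ℂ (sobSubmodule ν s))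

/-- An element of `H^s`, seen as a tempered distribution. -/
def toDistr : Sob ν s →ₗ[ℂ] 𝓢'(X ν, ℂ) := (sobSubmodule ν s).subtype

theorem toDistr_injective : Function.Injective (toDistr : Sob ν s → 𝓢'(X ν, ℂ)) :=
  Subtype.val_injective

theorem toDistr_memSobolev (f : Sob ν s) : TemperedDistribution.MemSobolev s 2 (toDistr f) :=
  f.2

theorem coe_L2_injective :
    Function.Injective (fun g : L2 ν => (g : 𝓢'(X ν, ℂ))) := by
  have h := Lp.ker_toTemperedDistributionCLM_eq_bot (E := X ν) (F := ℂ) (p := 2)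
    (μ := (volume : Measure (X ν)))
  exact LinearMap.ker_eq_bot.mp h

/-- The Bessel potential of order `s`, as a linear map `H^s → L²`. -/
def toL2 : Sob ν s →ₗ[ℂ] L2 ν where
  toFun f := (toDistr_memSobolev f).choose
  map_add' f g := by
    apply coe_L2_injective
    have h : ((((toDistr_memSobolev f).choose + (toDistr_memSobolev g).choose : L2 ν)) :
        𝓢'(X ν, ℂ)) = ((toDistr_memSobolev f).choose : 𝓢'(X ν, ℂ)) +
          ((toDistr_memSobolev g).choose : 𝓢'(X ν, ℂ)) :=
      map_add (Lp.toTemperedDistributionCLM ℂ (volume : Measure (X ν)) 2) _ _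
    simp only [h]
    rw [← (toDistr_memSobolev (f + g)).choose_spec, ← (toDistr_memSobolev f).choose_spec,
      ← (toDistr_memSobolev g).choose_spec, map_add, map_add]
  map_smul' c f := by
    apply coe_L2_injective
    have h : ((c • (toDistr_memSobolev f).choose : L2 ν) : 𝓢'(X ν, ℂ)) =
        c • ((toDistr_memSobolev f).choose : 𝓢'(X ν, ℂ)) :=
      map_smul (Lp.toTemperedDistributionCLM ℂ (volume : Measure (X ν)) 2) _ _
    simp only [RingHom.id_apply, h]
    rw [← (toDistr_memSobolev (c • f)).choose_spec, ← (toDistr_memSobolev f).choose_spec,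
      map_smul, map_smul]

theorem toL2_spec (f : Sob ν s) :
    TemperedDistribution.besselPotential (X ν) ℂ s (toDistr f) = (toL2 f : 𝓢'(X ν, ℂ)) :=
  (toDistr_memSobolev f).choose_spec

theorem toL2_injective : Function.Injective (toL2 : Sob ν s → L2 ν) := by
  intro f g h
  apply toDistr_injective
  have h1 : TemperedDistribution.besselPotential (X ν) ℂ s (toDistr f) =
      TemperedDistribution.besselPotential (X ν) ℂ s (toDistr g) := by
    rw [toL2_spec, toL2_spec, h]
  have h2 := congrArg (TemperedDistribution.besselPotential (X ν) ℂ (-s)) h1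
  simpa using h2

/-- The Sobolev norm: the `L²` norm of the Bessel potential of order `s`. (Mathlib's frequency
variable is the momentum divided by `2π`, so for `s = ± 1` this norm is equivalent to the one
built on `1 - Δ`.) -/
instance : NormedAddCommGroup (Sob ν s) :=
  NormedAddCommGroup.induced (Sob ν s) (L2 ν) toL2 toL2_injective

instance : NormedSpace ℂ (Sob ν s) := NormedSpace.induced ℂ (Sob ν s) (L2 ν) toL2

end Sob

/-- The duality between `H^1` and `H^{-1}` that extends the scalar product `(f, T)` of `L²`
(antilinear in `f`, linear in `T`). -/
def pairing {ν : ℕ} (f : Sob ν 1) (T : Sob ν (-1)) : ℂ :=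
  inner ℂ (Sob.toL2 f) (Sob.toL2 T)

/-! ### Potentials -/

/-- Smooth compactly supported functions on `X`. -/
def IsTest {ν : ℕ} (θ : X ν → ℂ) : Prop := ContDiff ℝ ∞ θ ∧ HasCompactSupport θ

/-- `V : H^1 → H^{-1}` is symmetric: `(f, V g) = (V f, g)`. -/
def IsSymm {ν : ℕ} (V : Sob ν 1 →L[ℂ] Sob ν (-1)) : Prop :=
  ∀ f g : Sob ν 1, pairing f (V g) = (starRingEnd ℂ) (pairing g (V f))

/-- `V` is a multiplication operator: `V θ(q) = θ(q) V` for all `θ ∈ C_c^∞(X)`. -/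
def IsMultiplication {ν : ℕ} (V : Sob ν 1 →L[ℂ] Sob ν (-1)) : Prop :=
  ∀ θ : X ν → ℂ, IsTest θ → ∀ f g : Sob ν 1,
    g.toDistr = TemperedDistribution.smulLeftCLM ℂ θ f.toDistr →
      (V g).toDistr = TemperedDistribution.smulLeftCLM ℂ θ (V f).toDistr

/-- For a multiplication operator `V` and a locally Lipschitz function `w`: the distribution
`x ↦ w(x) V(x)` belongs to `H^{-1}`. The distribution `T = w V` is characterized by
`φ T = V (w φ)` for all `φ ∈ C_c^∞(X)`, where `w φ ∈ H^1`. -/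
def WeightedMem {ν : ℕ} (w : X ν → ℝ) (V : Sob ν 1 →L[ℂ] Sob ν (-1)) : Prop :=
  ∃ T : Sob ν (-1), ∀ φ : X ν → ℂ, IsTest φ → ∀ (g : Sob ν 1) (h : L2 ν),
    (h : X ν → ℂ) =ᵐ[volume] (fun x => (w x : ℂ) * φ x) → g.toDistr = (h : 𝓢'(X ν, ℂ)) →
      (V g).toDistr = TemperedDistribution.smulLeftCLM ℂ φ T.toDistr

/-! ### The conjugate operator `A_u` -/

/-- The class `𝒰` of smooth vector fields on `X` that are bounded with all their derivatives,
with `x · u(x) > 0` for `x ≠ 0`. -/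
def IsClassU {ν : ℕ} (u : X ν → X ν) : Prop :=
  ContDiff ℝ ∞ u ∧ (∀ n : ℕ, ∃ C : ℝ, ∀ x, ‖iteratedFDeriv ℝ n u x‖ ≤ C) ∧
    ∀ x, x ≠ 0 → 0 < inner ℝ x (u x)

/-- The Japanese bracket `⟨x⟩ = (1 + |x|²)^{1/2}`. -/
def jap {ν : ℕ} (x : X ν) : ℝ := Real.sqrt (1 + ‖x‖ ^ 2)

/-- The vector field `u(x) = x ⟨x⟩^{-ν-1}`. -/
def uField (ν : ℕ) (x : X ν) : X ν := (jap x ^ (-(ν : ℝ) - 1)) • x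

/-- The operator `q_j` of multiplication by `x_j`, on Schwartz functions. -/
def qOp {ν : ℕ} (j : Fin ν) : 𝓢(X ν, ℂ) →L[ℂ] 𝓢(X ν, ℂ) :=
  SchwartzMap.smulLeftCLM ℂ (fun x : X ν => ((x j : ℝ) : ℂ))

/-- The operator `u_j(p)`, `p = -i∇`, on Schwartz functions. Since Mathlib's Fourier transform
has the kernel `e^{-2πi x·ξ}`, the momentum `p` is the Fourier multiplier `2πξ`. -/
def uOp {ν : ℕ} (u : X ν → X ν) (j : Fin ν) : 𝓢(X ν, ℂ) →L[ℂ] 𝓢(X ν, ℂ) :=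
  SchwartzMap.fourierMultiplierCLM ℂ (fun ξ : X ν => ((u ((2 * Real.pi) • ξ) j : ℝ) : ℂ))

/-- The expression `½ ∑_j (u_j(p) q_j + q_j u_j(p))` on Schwartz functions. -/
def conjExpr {ν : ℕ} (u : X ν → X ν) : 𝓢(X ν, ℂ) →L[ℂ] 𝓢(X ν, ℂ) :=
  (1 / 2 : ℂ) • ∑ j : Fin ν, ((uOp u j).comp (qOp j) + (qOp j).comp (uOp u j))

/-- `C_c^∞(X)`, as a space of Schwartz functions. -/
def testSubmodule (ν : ℕ) : Submodule ℂ 𝓢(X ν, ℂ) where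
  carrier := {φ | HasCompactSupport (φ : X ν → ℂ)}
  add_mem' := fun hf hg => hf.add hg
  zero_mem' := HasCompactSupport.zero
  smul_mem' := fun _ _ hf => hf.smul_left

/-- The embedding of `C_c^∞(X)` in `L²(X)`. -/
def testToL2 (ν : ℕ) : testSubmodule ν →ₗ[ℂ] L2 ν :=
  (SchwartzMap.toLpCLM ℂ ℂ 2 (volume : Measure (X ν))).toLinearMap ∘ₗ (testSubmodule ν).subtype

theorem testToL2_injective (ν : ℕ) : Function.Injective (testToL2 ν) := by
  intro f g h
  exact Subtype.ext (SchwartzMap.injective_toLp (E := X ν) (F := ℂ) 2 volume h)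

/-- The operator `½ (u(p)·q + q·u(p))` in `L²(X)` with domain `C_c^∞(X)`. -/
def conjOpMin {ν : ℕ} (u : X ν → X ν) : L2 ν →ₗ.[ℂ] L2 ν where
  domain := LinearMap.range (testToL2 ν)
  toFun := (SchwartzMap.toLpCLM ℂ ℂ 2 (volume : Measure (X ν))).toLinearMap ∘ₗ
    (conjExpr u).toLinearMap ∘ₗ (testSubmodule ν).subtype ∘ₗ
      (LinearEquiv.ofInjective (testToL2 ν) (testToL2_injective ν)).symm.toLinearMap

/-- The operator `A_u`: the closure of `½ (u(p)·q + q·u(p))` on `C_c^∞(X)`. -/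
def conjOp {ν : ℕ} (u : X ν → X ν) : L2 ν →ₗ.[ℂ] L2 ν := (conjOpMin u).closure

/-! ### Unitary groups and regularity classes -/

/-- `U` is the strongly continuous unitary group `τ ↦ e^{iτA}` in `L²(X)`: its generator is
exactly `A`, that is, `f ∈ D(A)` and `A f = g` if and only if `τ ↦ U_τ f` has the derivative
`i g` at `τ = 0`. -/
structure IsUnitaryGroup {ν : ℕ} (A : L2 ν →ₗ.[ℂ] L2 ν) (U : ℝ → L2 ν →L[ℂ] L2 ν) : Prop where
  map_zero : U 0 = ContinuousLinearMap.id ℂ (L2 ν)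
  map_add : ∀ σ τ, U (σ + τ) = (U σ).comp (U τ)
  norm_map : ∀ τ f, ‖U τ f‖ = ‖f‖
  continuous : ∀ f, Continuous fun τ => U τ f
  generator : ∀ f g, (f, g) ∈ A.graph ↔ HasDerivAt (fun τ : ℝ => U τ f) (Complex.I • g) 0

/-- `W` is the `C_0`-group in `H^s` induced by `U`: each `W_τ` is a bounded operator in `H^s` that
coincides with `U_τ` on `H^s ∩ L²`, and `W` is strongly continuous. (For `s = 1` it is the
restriction of `U` to `H^1`, for `s = -1` the extension by continuity to `H^{-1}`.) -/
structure IsInducedGroup {ν : ℕ} (s : ℝ) (U : ℝ → L2 ν →L[ℂ] L2 ν)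
    (W : ℝ → Sob ν s →L[ℂ] Sob ν s) : Prop where
  agree : ∀ (τ : ℝ) (f : Sob ν s) (g : L2 ν), f.toDistr = (g : 𝓢'(X ν, ℂ)) →
    (W τ f).toDistr = (U τ g : 𝓢'(X ν, ℂ))
  continuous : ∀ f, Continuous fun τ => W τ f

/-- The group `e^{iτA}` acting in `L²`, in `H^1` and in `H^{-1}`. There is at most one such triple
for a given `A`. -/
structure GroupOf {ν : ℕ} (A : L2 ν →ₗ.[ℂ] L2 ν) where
  U : ℝ → L2 ν →L[ℂ] L2 ν
  Wpos : ℝ → Sob ν 1 →L[ℂ] Sob ν 1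
  Wneg : ℝ → Sob ν (-1) →L[ℂ] Sob ν (-1)
  isUnitaryGroup : IsUnitaryGroup A U
  isInduced_pos : IsInducedGroup 1 U Wpos
  isInduced_neg : IsInducedGroup (-1) U Wneg

/-- `V_τ = e^{iτA} V e^{-iτA}`, as a bounded operator `H^1 → H^{-1}`. -/
def GroupOf.conj {ν : ℕ} {A : L2 ν →ₗ.[ℂ] L2 ν} (G : GroupOf A)
    (V : Sob ν 1 →L[ℂ] Sob ν (-1)) (τ : ℝ) : Sob ν 1 →L[ℂ] Sob ν (-1) :=
  (G.Wneg τ).comp (V.comp (G.Wpos (-τ)))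

/-- `V ∈ C^1(A, H^1, H^{-1})`: the unitary group `e^{iτA}` exists and induces `C_0`-groups in
`H^1` and `H^{-1}`, and `τ ↦ V_τ` is strongly of class `C^1`. -/
def IsClassC1 {ν : ℕ} (A : L2 ν →ₗ.[ℂ] L2 ν) (V : Sob ν 1 →L[ℂ] Sob ν (-1)) : Prop :=
  ∃ G : GroupOf A, ∀ f : Sob ν 1, ContDiff ℝ 1 (fun τ : ℝ => G.conj V τ f)

/-- `V ∈ C^{1,1}(A, H^1, H^{-1})`: the unitary group `e^{iτA}` exists and induces `C_0`-groups in
`H^1` and `H^{-1}`, and `∫_0^1 ‖V_τ + V_{-τ} - 2V‖ τ^{-2} dτ < ∞`. -/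
def IsClassC11 {ν : ℕ} (A : L2 ν →ₗ.[ℂ] L2 ν) (V : Sob ν 1 →L[ℂ] Sob ν (-1)) : Prop :=
  ∃ G : GroupOf A, ∫⁻ τ in Set.Ioc (0 : ℝ) 1,
    ENNReal.ofReal (‖G.conj V τ + G.conj V (-τ) - (2 : ℂ) • V‖ / τ ^ 2) < ⊤

end ConjClass

end

noncomputable section

namespace ConjClass

section

/-! ### The radial flow -/

/-! On the Fourier side, with `p = 2πξ` and `q = (i/2π)∇`, the operator `iA_u` becomes `-(b·∇ + ½
div b)`, where `b(ξ) = (2π)⁻¹ u(2πξ)` is a radial vector field. Hence `e^{iτA_u}` is transport along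
the flow of `b`, corrected by the square root of the Jacobian. In the logarithm of the radius the
flow is an autonomous scalar equation with speed at most 1, so it is complete and changes radii by
at most the factor `e^{|τ|}`. The same transport is therefore bounded on `L²` with weight `⟨ξ⟩^s`,
which gives the induced `C_0`-groups in `H^s`. Smooth functions supported in annuli are preserved by
the flow and form a core. From this the generator of the transport group is identified with the
closure of the operator on `C_c^∞` (`hasDerivAt_transport_iff`, `graph_conjOp_uField`).

Multiplication by a distribution `v` becomes convolution with its Fourier transform `v̂`. As an
operator from `H^1` to `H^{-1}` it has, in `L²`, the kernel `⟨ξ⟩⁻¹ v̂(ξ-η) ⟨η⟩⁻¹`, and `v ∈ H^{-1}`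
means `v̂ = ⟨·⟩S` with `S ∈ L²`. Integrating by parts along `(b(ξ), b(η))`, the commutator with the
generator replaces `v̂(ξ-η)` by `½(div b(ξ) + div b(η)) v̂(ξ-η) + ∑_j (b_j(ξ) - b_j(η)) ∂_j v̂(ξ-η)`
(`cform_genFun`), where `∂_j v̂` comes from `x_j v`. The choice of `u` makes `b` and `div b` of size
`O(⟨ξ⟩^{-ν})`, which is square integrable. Since `⟨ξ-η⟩ ≤ 2⟨ξ⟩⟨η⟩`, the commutator is
Hilbert–Schmidt, with norm bounded by the `H^{-1}` norms of `v` and of the `x_j v`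
(`exists_operator_of_isCoef`). Second commutators have the same structure and need `x_i x_j v` as
well.

For the first claim, the weight `|x|` gives `v` and all `x_j v` in `H^{-1}`, so the commutator is
bounded and `τ ↦ V_τ` is strongly `C^1` (`contDiff_sandwich`).

For the second claim, reduce to `μ ≤ 1` and split `v = v₁ + v₂` at the scale `|x| ~ 1/ε`
(`exists_decomposition`). The first commutator of `v₂` is `O(ε^μ)`, the second commutator of `v₁` is
`O(ε^{μ-1})`. The second difference at `τ` is at most a constant times `τ(‖B₂‖ + τ‖C₁‖)`, where `B₂`
is the former and `C₁` the latter (`norm_second_difference_le`). With `ε = τ` it is `O(τ^{1+μ})`,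
and dividing by `τ²` leaves the integrable function `τ^{μ-1}`. -/

/-- The radial speed `(1 + 4π²t²)^{-(ν+1)/2}`. -/
def speed (ν : ℕ) (t : ℝ) : ℝ := (1 + 4 * Real.pi ^ 2 * t ^ 2) ^ (-((ν : ℝ) + 1) / 2)

theorem one_le_speed_base (t : ℝ) : 1 ≤ 1 + 4 * Real.pi ^ 2 * t ^ 2 := by
  have : 0 ≤ 4 * Real.pi ^ 2 * t ^ 2 := by positivity
  linarith

theorem speed_pos (ν : ℕ) (t : ℝ) : 0 < speed ν t :=
  Real.rpow_pos_of_pos (by linarith [one_le_speed_base t]) _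

theorem speed_le_one (ν : ℕ) (t : ℝ) : speed ν t ≤ 1 := by
  apply Real.rpow_le_one_of_one_le_of_nonpos (one_le_speed_base t)
  have : (0 : ℝ) ≤ ν := Nat.cast_nonneg ν
  linarith

theorem contDiff_speed (ν : ℕ) : ContDiff ℝ ∞ (speed ν) := by
  unfold speed
  apply ContDiff.rpow_const_of_ne (by fun_prop)
  intro t
  linarith [one_le_speed_base t]

/-- The reciprocal speed in the logarithmic radial variable. -/
def logSlow (ν : ℕ) (s : ℝ) : ℝ := (speed ν (Real.exp s))⁻¹

theorem contDiff_logSlow (ν : ℕ) : ContDiff ℝ ∞ (logSlow ν) :=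
  ((contDiff_speed ν).comp Real.contDiff_exp).inv fun _ => (speed_pos ν _).ne'

theorem one_le_logSlow (ν : ℕ) (s : ℝ) : 1 ≤ logSlow ν s :=
  (one_le_inv₀ (speed_pos ν _)).2 (speed_le_one ν _)

/-- The time coordinate of the flow, as a function of the logarithm of the radius. -/
def clock (ν : ℕ) (s : ℝ) : ℝ := ∫ σ in (0 : ℝ)..s, logSlow ν σ

theorem hasDerivAt_clock (ν : ℕ) (s : ℝ) : HasDerivAt (clock ν) (logSlow ν s) s :=
  intervalIntegral.integral_hasDerivAt_right
    ((contDiff_logSlow ν).continuous.intervalIntegrable _ _)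
    ((contDiff_logSlow ν).continuous.stronglyMeasurableAtFilter _ _)
    (contDiff_logSlow ν).continuous.continuousAt

theorem contDiff_clock (ν : ℕ) : ContDiff ℝ ∞ (clock ν) := by
  refine contDiff_infty_iff_deriv.2 ⟨fun s => (hasDerivAt_clock ν s).differentiableAt, ?_⟩
  have : deriv (clock ν) = logSlow ν := funext fun s => (hasDerivAt_clock ν s).deriv
  rw [this]
  exact contDiff_logSlow ν

theorem strictMono_clock (ν : ℕ) : StrictMono (clock ν) :=
  strictMono_of_deriv_pos fun s => by
    rw [(hasDerivAt_clock ν s).deriv]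
    linarith [one_le_logSlow ν s]

/-- The clock has slope at least 1. Read through the inverse function, this says that the logarithm
of the radius moves by at most the elapsed time. -/
theorem clock_sub_le {ν : ℕ} {s t : ℝ} (h : s ≤ t) : t - s ≤ clock ν t - clock ν s := by
  have hm : Monotone fun s => clock ν s - s := by
    apply monotone_of_deriv_nonneg
    · exact (contDiff_clock ν).differentiable (by simp) |>.sub differentiable_id
    · intro s
      have := ((hasDerivAt_clock ν s).sub (hasDerivAt_id s)).deriv
      have h2 : deriv (fun s => clock ν s - s) s = logSlow ν s - 1 := this
      rw [h2]
      linarith [one_le_logSlow ν s]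
  have := hm h
  simp only at this
  linarith

/-- At least linear growth in both directions: no trajectory reaches zero or infinity in finite
time, so the flow is a group defined for all times. -/
theorem surjective_clock (ν : ℕ) : Function.Surjective (clock ν) := by
  have h0 : clock ν 0 = 0 := by simp [clock]
  apply (contDiff_clock ν).continuous.surjective
  · apply tendsto_atTop_mono' _ _ tendsto_id
    filter_upwards [eventually_ge_atTop (0 : ℝ)] with s hs
    have := clock_sub_le (ν := ν) hs
    simp only [id]
    linarith
  · apply tendsto_atBot_mono' _ _ tendsto_id
    filter_upwards [eventually_le_atBot (0 : ℝ)] with s hs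
    have := clock_sub_le (ν := ν) hs
    simp only [id]
    linarith

/-- The clock as an order isomorphism of the line. -/
def clockIso (ν : ℕ) : ℝ ≃o ℝ :=
  (strictMono_clock ν).orderIsoOfSurjective (clock ν) (surjective_clock ν)

/-- The logarithm of the radius, as a function of time. -/
def logRad (ν : ℕ) (t : ℝ) : ℝ := (clockIso ν).symm t

@[simp] theorem clock_logRad (ν : ℕ) (t : ℝ) : clock ν (logRad ν t) = t :=
  (clockIso ν).apply_symm_apply t

@[simp] theorem logRad_clock (ν : ℕ) (s : ℝ) : logRad ν (clock ν s) = s :=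
  (clockIso ν).symm_apply_apply s

theorem continuous_logRad (ν : ℕ) : Continuous (logRad ν) := (clockIso ν).symm.continuous

theorem hasDerivAt_logRad (ν : ℕ) (t : ℝ) :
    HasDerivAt (logRad ν) (speed ν (Real.exp (logRad ν t))) t := by
  have h := HasDerivAt.of_local_left_inverse (f := clock ν) (g := logRad ν) (a := t)
    (continuous_logRad ν).continuousAt (hasDerivAt_clock ν (logRad ν t))
    (by linarith [one_le_logSlow ν (logRad ν t)])
    (Eventually.of_forall fun s => clock_logRad ν s)
  rwa [logSlow, inv_inv] at h

/-- Bootstrap of the differential equation: if the solution is `C^n`, so is the right-hand side, and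
the solution is `C^{n+1}`. -/
theorem contDiff_logRad (ν : ℕ) : ContDiff ℝ ∞ (logRad ν) := by
  rw [contDiff_infty]
  intro n
  induction n with
  | zero => exact contDiff_zero.2 (continuous_logRad ν)
  | succ n ih =>
    push_cast
    refine contDiff_succ_iff_deriv.2 ⟨fun t => (hasDerivAt_logRad ν t).differentiableAt,
      by simp, ?_⟩
    have : deriv (logRad ν) = fun t => speed ν (Real.exp (logRad ν t)) :=
      funext fun t => (hasDerivAt_logRad ν t).deriv
    rw [this]
    exact ((contDiff_speed ν).of_le (by exact_mod_cast le_top)).comp (Real.contDiff_exp.comp ih)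

theorem logRad_add_sub_le (ν : ℕ) {t τ : ℝ} (hτ : 0 ≤ τ) :
    logRad ν (t + τ) - logRad ν t ≤ τ := by
  have hle : logRad ν t ≤ logRad ν (t + τ) :=
    (clockIso ν).symm.monotone (by linarith)
  have := clock_sub_le (ν := ν) hle
  simpa using this

theorem abs_logRad_sub_le (ν : ℕ) (t τ : ℝ) : |logRad ν (t + τ) - logRad ν t| ≤ |τ| := by
  have hm := (clockIso ν).symm.monotone
  rcases le_total 0 τ with h | h
  · have h1 := logRad_add_sub_le ν (t := t) h
    have h2 : logRad ν t ≤ logRad ν (t + τ) := hm (by linarith)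
    rw [abs_of_nonneg h, abs_of_nonneg (by linarith)]
    exact h1
  · have h1 := logRad_add_sub_le ν (t := t + τ) (τ := -τ) (by linarith)
    have h2 : logRad ν (t + τ) ≤ logRad ν t := hm (by linarith)
    rw [abs_of_nonpos h, abs_of_nonpos (by linarith)]
    simp only [add_neg_cancel_right] at h1
    linarith

/-- The flow of the vector field `ξ ↦ speed |ξ| ξ`. -/
def flow {ν : ℕ} (τ : ℝ) (ξ : X ν) : X ν :=
  Real.exp (logRad ν (clock ν (Real.log ‖ξ‖) + τ) - Real.log ‖ξ‖) • ξ

@[simp] theorem flow_zero_right {ν : ℕ} (τ : ℝ) : flow τ (0 : X ν) = 0 := by simp [flow]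

@[simp] theorem flow_zero_left {ν : ℕ} (ξ : X ν) : flow 0 ξ = ξ := by simp [flow]

theorem norm_flow {ν : ℕ} (τ : ℝ) {ξ : X ν} (h : ξ ≠ 0) :
    ‖flow τ ξ‖ = Real.exp (logRad ν (clock ν (Real.log ‖ξ‖) + τ)) := by
  rw [flow, norm_smul, Real.norm_eq_abs, abs_of_pos (Real.exp_pos _), Real.exp_sub,
    Real.exp_log (norm_pos_iff.2 h), div_mul_cancel₀ _ (norm_ne_zero_iff.2 h)]

theorem flow_ne_zero {ν : ℕ} (τ : ℝ) {ξ : X ν} (h : ξ ≠ 0) : flow τ ξ ≠ 0 :=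
  smul_ne_zero (Real.exp_pos _).ne' h

theorem clock_log_norm_flow {ν : ℕ} (τ : ℝ) {ξ : X ν} (h : ξ ≠ 0) :
    clock ν (Real.log ‖flow τ ξ‖) = clock ν (Real.log ‖ξ‖) + τ := by
  rw [norm_flow τ h, Real.log_exp, clock_logRad]

theorem flow_flow {ν : ℕ} (σ τ : ℝ) (ξ : X ν) : flow σ (flow τ ξ) = flow (σ + τ) ξ := by
  by_cases h : ξ = 0
  · simp [h]
  rw [flow, clock_log_norm_flow τ h, norm_flow τ h, Real.log_exp, flow, flow, smul_smul,
    ← Real.exp_add]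
  congr 2
  rw [add_comm σ τ, ← add_assoc]
  ring

theorem norm_flow_le {ν : ℕ} (τ : ℝ) (ξ : X ν) : ‖flow τ ξ‖ ≤ Real.exp |τ| * ‖ξ‖ := by
  rw [flow, norm_smul, Real.norm_eq_abs, abs_of_pos (Real.exp_pos _)]
  apply mul_le_mul_of_nonneg_right _ (norm_nonneg _)
  apply Real.exp_le_exp.2
  have := (abs_le.1 (abs_logRad_sub_le ν (clock ν (Real.log ‖ξ‖)) τ)).2
  simpa using this

/-- The upper bound applied to the inverse flow, from the image point. -/
theorem le_norm_flow {ν : ℕ} (τ : ℝ) (ξ : X ν) : Real.exp (-|τ|) * ‖ξ‖ ≤ ‖flow τ ξ‖ := by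
  have h := norm_flow_le (-τ) (flow τ ξ)
  rw [flow_flow, neg_add_cancel, flow_zero_left, abs_neg] at h
  rw [Real.exp_neg, inv_mul_le_iff₀ (Real.exp_pos _)]
  exact h

/-- The formula goes through `log ‖ξ‖`, so smoothness is obtained off the origin only. This is why
the core below consists of functions vanishing near the origin. -/
theorem contDiffAt_flow {ν : ℕ} (τ : ℝ) {ξ : X ν} (h : ξ ≠ 0) :
    ContDiffAt ℝ ∞ (fun p : ℝ × X ν => flow p.1 p.2) (τ, ξ) := by
  unfold flow
  have hlog : ContDiffAt ℝ ∞ (fun p : ℝ × X ν => Real.log ‖p.2‖) (τ, ξ) :=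
    (contDiffAt_snd.norm ℝ h).log (norm_ne_zero_iff.2 h)
  refine ContDiffAt.smul (ContDiffAt.exp (ContDiffAt.sub ?_ hlog)) contDiffAt_snd
  exact (contDiff_logRad ν).contDiffAt.comp _
    (((contDiff_clock ν).contDiffAt.comp _ hlog).add contDiffAt_fst)

/-- The vector field `b(ξ) = speed |ξ| ξ`. -/
def field {ν : ℕ} (ξ : X ν) : X ν := speed ν ‖ξ‖ • ξ

theorem hasDerivAt_flow {ν : ℕ} (ξ : X ν) : HasDerivAt (fun τ => flow τ ξ) (field ξ) 0 := by
  by_cases h : ξ = 0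
  · subst h
    simpa [field] using hasDerivAt_const (0 : ℝ) (0 : X ν)
  have h1 : HasDerivAt (fun τ => logRad ν (clock ν (Real.log ‖ξ‖) + τ)) (speed ν ‖ξ‖) 0 := by
    have := (hasDerivAt_logRad ν (clock ν (Real.log ‖ξ‖) + 0)).comp_const_add
      (clock ν (Real.log ‖ξ‖)) 0
    simpa [Real.exp_log (norm_pos_iff.2 h)] using this
  have h2 := ((h1.sub_const (Real.log ‖ξ‖)).exp).smul_const ξ
  simpa [field, flow] using h2

theorem continuous_flow {ν : ℕ} (τ : ℝ) : Continuous (flow τ : X ν → X ν) := by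
  rw [continuous_iff_continuousAt]
  intro ξ
  by_cases h : ξ = 0
  · subst h
    rw [ContinuousAt, flow_zero_right]
    apply squeeze_zero_norm (fun ξ => norm_flow_le τ ξ)
    have : Tendsto (fun ξ : X ν => Real.exp |τ| * ‖ξ‖) (𝓝 0) (𝓝 (Real.exp |τ| * ‖(0 : X ν)‖)) :=
      (continuous_const.mul continuous_norm).tendsto _
    simpa using this
  · have h2 : ContinuousAt (fun η : X ν => ((τ, η) : ℝ × X ν)) ξ := by fun_prop
    exact ContinuousAt.comp (f := fun η : X ν => ((τ, η) : ℝ × X ν))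
      (contDiffAt_flow τ h).continuousAt h2

end

section

/-! ### The invariant measure of the flow -/

theorem ae_ne_zero {ν : ℕ} (hν : 0 < ν) : ∀ᵐ ξ : X ν, ξ ≠ 0 := by
  have : Nonempty (Fin ν) := ⟨⟨0, hν⟩⟩
  have : Nontrivial (X ν) := inferInstance
  simp [ae_iff, measure_singleton]

theorem lintegral_polar {ν : ℕ} (hν : 0 < ν) {f : X ν → ℝ≥0∞} (hf : Measurable f) :
    ∫⁻ ξ, f ξ = ∫⁻ θ : Metric.sphere (0 : X ν) 1,
      (∫⁻ r in Set.Ioi (0 : ℝ), ENNReal.ofReal (r ^ (ν - 1)) * f (r • (θ : X ν)))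
      ∂(volume : Measure (X ν)).toSphere := by
  have h1 : ∫⁻ ξ, f ξ = ∫⁻ ξ in ({0}ᶜ : Set (X ν)), f ξ := by
    rw [Measure.restrict_eq_self_of_ae_mem]
    filter_upwards [ae_ne_zero hν] with ξ hξ using hξ
  rw [h1, ← lintegral_subtype_comap (measurableSet_singleton _).compl]
  have hmp := Measure.measurePreserving_homeomorphUnitSphereProd (volume : Measure (X ν))
  have hg : Measurable (fun p : Metric.sphere (0 : X ν) 1 × Set.Ioi (0 : ℝ) =>
      f ((p.2 : ℝ) • (p.1 : X ν))) := by
    apply hf.comp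
    fun_prop
  have h2 := hmp.lintegral_comp hg
  have h3 : ∀ x : ({0}ᶜ : Set (X ν)),
      (((homeomorphUnitSphereProd (X ν) x).2 : ℝ) • ((homeomorphUnitSphereProd (X ν) x).1 : X ν))
        = x := by
    intro x
    have hx : ‖(x : X ν)‖ ≠ 0 := norm_ne_zero_iff.2 x.2
    simp [homeomorphUnitSphereProd, smul_smul, hx]
  simp only [h3] at h2
  rw [h2, lintegral_prod _ hg.aemeasurable]
  apply lintegral_congr
  intro θ
  rw [Measure.volumeIoiPow, lintegral_withDensity_eq_lintegral_mul _ (by fun_prop)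
    (by apply hf.comp; fun_prop)]
  rw [← lintegral_subtype_comap measurableSet_Ioi]
  simp

/-- The density of Lebesgue measure with respect to the invariant measure of the flow. -/
def dens {ν : ℕ} (ξ : X ν) : ℝ := ‖ξ‖ ^ ν * speed ν ‖ξ‖

theorem dens_pos {ν : ℕ} {ξ : X ν} (h : ξ ≠ 0) : 0 < dens ξ :=
  mul_pos (pow_pos (norm_pos_iff.2 h) _) (speed_pos _ _)

theorem dens_nonneg {ν : ℕ} (ξ : X ν) : 0 ≤ dens ξ :=
  mul_nonneg (pow_nonneg (norm_nonneg _) _) (speed_pos _ _).le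

theorem continuous_dens {ν : ℕ} : Continuous (dens : X ν → ℝ) := by
  unfold dens
  exact (continuous_norm.pow _).mul ((contDiff_speed ν).continuous.comp continuous_norm)

theorem contDiffAt_dens {ν : ℕ} {ξ : X ν} (h : ξ ≠ 0) : ContDiffAt ℝ ∞ (dens : X ν → ℝ) ξ :=
  ((contDiffAt_id.norm ℝ h).pow ν).mul
    ((contDiff_speed ν).contDiffAt.comp _ (contDiffAt_id.norm ℝ h))

/-- The radial part of the flow. -/
def radFlow (ν : ℕ) (τ r : ℝ) : ℝ := Real.exp (logRad ν (clock ν (Real.log r) + τ))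

theorem hasDerivAt_radFlow (ν : ℕ) (τ : ℝ) {r : ℝ} (hr : 0 < r) :
    HasDerivAt (radFlow ν τ)
      (radFlow ν τ r * speed ν (radFlow ν τ r) * (r * speed ν r)⁻¹) r := by
  have h1 : HasDerivAt (fun r => clock ν (Real.log r) + τ) ((r * speed ν r)⁻¹) r := by
    have := ((hasDerivAt_clock ν (Real.log r)).comp r (Real.hasDerivAt_log hr.ne')).add_const τ
    rw [logSlow, Real.exp_log hr] at this
    rw [mul_inv, mul_comm]
    exact this
  have h2 := ((hasDerivAt_logRad ν _).comp r h1).exp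
  rw [← mul_assoc] at h2
  exact h2

theorem radFlow_radFlow (ν : ℕ) (σ τ r : ℝ) :
    radFlow ν σ (radFlow ν τ r) = radFlow ν (σ + τ) r := by
  simp only [radFlow, Real.log_exp, clock_logRad]
  congr 2
  ring

theorem radFlow_zero (ν : ℕ) {r : ℝ} (hr : 0 < r) : radFlow ν 0 r = r := by
  simp [radFlow, Real.exp_log hr]

/-- The measure `dr / (r speed(r))` is `dt` in the time coordinate given by the clock, and there the
flow is a translation. -/
theorem lintegral_radFlow (ν : ℕ) (τ : ℝ) (f : ℝ → ℝ≥0∞) :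
    ∫⁻ r in Set.Ioi (0 : ℝ), ENNReal.ofReal (r * speed ν r)⁻¹ * f (radFlow ν τ r) =
      ∫⁻ r in Set.Ioi (0 : ℝ), ENNReal.ofReal (r * speed ν r)⁻¹ * f r := by
  have hinj : Set.InjOn (radFlow ν τ) (Set.Ioi 0) := by
    intro r hr s hs h
    have := congrArg (radFlow ν (-τ)) h
    rwa [radFlow_radFlow, radFlow_radFlow, neg_add_cancel,
      radFlow_zero _ hr, radFlow_zero _ hs] at this
  have himg : radFlow ν τ '' Set.Ioi 0 = Set.Ioi 0 := by
    apply Set.Subset.antisymm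
    · rintro _ ⟨r, -, rfl⟩
      exact Real.exp_pos _
    · intro r hr
      refine ⟨radFlow ν (-τ) r, Real.exp_pos _, ?_⟩
      rw [radFlow_radFlow, add_neg_cancel, radFlow_zero _ hr]
  conv_rhs => rw [← himg]
  rw [lintegral_image_eq_lintegral_abs_deriv_mul measurableSet_Ioi
    (fun _ hr => (hasDerivAt_radFlow ν τ hr).hasDerivWithinAt) hinj]
  apply setLIntegral_congr_fun measurableSet_Ioi
  intro r hr
  have h1 : 0 < radFlow ν τ r := Real.exp_pos _
  have h2 := speed_pos ν (radFlow ν τ r)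
  have h3 := speed_pos ν r
  have h4 : (0 : ℝ) < r := hr
  simp only
  rw [← mul_assoc, ← ENNReal.ofReal_mul (abs_nonneg _), abs_of_pos (by positivity)]
  congr 2
  field_simp

theorem flow_smul_sphere {ν : ℕ} (τ : ℝ) {r : ℝ} (hr : 0 < r) {θ : X ν} (hθ : ‖θ‖ = 1) :
    flow τ (r • θ) = radFlow ν τ r • θ := by
  rw [flow, norm_smul, hθ, mul_one, Real.norm_of_nonneg hr.le, smul_smul, Real.exp_sub,
    Real.exp_log hr, div_mul_cancel₀ _ hr.ne', radFlow]

/-- The flow keeps directions fixed. On each ray, `r^{ν-1} dr` divided by `dens` is the measure `dr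
/ (r speed(r))`, invariant under the radial flow. -/
theorem lintegral_flow {ν : ℕ} (hν : 0 < ν) (τ : ℝ) {f : X ν → ℝ≥0∞} (hf : Measurable f) :
    ∫⁻ ξ, ENNReal.ofReal (dens ξ)⁻¹ * f (flow τ ξ) =
      ∫⁻ ξ, ENNReal.ofReal (dens ξ)⁻¹ * f ξ := by
  have hd : Measurable fun ξ : X ν => ENNReal.ofReal (dens ξ)⁻¹ :=
    (continuous_dens.measurable.inv).ennreal_ofReal
  rw [lintegral_polar hν (f := fun ξ => ENNReal.ofReal (dens ξ)⁻¹ * f (flow τ ξ))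
      (hd.mul (hf.comp (continuous_flow τ).measurable)),
    lintegral_polar hν (f := fun ξ => ENNReal.ofReal (dens ξ)⁻¹ * f ξ) (hd.mul hf)]
  apply lintegral_congr
  intro θ
  have hθ : ‖(θ : X ν)‖ = 1 := by simp
  have key : ∀ r : ℝ, 0 < r → ENNReal.ofReal (r ^ (ν - 1)) *
      ENNReal.ofReal (dens (r • (θ : X ν)))⁻¹ = ENNReal.ofReal (r * speed ν r)⁻¹ := by
    intro r hr
    rw [← ENNReal.ofReal_mul (by positivity)]
    congr 1
    have h3 := speed_pos ν r
    rw [dens, norm_smul, hθ, mul_one, Real.norm_of_nonneg hr.le]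
    -- The exponent `ν - 1` is a truncated subtraction; positivity of `ν` makes it harmless.
    obtain ⟨n, rfl⟩ : ∃ n, ν = n + 1 := ⟨ν - 1, by omega⟩
    simp only [Nat.add_sub_cancel]
    field_simp
    ring
  refine (setLIntegral_congr_fun measurableSet_Ioi fun r hr => ?_).trans
    ((lintegral_radFlow ν τ fun r => f (r • (θ : X ν))).trans
      (setLIntegral_congr_fun measurableSet_Ioi fun r hr => ?_))
  · simp only [flow_smul_sphere τ hr hθ, ← mul_assoc, key r hr]
  · simp only [← mul_assoc, key r hr]

/-- The invariant measure of the flow. -/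
def invMeasure (ν : ℕ) : Measure (X ν) :=
  volume.withDensity fun ξ => ENNReal.ofReal (dens ξ)⁻¹

theorem measurable_invDens {ν : ℕ} : Measurable fun ξ : X ν => ENNReal.ofReal (dens ξ)⁻¹ :=
  (continuous_dens.measurable.inv).ennreal_ofReal

theorem measurePreserving_flow {ν : ℕ} (hν : 0 < ν) (τ : ℝ) :
    MeasurePreserving (flow τ) (invMeasure ν) (invMeasure ν) := by
  refine ⟨(continuous_flow τ).measurable, ?_⟩
  refine Measure.ext fun s hs => ?_
  have h := lintegral_flow hν τ (f := s.indicator 1) (measurable_one.indicator hs)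
  rw [Measure.map_apply (continuous_flow τ).measurable hs, invMeasure,
    withDensity_apply _ hs, withDensity_apply _ ((continuous_flow τ).measurable hs),
    ← lintegral_indicator hs, ← lintegral_indicator ((continuous_flow τ).measurable hs)]
  refine (lintegral_congr fun ξ => ?_).trans (h.trans (lintegral_congr fun ξ => ?_))
  · by_cases h' : flow τ ξ ∈ s <;> simp [Set.indicator, h']
  · by_cases h' : ξ ∈ s <;> simp [h']

/-- The density is positive off the null set `{0}`, so Lebesgue measure and the invariant measure
have the same null sets. Composition with the flow is thus well defined on almost-everywhere
classes. -/
theorem volume_ac_invMeasure {ν : ℕ} (hν : 0 < ν) :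
    (volume : Measure (X ν)) ≪ invMeasure ν := by
  apply withDensity_absolutelyContinuous' measurable_invDens.aemeasurable
  filter_upwards [ae_ne_zero hν] with ξ hξ
  simpa using dens_pos hξ

theorem invMeasure_ac_volume (ν : ℕ) : invMeasure ν ≪ (volume : Measure (X ν)) :=
  withDensity_absolutelyContinuous _ _

theorem quasiMeasurePreserving_flow {ν : ℕ} (hν : 0 < ν) (τ : ℝ) :
    Measure.QuasiMeasurePreserving (flow τ) (volume : Measure (X ν)) volume :=
  ((measurePreserving_flow hν τ).quasiMeasurePreserving.mono
    (volume_ac_invMeasure hν) (invMeasure_ac_volume ν))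

end

section

/-! ### Weighted transport operators -/

/-- The weight `(1 + |ξ|²)^{s/2}`. -/
def wt {ν : ℕ} (s : ℝ) (ξ : X ν) : ℝ := (1 + ‖ξ‖ ^ 2) ^ (s / 2)

theorem wt_base_pos {ν : ℕ} (ξ : X ν) : 0 < 1 + ‖ξ‖ ^ 2 := by positivity

theorem wt_pos {ν : ℕ} (s : ℝ) (ξ : X ν) : 0 < wt s ξ := Real.rpow_pos_of_pos (wt_base_pos ξ) _

@[simp] theorem wt_zero {ν : ℕ} (ξ : X ν) : wt 0 ξ = 1 := by simp [wt]

theorem wt_neg {ν : ℕ} (s : ℝ) (ξ : X ν) : wt (-s) ξ = (wt s ξ)⁻¹ := by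
  rw [wt, wt, neg_div, Real.rpow_neg (wt_base_pos ξ).le]

theorem contDiff_wt {ν : ℕ} (s : ℝ) : ContDiff ℝ ∞ (wt s : X ν → ℝ) := by
  unfold wt
  exact ContDiff.rpow_const_of_ne (contDiff_const.add (contDiff_norm_sq ℝ))
    fun ξ => (wt_base_pos ξ).ne'

theorem hasTemperateGrowth_wt {ν : ℕ} (s : ℝ) :
    Function.HasTemperateGrowth (wt s : X ν → ℝ) :=
  Function.hasTemperateGrowth_one_add_norm_sq_rpow _ _

/-- The ratio `(1 + |flow|²) / (1 + |ξ|²)` is at most `e^{2|τ|}`. -/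
theorem one_add_norm_flow_le {ν : ℕ} (τ : ℝ) (ξ : X ν) :
    1 + ‖flow τ ξ‖ ^ 2 ≤ Real.exp (2 * |τ|) * (1 + ‖ξ‖ ^ 2) := by
  have h := norm_flow_le τ ξ
  have h1 : (1 : ℝ) ≤ Real.exp |τ| := Real.one_le_exp (abs_nonneg _)
  have h2 : Real.exp (2 * |τ|) = Real.exp |τ| ^ 2 := by
    rw [← Real.exp_nat_mul]; norm_num
  have h3 : ‖flow τ ξ‖ ^ 2 ≤ (Real.exp |τ| * ‖ξ‖) ^ 2 :=
    pow_le_pow_left₀ (norm_nonneg _) h 2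
  rw [h2]
  nlinarith

theorem wt_flow_le {ν : ℕ} {s : ℝ} (hs : 0 ≤ s) (τ : ℝ) (ξ : X ν) :
    wt s (flow τ ξ) ≤ Real.exp (s * |τ|) * wt s ξ := by
  have h := Real.rpow_le_rpow (by positivity) (one_add_norm_flow_le τ ξ)
    (by positivity : 0 ≤ s / 2)
  rw [Real.mul_rpow (Real.exp_pos _).le (wt_base_pos ξ).le, ← Real.exp_mul] at h
  have e : 2 * |τ| * (s / 2) = s * |τ| := by ring
  rwa [e] at h

/-- For `s ≥ 0` the growth bound is used along the inverse flow, for `s ≤ 0` along the flow itself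
with exponent `-s`. -/
theorem wt_div_wt_flow_le {ν : ℕ} (s τ : ℝ) (ξ : X ν) :
    wt s ξ / wt s (flow τ ξ) ≤ Real.exp (|s| * |τ|) := by
  rw [div_le_iff₀ (wt_pos _ _)]
  rcases le_total 0 s with hs | hs
  · have h := wt_flow_le hs (-τ) (flow τ ξ)
    rw [flow_flow, neg_add_cancel, flow_zero_left, abs_neg] at h
    rwa [abs_of_nonneg hs]
  · have h := wt_flow_le (neg_nonneg.2 hs) τ ξ
    rw [wt_neg, wt_neg, inv_le_iff_one_le_mul₀ (wt_pos _ _)] at h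
    rw [abs_of_nonpos hs]
    have h' := mul_le_mul_of_nonneg_right h (wt_pos s ξ).le
    rw [one_mul] at h'
    have e : Real.exp (-s * |τ|) * (wt s ξ)⁻¹ * wt s (flow τ ξ) * wt s ξ =
      Real.exp (-s * |τ|) * wt s (flow τ ξ) := by
      field_simp [(wt_pos s ξ).ne']
    rwa [e] at h'

/-- The weight whose coboundary defines the transport operators. -/
def cobWeight {ν : ℕ} (s : ℝ) (ξ : X ν) : ℝ := wt s ξ / Real.sqrt (dens ξ)

theorem cobWeight_pos {ν : ℕ} (s : ℝ) {ξ : X ν} (h : ξ ≠ 0) : 0 < cobWeight s ξ :=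
  div_pos (wt_pos _ _) (Real.sqrt_pos.2 (dens_pos h))

theorem contDiffAt_cobWeight {ν : ℕ} (s : ℝ) {ξ : X ν} (h : ξ ≠ 0) :
    ContDiffAt ℝ ∞ (cobWeight s : X ν → ℝ) ξ :=
  (contDiff_wt s).contDiffAt.div ((contDiffAt_dens h).sqrt (dens_pos h).ne')
    (Real.sqrt_pos.2 (dens_pos h)).ne'

/-- The multiplier of the transport operator. -/
def ratio {ν : ℕ} (s τ : ℝ) (ξ : X ν) : ℝ := cobWeight s ξ / cobWeight s (flow (-τ) ξ)

theorem measurable_ratio {ν : ℕ} (s τ : ℝ) : Measurable (ratio s τ : X ν → ℝ) := by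
  have h : Measurable (cobWeight s : X ν → ℝ) :=
    (contDiff_wt s).continuous.measurable.div continuous_dens.measurable.sqrt
  exact h.div (h.comp (continuous_flow _).measurable)

/-- The Jacobian of the flow. -/
def jac {ν : ℕ} (τ : ℝ) (ξ : X ν) : ℝ := dens (flow τ ξ) / dens ξ

theorem measurable_jac {ν : ℕ} (τ : ℝ) : Measurable (jac τ : X ν → ℝ) :=
  (continuous_dens.measurable.comp (continuous_flow _).measurable).div continuous_dens.measurable

theorem jac_nonneg {ν : ℕ} (τ : ℝ) (ξ : X ν) : 0 ≤ jac τ ξ :=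
  div_nonneg (dens_nonneg _) (dens_nonneg _)

theorem ratio_nonneg {ν : ℕ} (s τ : ℝ) (ξ : X ν) : 0 ≤ ratio s τ ξ := by
  have h : ∀ ξ : X ν, 0 ≤ cobWeight s ξ := fun ξ => div_nonneg (wt_pos _ _).le (Real.sqrt_nonneg _)
  exact div_nonneg (h _) (h _)

/-- The multiplier splits into a quotient of weights, bounded by `e^{|s||τ|}`, and the square root
of the Jacobian of the backward flow, which makes the case `s = 0` unitary. -/
theorem ratio_eq {ν : ℕ} (s τ : ℝ) (ξ : X ν) :
    ratio s τ ξ = wt s ξ / wt s (flow (-τ) ξ) * Real.sqrt (jac (-τ) ξ) := by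
  rw [ratio, cobWeight, cobWeight, jac, Real.sqrt_div (dens_nonneg _)]
  rw [div_div_div_eq, mul_comm (√(dens ξ)), mul_div_mul_comm]

theorem ratio_sq_le {ν : ℕ} (s τ : ℝ) (ξ : X ν) :
    ratio s τ ξ ^ 2 ≤ Real.exp (|s| * |τ|) ^ 2 * jac (-τ) ξ := by
  rw [ratio_eq, mul_pow, Real.sq_sqrt (jac_nonneg _ _)]
  apply mul_le_mul_of_nonneg_right _ (jac_nonneg _ _)
  apply pow_le_pow_left₀ (div_pos (wt_pos _ _) (wt_pos _ _)).le
  simpa using wt_div_wt_flow_le s (-τ) ξ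

variable {ν : ℕ} [NeZero ν]

/-- Invariance under the flow, applied to `dens · f`: this is the change of variables with Jacobian
`jac`. -/
theorem lintegral_jac (τ : ℝ) {f : X ν → ℝ≥0∞} (hf : Measurable f) :
    ∫⁻ ξ, ENNReal.ofReal (jac τ ξ) * f (flow τ ξ) = ∫⁻ ξ, f ξ := by
  have h := lintegral_flow (NeZero.pos ν) τ
    (f := fun ξ => ENNReal.ofReal (dens ξ) * f ξ)
    (continuous_dens.measurable.ennreal_ofReal.mul hf)
  refine Eq.trans (lintegral_congr fun ξ => ?_) (h.trans (lintegral_congr_ae ?_))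
  · rw [← mul_assoc, ← ENNReal.ofReal_mul (inv_nonneg.2 (dens_nonneg _)), jac, div_eq_inv_mul]
  · filter_upwards [ae_ne_zero (NeZero.pos ν)] with ξ hξ
    rw [← mul_assoc, ← ENNReal.ofReal_mul (inv_nonneg.2 (dens_nonneg _)),
      inv_mul_cancel₀ (dens_pos hξ).ne']
    simp

theorem map_jac (τ : ℝ) :
    ((volume : Measure (X ν)).withDensity fun ξ => ENNReal.ofReal (jac τ ξ)).map (flow τ) =
      volume := by
  refine Measure.ext fun s hs => ?_
  have hm := (continuous_flow τ : Continuous (flow τ : X ν → X ν)).measurable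
  rw [Measure.map_apply hm hs, withDensity_apply _ (hm hs), ← lintegral_indicator (hm hs)]
  have h := lintegral_jac τ (f := s.indicator 1) (measurable_one.indicator hs)
  rw [lintegral_indicator_one hs] at h
  rw [← h]
  refine lintegral_congr fun ξ => ?_
  by_cases h' : flow τ ξ ∈ s <;> simp [Set.indicator, h']

theorem integral_jac (τ : ℝ) {f : X ν → ℂ} (hf : AEStronglyMeasurable f volume) :
    ∫ ξ, jac τ ξ • f (flow τ ξ) = ∫ ξ, f ξ := by
  have hm := (continuous_flow τ : Continuous (flow τ : X ν → X ν)).measurable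
  conv_rhs => rw [← map_jac (ν := ν) τ]
  rw [integral_map hm.aemeasurable (by rwa [map_jac]),
    integral_withDensity_eq_integral_toReal_smul (measurable_jac τ).ennreal_ofReal
      (by simp)]
  simp [ENNReal.toReal_ofReal (jac_nonneg _ _)]

theorem lintegral_jac_of_aemeasurable (τ : ℝ) {f : X ν → ℝ≥0∞} (hf : AEMeasurable f volume) :
    ∫⁻ ξ, ENNReal.ofReal (jac τ ξ) * f (flow τ ξ) = ∫⁻ ξ, f ξ := by
  rw [lintegral_congr_ae hf.ae_eq_mk, ← lintegral_jac τ hf.measurable_mk]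
  apply lintegral_congr_ae
  filter_upwards [(quasiMeasurePreserving_flow (NeZero.pos ν) τ).ae hf.ae_eq_mk] with ξ hξ
  rw [hξ]

/-- The weighted transport of a function along the flow. -/
def transportFun {ν : ℕ} (s τ : ℝ) (F : X ν → ℂ) (ξ : X ν) : ℂ :=
  (ratio s τ ξ : ℂ) * F (flow (-τ) ξ)

theorem aestronglyMeasurable_transportFun (s τ : ℝ) {F : X ν → ℂ}
    (hF : AEStronglyMeasurable F volume) : AEStronglyMeasurable (transportFun s τ F) volume :=
  ((Complex.measurable_ofReal.comp (measurable_ratio s τ)).aestronglyMeasurable).mul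
    (hF.comp_quasiMeasurePreserving (quasiMeasurePreserving_flow (NeZero.pos ν) (-τ)))

theorem transportFun_congr (s τ : ℝ) {F G : X ν → ℂ} (h : F =ᵐ[volume] G) :
    transportFun s τ F =ᵐ[volume] transportFun s τ G := by
  filter_upwards [(quasiMeasurePreserving_flow (NeZero.pos ν) (-τ)).ae h] with ξ hξ
  simp [transportFun, hξ]

/-- The Jacobian inside the squared multiplier is absorbed by the change of variables; only the
quotient of weights remains. -/
theorem eLpNorm_transportFun_le (s τ : ℝ) {F : X ν → ℂ} (hF : AEStronglyMeasurable F volume) :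
    eLpNorm (transportFun s τ F) 2 volume ≤
      ENNReal.ofReal (Real.exp (|s| * |τ|)) * eLpNorm F 2 volume := by
  have key : ∫⁻ ξ, ‖transportFun s τ F ξ‖ₑ ^ (2 : ℝ) ≤
      ENNReal.ofReal (Real.exp (|s| * |τ|)) ^ (2 : ℝ) * ∫⁻ ξ, ‖F ξ‖ₑ ^ (2 : ℝ) := by
    have hF2 : AEMeasurable (fun ξ => ‖F ξ‖ₑ ^ (2 : ℝ)) volume := hF.enorm.pow_const _
    rw [← lintegral_jac_of_aemeasurable (-τ) hF2, ← lintegral_const_mul' _ _ (by simp)]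
    apply lintegral_mono
    intro ξ
    simp only [transportFun, enorm_mul]
    rw [ENNReal.mul_rpow_of_nonneg _ _ (by norm_num), ← mul_assoc]
    gcongr
    rw [← ofReal_norm, Complex.norm_real, Real.norm_of_nonneg (ratio_nonneg _ _ _),
      ENNReal.ofReal_rpow_of_nonneg (ratio_nonneg _ _ _) (by norm_num),
      ENNReal.ofReal_rpow_of_nonneg (Real.exp_pos _).le (by norm_num),
      ← ENNReal.ofReal_mul (by positivity)]
    apply ENNReal.ofReal_le_ofReal
    exact_mod_cast ratio_sq_le s τ ξ
  rw [eLpNorm_eq_lintegral_rpow_enorm_toReal (by norm_num) (by norm_num),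
    eLpNorm_eq_lintegral_rpow_enorm_toReal (by norm_num) (by norm_num)]
  simp only [ENNReal.toReal_ofNat]
  calc _ ≤ (ENNReal.ofReal (Real.exp (|s| * |τ|)) ^ (2 : ℝ) *
        ∫⁻ ξ, ‖F ξ‖ₑ ^ (2 : ℝ)) ^ ((1 : ℝ) / 2) := by gcongr
    _ = _ := by
      rw [ENNReal.mul_rpow_of_nonneg _ _ (by norm_num), ← ENNReal.rpow_mul]
      norm_num

theorem memLp_transportFun (s τ : ℝ) {F : X ν → ℂ} (hF : MemLp F 2 volume) :
    MemLp (transportFun s τ F) 2 volume :=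
  ⟨aestronglyMeasurable_transportFun s τ hF.1,
    (eLpNorm_transportFun_le s τ hF.1).trans_lt (ENNReal.mul_lt_top (by simp) hF.2)⟩

/-- The weighted transport along the flow, as a linear map in `L²`. -/
def transportLM (s τ : ℝ) : L2 ν →ₗ[ℂ] L2 ν where
  toFun F := (memLp_transportFun s τ (Lp.memLp F)).toLp _
  map_add' F G := by
    rw [← MemLp.toLp_add, MemLp.toLp_eq_toLp_iff]
    refine (transportFun_congr s τ (Lp.coeFn_add F G)).trans (Eventually.of_forall fun ξ => ?_)
    simp [transportFun, mul_add]
  map_smul' c F := by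
    rw [RingHom.id_apply, ← MemLp.toLp_const_smul, MemLp.toLp_eq_toLp_iff]
    refine (transportFun_congr s τ (Lp.coeFn_smul c F)).trans (Eventually.of_forall fun ξ => ?_)
    simp [transportFun, mul_left_comm]

theorem norm_transportLM_le (s τ : ℝ) (F : L2 ν) :
    ‖transportLM s τ F‖ ≤ Real.exp (|s| * |τ|) * ‖F‖ := by
  have h := eLpNorm_transportFun_le s τ (Lp.memLp F).1
  have h2 : ‖transportLM s τ F‖ = (eLpNorm (transportFun s τ F) 2 volume).toReal :=
    Lp.norm_toLp _ (memLp_transportFun s τ (Lp.memLp F))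
  rw [h2, Lp.norm_def, ← ENNReal.toReal_ofReal (Real.exp_pos (|s| * |τ|)).le,
    ← ENNReal.toReal_mul]
  exact ENNReal.toReal_mono (ENNReal.mul_ne_top (by simp) (Lp.eLpNorm_ne_top F)) h

/-- The weighted transport along the flow, as a bounded operator in `L²`. -/
def transport (s τ : ℝ) : L2 ν →L[ℂ] L2 ν :=
  (transportLM s τ).mkContinuous (Real.exp (|s| * |τ|)) (norm_transportLM_le s τ)

theorem coeFn_transport (s τ : ℝ) (F : L2 ν) :
    transport s τ F =ᵐ[volume] transportFun s τ F :=
  (memLp_transportFun s τ (Lp.memLp F)).coeFn_toLp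

theorem transport_toLp (s τ : ℝ) {F : X ν → ℂ} (hF : MemLp F 2 volume) :
    transport s τ hF.toLp = (memLp_transportFun s τ hF).toLp := by
  apply Lp.ext
  exact (coeFn_transport s τ _).trans ((transportFun_congr s τ hF.coeFn_toLp).trans
    (memLp_transportFun s τ hF).coeFn_toLp.symm)

theorem norm_transport_le (s τ : ℝ) : ‖(transport s τ : L2 ν →L[ℂ] L2 ν)‖ ≤
    Real.exp (|s| * |τ|) :=
  LinearMap.mkContinuous_norm_le _ (Real.exp_pos _).le _

theorem ratio_zero {ν : ℕ} (s : ℝ) {ξ : X ν} (h : ξ ≠ 0) :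
    ratio s 0 ξ = 1 := by
  simp [ratio, (cobWeight_pos s h).ne']

theorem transport_zero (s : ℝ) : transport s 0 = ContinuousLinearMap.id ℂ (L2 ν) := by
  ext1 F
  apply Lp.ext
  refine (coeFn_transport s 0 F).trans ?_
  filter_upwards [ae_ne_zero (NeZero.pos ν)] with ξ hξ
  simp [transportFun, ratio_zero s hξ]

/-- A coboundary satisfies the cocycle identity by telescoping. The intermediate weight must not
vanish, hence `ξ ≠ 0`. -/
theorem ratio_mul_ratio {ν : ℕ} (s σ τ : ℝ) {ξ : X ν} (h : ξ ≠ 0) :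
    ratio s σ ξ * ratio s τ (flow (-σ) ξ) = ratio s (σ + τ) ξ := by
  have h1 := (cobWeight_pos s (flow_ne_zero (-σ) h)).ne'
  rw [ratio, ratio, ratio, flow_flow, div_mul_div_cancel₀ h1]
  congr 3
  ring

theorem transportFun_transportFun {ν : ℕ} (s σ τ : ℝ) (F : X ν → ℂ) {ξ : X ν} (h : ξ ≠ 0) :
    transportFun s σ (transportFun s τ F) ξ = transportFun s (σ + τ) F ξ := by
  simp only [transportFun]
  rw [← mul_assoc, ← Complex.ofReal_mul, ratio_mul_ratio s σ τ h, flow_flow]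
  congr 3
  ring

theorem transport_add (s σ τ : ℝ) :
    (transport s (σ + τ) : L2 ν →L[ℂ] L2 ν) = (transport s σ).comp (transport s τ) := by
  ext1 F
  apply Lp.ext
  refine (coeFn_transport s _ F).trans ?_
  refine EventuallyEq.trans ?_ (coeFn_transport s σ _).symm
  refine EventuallyEq.trans ?_ (transportFun_congr s σ (coeFn_transport s τ F).symm)
  filter_upwards [ae_ne_zero (NeZero.pos ν)] with ξ hξ
  exact (transportFun_transportFun s σ τ F hξ).symm

theorem jac_mul_ratio {ν : ℕ} (s τ : ℝ) {ξ : X ν} (h : ξ ≠ 0) :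
    jac (-τ) ξ * ratio (-s) (-τ) (flow (-τ) ξ) = ratio s τ ξ := by
  have h' := flow_ne_zero (-τ) h
  rw [ratio, ratio, jac, flow_flow, neg_neg, add_neg_cancel, flow_zero_left]
  simp only [cobWeight, wt_neg]
  have e1 := Real.mul_self_sqrt (dens_pos h).le
  have e2 := Real.mul_self_sqrt (dens_pos h').le
  have p1 := Real.sqrt_pos.2 (dens_pos h)
  have p2 := Real.sqrt_pos.2 (dens_pos h')
  have p3 := wt_pos s ξ
  have p4 := wt_pos s (flow (-τ) ξ)
  have p5 := dens_pos h
  field_simp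
  rw [sq, sq, e1, e2, mul_comm]

/-- The change of variables `ξ ↦ flow (-τ) ξ` turns the multiplier of weight `s` into that of weight
`-s` at time `-τ`. This is the duality between the groups in `H^1` and `H^{-1}`. -/
theorem inner_transport (s τ : ℝ) (F G : L2 ν) :
    inner ℂ (transport s τ F) G = inner ℂ F (transport (-s) (-τ) G) := by
  rw [L2.inner_def, L2.inner_def]
  rw [← integral_jac (-τ) (f := fun ξ => inner ℂ (F ξ) (transport (-s) (-τ) G ξ))
    ((Lp.memLp F).1.inner (Lp.memLp _).1)]
  apply integral_congr_ae
  filter_upwards [coeFn_transport s τ F, ae_ne_zero (NeZero.pos ν),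
    (quasiMeasurePreserving_flow (NeZero.pos ν) (-τ)).ae (coeFn_transport (-s) (-τ) G)]
    with ξ h1 h2 h3
  rw [h1, h3, transportFun, transportFun, flow_flow, neg_neg, add_neg_cancel, flow_zero_left,
    ← jac_mul_ratio s τ h2]
  simp only [RCLike.inner_apply, map_mul, Complex.conj_ofReal, Complex.ofReal_mul,
    Complex.real_smul]
  ring

/-- For `s = 0` the adjoint is the inverse. -/
theorem norm_transport_zero (τ : ℝ) (F : L2 ν) : ‖transport 0 τ F‖ = ‖F‖ := by
  have h := inner_transport 0 τ F (transport 0 τ F)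
  rw [← ContinuousLinearMap.comp_apply, neg_zero, ← transport_add, neg_add_cancel, transport_zero,
    ContinuousLinearMap.id_apply] at h
  rw [inner_self_eq_norm_sq_to_K, inner_self_eq_norm_sq_to_K] at h
  have h' : ‖transport 0 τ F‖ ^ 2 = ‖F‖ ^ 2 := by exact_mod_cast h
  exact (pow_left_inj₀ (norm_nonneg _) (norm_nonneg _) (by norm_num)).1 h'

end

section

/-! ### Smooth functions supported in an annulus -/

/-- Smooth functions supported in a closed annulus around the origin. -/
structure IsAnnular {ν : ℕ} (F : X ν → ℂ) : Prop where
  contDiff : ContDiff ℝ ∞ F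
  supp : ∃ r₀ : ℝ, 0 < r₀ ∧ ∃ r₁ : ℝ, ∀ ξ, F ξ ≠ 0 → r₀ ≤ ‖ξ‖ ∧ ‖ξ‖ ≤ r₁

namespace IsAnnular

variable {ν : ℕ} {F G : X ν → ℂ}

theorem hasCompactSupport (hF : IsAnnular F) : HasCompactSupport F := by
  obtain ⟨r₀, -, r₁, h⟩ := hF.supp
  apply HasCompactSupport.of_support_subset_isCompact (isCompact_closedBall (0 : X ν) r₁)
  intro ξ hξ
  simpa using (h ξ hξ).2

theorem memLp (hF : IsAnnular F) (p : ℝ≥0∞) : MemLp F p volume :=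
  hF.contDiff.continuous.memLp_of_hasCompactSupport hF.hasCompactSupport

theorem eventually_eq_zero (hF : IsAnnular F) : ∀ᶠ ξ in 𝓝 (0 : X ν), F ξ = 0 := by
  obtain ⟨r₀, h0, r₁, h⟩ := hF.supp
  filter_upwards [Metric.ball_mem_nhds (0 : X ν) h0] with ξ hξ
  by_contra hne
  have := (h ξ hne).1
  rw [mem_ball_zero_iff] at hξ
  linarith

theorem apply_zero (hF : IsAnnular F) : F 0 = 0 := hF.eventually_eq_zero.self_of_nhds

/-- An element of `L²` given by an annular function. -/
def toL2 (hF : IsAnnular F) : L2 ν := (hF.memLp 2).toLp F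

theorem coeFn_toL2 (hF : IsAnnular F) : (hF.toL2 : X ν → ℂ) =ᵐ[volume] F :=
  (hF.memLp 2).coeFn_toLp

theorem of_contDiffAt (hG : ∀ ξ, ξ ≠ 0 → ContDiffAt ℝ ∞ G ξ)
    (hs : ∃ r₀ : ℝ, 0 < r₀ ∧ ∃ r₁ : ℝ, ∀ ξ, G ξ ≠ 0 → r₀ ≤ ‖ξ‖ ∧ ‖ξ‖ ≤ r₁) : IsAnnular G := by
  refine ⟨?_, hs⟩
  rw [contDiff_iff_contDiffAt]
  intro ξ
  by_cases h : ξ = 0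
  · obtain ⟨r₀, h0, r₁, hs⟩ := hs
    subst h
    have : G =ᶠ[𝓝 0] fun _ => 0 := by
      filter_upwards [Metric.ball_mem_nhds (0 : X ν) h0] with ξ hξ
      by_contra hne
      have := (hs ξ hne).1
      rw [mem_ball_zero_iff] at hξ
      linarith
    exact contDiffAt_const.congr_of_eventuallyEq this
  · exact hG ξ h

theorem mul_left (hF : IsAnnular F) {m : X ν → ℂ} (hm : ∀ ξ, ξ ≠ 0 → ContDiffAt ℝ ∞ m ξ) :
    IsAnnular fun ξ => m ξ * F ξ := by
  refine of_contDiffAt (fun ξ h => (hm ξ h).mul hF.contDiff.contDiffAt) ?_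
  obtain ⟨r₀, h0, r₁, h⟩ := hF.supp
  exact ⟨r₀, h0, r₁, fun ξ hξ => h ξ (right_ne_zero_of_mul hξ)⟩

theorem ofReal_mul (hF : IsAnnular F) {m : X ν → ℝ} (hm : ∀ ξ, ξ ≠ 0 → ContDiffAt ℝ ∞ m ξ) :
    IsAnnular fun ξ => (m ξ : ℂ) * F ξ :=
  hF.mul_left fun ξ h => Complex.ofRealCLM.contDiff.contDiffAt.comp ξ (hm ξ h)

theorem add (hF : IsAnnular F) (hG : IsAnnular G) : IsAnnular fun ξ => F ξ + G ξ := by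
  refine ⟨hF.contDiff.add hG.contDiff, ?_⟩
  obtain ⟨r₀, h0, r₁, h⟩ := hF.supp
  obtain ⟨r₀', h0', r₁', h'⟩ := hG.supp
  refine ⟨min r₀ r₀', lt_min h0 h0', max r₁ r₁', fun ξ hξ => ?_⟩
  by_cases hz : F ξ = 0
  · have := h' ξ (by intro h2; simp [hz, h2] at hξ)
    exact ⟨(min_le_right _ _).trans this.1, this.2.trans (le_max_right _ _)⟩
  · have := h ξ hz
    exact ⟨(min_le_left _ _).trans this.1, this.2.trans (le_max_left _ _)⟩

theorem const_mul (hF : IsAnnular F) (c : ℂ) : IsAnnular fun ξ => c * F ξ :=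
  hF.mul_left fun _ _ => contDiffAt_const

theorem neg (hF : IsAnnular F) : IsAnnular fun ξ => -F ξ := by
  simpa using hF.const_mul (-1)

theorem fderiv_apply (hF : IsAnnular F) {v : X ν → X ν} (hv : ContDiff ℝ ∞ v) :
    IsAnnular fun ξ => fderiv ℝ F ξ (v ξ) := by
  refine ⟨(hF.contDiff.fderiv_right (m := ∞) (by simp)).clm_apply hv, ?_⟩
  obtain ⟨r₀, h0, r₁, h⟩ := hF.supp
  refine ⟨r₀, h0, r₁, fun ξ hξ => ?_⟩
  have hcl : IsClosed {η : X ν | r₀ ≤ ‖η‖ ∧ ‖η‖ ≤ r₁} :=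
    (isClosed_le continuous_const continuous_norm).inter
      (isClosed_le continuous_norm continuous_const)
  have hts : tsupport F ⊆ {η : X ν | r₀ ≤ ‖η‖ ∧ ‖η‖ ≤ r₁} := closure_minimal h hcl
  apply hts
  apply support_fderiv_subset ℝ
  intro h2
  simp [h2] at hξ

theorem comp_flow (hF : IsAnnular F) (τ : ℝ) : IsAnnular fun ξ => F (flow τ ξ) := by
  refine of_contDiffAt (fun ξ h => ?_) ?_
  · have h2 : ContDiffAt ℝ ∞ (fun η : X ν => ((τ, η) : ℝ × X ν)) ξ := by fun_prop
    exact hF.contDiff.contDiffAt.comp ξ (ContDiffAt.comp (f := fun η : X ν => ((τ, η) : ℝ × X ν))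
      ξ (contDiffAt_flow τ h) h2)
  · obtain ⟨r₀, h0, r₁, h⟩ := hF.supp
    refine ⟨Real.exp (-|τ|) * r₀, by positivity, Real.exp |τ| * r₁, fun ξ hξ => ?_⟩
    obtain ⟨h1, h2⟩ := h _ hξ
    constructor
    · rw [Real.exp_neg, inv_mul_le_iff₀ (Real.exp_pos _)]
      exact h1.trans (norm_flow_le τ ξ)
    · have := (le_norm_flow τ ξ).trans h2
      rwa [Real.exp_neg, inv_mul_le_iff₀ (Real.exp_pos _)] at this

theorem div_cobWeight (hF : IsAnnular F) (s : ℝ) :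
    IsAnnular fun ξ => ((cobWeight s ξ)⁻¹ : ℝ) * F ξ :=
  hF.ofReal_mul fun _ h => (contDiffAt_cobWeight s h).inv (cobWeight_pos s h).ne'

theorem transportFun_eq (s τ : ℝ) (F : X ν → ℂ) :
    transportFun s τ F = fun ξ => (cobWeight s ξ : ℂ) *
      (((cobWeight s (flow (-τ) ξ))⁻¹ : ℝ) * F (flow (-τ) ξ)) := by
  ext ξ
  rw [transportFun, ratio, ← mul_assoc, ← Complex.ofReal_mul, div_eq_mul_inv]

theorem transportFun (hF : IsAnnular F) (s τ : ℝ) : IsAnnular (transportFun s τ F) := by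
  rw [transportFun_eq]
  exact ((hF.div_cobWeight s).comp_flow (-τ)).ofReal_mul fun _ h => contDiffAt_cobWeight s h

end IsAnnular

/-- The constant is the `L²` norm of the indicator function of the ball. It depends on `R` only, so
pointwise estimates uniform in `τ` become `L²` estimates. -/
theorem norm_toLp_le_of_support {ν : ℕ} (R : ℝ) : ∃ c : ℝ, 0 ≤ c ∧ ∀ (f : L2 ν) (M : ℝ), 0 ≤ M →
    (∀ᵐ ξ, ‖f ξ‖ ≤ M) → (∀ᵐ ξ, R < ‖ξ‖ → f ξ = 0) → ‖f‖ ≤ M * c := by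
  have hfin : volume (Metric.closedBall (0 : X ν) R) ≠ ⊤ :=
    (isCompact_closedBall (0 : X ν) R).measure_lt_top.ne
  refine ⟨‖indicatorConstLp 2 (measurableSet_closedBall (x := (0 : X ν)) (ε := R)) hfin (1 : ℂ)‖,
    norm_nonneg _, fun f M hM h1 h2 => ?_⟩
  apply Lp.norm_le_mul_norm_of_ae_le_mul
  filter_upwards [h1, h2, indicatorConstLp_coeFn (p := 2)
    (hs := measurableSet_closedBall (x := (0 : X ν)) (ε := R)) (hμs := hfin) (c := (1 : ℂ))]
    with ξ h1 h2 h3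
  rw [h3]
  by_cases h : ξ ∈ Metric.closedBall (0 : X ν) R
  · simpa [h] using h1
  · rw [h2 (by simpa using h)]
    simp [h]

/-- A smooth family of functions supported in a fixed ball is differentiable in `L²`. -/
theorem hasDerivAt_toLp_of_contDiff {ν : ℕ} {H : ℝ × X ν → ℂ} (hH : ContDiff ℝ 2 H) {R : ℝ}
    (hR : ∀ τ ξ, |τ| ≤ 1 → R < ‖ξ‖ → H (τ, ξ) = 0) {f : ℝ → L2 ν} {f' : L2 ν}
    (hf : ∀ τ, f τ =ᵐ[volume] fun ξ => H (τ, ξ))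
    (hf' : f' =ᵐ[volume] fun ξ => fderiv ℝ H (0, ξ) (1, 0)) : HasDerivAt f f' 0 := by
  set g : ℝ × X ν → ℂ := fun p => fderiv ℝ H p (1, 0) with hg
  have hgd : ContDiff ℝ 1 g := (hH.fderiv_right (m := 1) (by norm_num)).clm_apply contDiff_const
  have hderiv : ∀ τ ξ, HasDerivAt (fun τ => H (τ, ξ)) (g (τ, ξ)) τ := by
    intro τ ξ
    have h1 := (hH.differentiable (by norm_num) (τ, ξ)).hasFDerivAt
    have h2 : HasDerivAt (fun τ : ℝ => (τ, ξ)) ((1 : ℝ), (0 : X ν)) τ :=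
      (hasDerivAt_id τ).prodMk (hasDerivAt_const τ ξ)
    exact h1.comp_hasDerivAt τ h2
  have hderiv2 : ∀ τ ξ, HasDerivAt (fun τ => g (τ, ξ)) (fderiv ℝ g (τ, ξ) (1, 0)) τ := by
    intro τ ξ
    have h1 := (hgd.differentiable (by norm_num) (τ, ξ)).hasFDerivAt
    have h2 : HasDerivAt (fun τ : ℝ => (τ, ξ)) ((1 : ℝ), (0 : X ν)) τ :=
      (hasDerivAt_id τ).prodMk (hasDerivAt_const τ ξ)
    exact h1.comp_hasDerivAt τ h2
  obtain ⟨M, hM⟩ := ((isCompact_Icc (a := (-1 : ℝ)) (b := 1)).prod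
    (isCompact_closedBall (0 : X ν) R)).exists_bound_of_continuousOn
      (f := fun p => fderiv ℝ g p (1, 0))
      ((hgd.continuous_fderiv (by norm_num)).clm_apply continuous_const).continuousOn
  have hM' : ∀ τ ξ, |τ| ≤ 1 → ‖ξ‖ ≤ R → ‖fderiv ℝ g (τ, ξ) (1, 0)‖ ≤ |M| := by
    intro τ ξ h1 h2
    exact (hM (τ, ξ) ⟨abs_le.1 h1, by simpa using h2⟩).trans (le_abs_self _)
  have hg1 : ∀ τ ξ, |τ| ≤ 1 → ‖ξ‖ ≤ R → ‖g (τ, ξ) - g (0, ξ)‖ ≤ |M| * |τ| := by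
    intro τ ξ h1 h2
    have := (convex_uIcc (0 : ℝ) τ).norm_image_sub_le_of_norm_hasDerivWithin_le
      (f := fun τ => g (τ, ξ)) (f' := fun τ => fderiv ℝ g (τ, ξ) (1, 0)) (C := |M|)
      (x := 0) (y := τ)
      (fun t _ => (hderiv2 t ξ).hasDerivWithinAt)
      (fun t ht => hM' t ξ (by
        have := Set.abs_sub_left_of_mem_uIcc ht
        simp only [sub_zero] at this
        exact this.trans h1) h2) Set.left_mem_uIcc Set.right_mem_uIcc
    simpa using this
  -- Second-order Taylor remainder: the mean value inequality for `t ↦ H(t,ξ) - t g(0,ξ)`, whose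
  -- derivative `g(t,ξ) - g(0,ξ)` has just been bounded by `|M||τ|`.
  have hmain : ∀ τ ξ, |τ| ≤ 1 → ‖ξ‖ ≤ R →
      ‖H (τ, ξ) - H (0, ξ) - τ • g (0, ξ)‖ ≤ |M| * |τ| * |τ| := by
    intro τ ξ h1 h2
    have := (convex_uIcc (0 : ℝ) τ).norm_image_sub_le_of_norm_hasDerivWithin_le
      (f := fun t => H (t, ξ) - t • g (0, ξ)) (f' := fun t => g (t, ξ) - g (0, ξ))
      (C := |M| * |τ|) (x := 0) (y := τ)
      (fun t _ => by
        have h3 := (hderiv t ξ).sub ((hasDerivAt_id t).smul_const (g (0, ξ)))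
        rw [one_smul] at h3
        exact h3.hasDerivWithinAt)
      (fun t ht => by
        have h3 := Set.abs_sub_left_of_mem_uIcc ht
        simp only [sub_zero] at h3
        exact (hg1 t ξ (h3.trans h1) h2).trans (by gcongr)) Set.left_mem_uIcc Set.right_mem_uIcc
    simp only [zero_smul, sub_zero, Real.norm_eq_abs] at this
    rw [sub_right_comm]
    exact this
  have hout : ∀ ξ, R < ‖ξ‖ → g (0, ξ) = 0 := by
    intro ξ hξ
    have h1 : (fun τ => H (τ, ξ)) =ᶠ[𝓝 0] fun _ => 0 := by
      filter_upwards [Metric.ball_mem_nhds (0 : ℝ) one_pos] with τ hτ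
      rw [mem_ball_zero_iff] at hτ
      exact hR τ ξ hτ.le hξ
    have h2 := (hderiv 0 ξ).congr_of_eventuallyEq h1.symm
    exact h2.unique (hasDerivAt_const _ _)
  obtain ⟨c, hc, hbound⟩ := norm_toLp_le_of_support (ν := ν) R
  rw [hasDerivAt_iff_isLittleO_nhds_zero]
  have hO : (fun τ : ℝ => f (0 + τ) - f 0 - τ • f') =O[𝓝 0] fun τ : ℝ => τ * τ := by
    apply Asymptotics.IsBigO.of_bound (|M| * c)
    filter_upwards [Metric.ball_mem_nhds (0 : ℝ) one_pos] with τ hτ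
    rw [mem_ball_zero_iff] at hτ
    have hae : (f (0 + τ) - f 0 - τ • f' : L2 ν) =ᵐ[volume]
        fun ξ => H (τ, ξ) - H (0, ξ) - τ • g (0, ξ) := by
      filter_upwards [Lp.coeFn_sub (f (0 + τ) - f 0) (τ • f'), Lp.coeFn_sub (f (0 + τ)) (f 0),
        Lp.coeFn_smul τ f', hf (0 + τ), hf 0, hf'] with ξ h1 h2 h3 h4 h5 h6
      rw [h1, Pi.sub_apply, h2, Pi.sub_apply, h3, Pi.smul_apply, h4, h5, h6, zero_add]
    have hz : ∀ ξ, R < ‖ξ‖ → H (τ, ξ) - H (0, ξ) - τ • g (0, ξ) = 0 := by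
      intro ξ hξ
      rw [hR τ ξ hτ.le hξ, hR 0 ξ (by simp) hξ, hout ξ hξ]
      simp
    have := hbound _ (|M| * |τ| * |τ|) (by positivity)
      (by
        filter_upwards [hae] with ξ hξ
        rw [hξ]
        by_cases h : ‖ξ‖ ≤ R
        · exact hmain τ ξ hτ.le h
        · rw [hz ξ (not_le.1 h), norm_zero]
          positivity)
      (by
        filter_upwards [hae] with ξ hξ h
        rw [hξ, hz ξ h])
    refine this.trans (le_of_eq ?_)
    rw [Real.norm_eq_abs, abs_mul]
    ring
  refine hO.trans_isLittleO ?_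
  simpa [sq] using Asymptotics.isLittleO_pow_id (𝕜 := ℝ) one_lt_two

end

section

/-! ### The generator on annular functions -/

theorem hasDerivAt_speed (ν : ℕ) (t : ℝ) : HasDerivAt (speed ν)
    (speed ν t * (-((ν : ℝ) + 1) * (4 * Real.pi ^ 2 * t) / (1 + 4 * Real.pi ^ 2 * t ^ 2))) t := by
  have hpos : 0 < 1 + 4 * Real.pi ^ 2 * t ^ 2 := by linarith [one_le_speed_base t]
  have h1 : HasDerivAt (fun t : ℝ => 1 + 4 * Real.pi ^ 2 * t ^ 2)
      (4 * Real.pi ^ 2 * (2 * t)) t := by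
    have := (((hasDerivAt_id t).pow 2).const_mul (4 * Real.pi ^ 2)).const_add 1
    simpa using this
  have h2 := h1.rpow_const (p := -((ν : ℝ) + 1) / 2) (Or.inl hpos.ne')
  rw [Real.rpow_sub_one hpos.ne'] at h2
  refine HasDerivAt.congr_deriv (f := speed ν) h2 ?_
  simp only [speed]
  ring

/-- The divergence of the vector field `field`. -/
def divField {ν : ℕ} (ξ : X ν) : ℝ :=
  speed ν ‖ξ‖ * (ν - (ν + 1) * (4 * Real.pi ^ 2 * ‖ξ‖ ^ 2) / (1 + 4 * Real.pi ^ 2 * ‖ξ‖ ^ 2))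

theorem contDiff_speed_norm {ν : ℕ} : ContDiff ℝ ∞ fun ξ : X ν => speed ν ‖ξ‖ := by
  unfold speed
  exact ContDiff.rpow_const_of_ne (contDiff_const.add (contDiff_const.mul (contDiff_norm_sq ℝ)))
    fun ξ => by linarith [one_le_speed_base ‖ξ‖]

theorem contDiff_field {ν : ℕ} : ContDiff ℝ ∞ (field : X ν → X ν) :=
  contDiff_speed_norm.smul contDiff_id

theorem contDiff_divField {ν : ℕ} : ContDiff ℝ ∞ (divField : X ν → ℝ) := by
  have hn : ContDiff ℝ ∞ fun ξ : X ν => 4 * Real.pi ^ 2 * ‖ξ‖ ^ 2 :=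
    contDiff_const.mul (contDiff_norm_sq ℝ)
  exact contDiff_speed_norm.mul (contDiff_const.sub ((contDiff_const.mul hn).div
    (contDiff_const.add hn) fun ξ => by linarith [one_le_speed_base ‖ξ‖]))

theorem fderiv_comp_norm_field {ν : ℕ} {φ : ℝ → ℝ} {φ' : ℝ} {ξ : X ν} (h : ξ ≠ 0)
    (hφ : HasDerivAt φ φ' ‖ξ‖) :
    HasFDerivAt (fun ξ : X ν => φ ‖ξ‖) (φ' • fderiv ℝ (fun ξ : X ν => ‖ξ‖) ξ) ξ ∧
      (φ' • fderiv ℝ (fun ξ : X ν => ‖ξ‖) ξ) (field ξ) = φ' * (speed ν ‖ξ‖ * ‖ξ‖) := by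
  have hd : DifferentiableAt ℝ (fun ξ : X ν => ‖ξ‖) ξ :=
    (contDiffAt_norm ℝ h (n := 1)).differentiableAt (by norm_num)
  refine ⟨hφ.comp_hasFDerivAt ξ hd.hasFDerivAt, ?_⟩
  rw [_root_.smul_apply, field, map_smul, hd.fderiv_norm_self, smul_eq_mul,
    smul_eq_mul]

/-- Infinitesimal form of the invariance of `dξ / dens`: the derivative of `dens` along `b` is `(div
b) dens`. -/
theorem hasFDerivAt_dens {ν : ℕ} {ξ : X ν} (h : ξ ≠ 0) :
    ∃ L : X ν →L[ℝ] ℝ, HasFDerivAt dens L ξ ∧ L (field ξ) = divField ξ * dens ξ := by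
  have h1 := ((hasDerivAt_id ‖ξ‖).pow ν).mul (hasDerivAt_speed ν ‖ξ‖)
  obtain ⟨h2, h3⟩ := fderiv_comp_norm_field h h1
  refine ⟨_, h2, h3.trans ?_⟩
  have hpos : 0 < 1 + 4 * Real.pi ^ 2 * ‖ξ‖ ^ 2 := by linarith [one_le_speed_base ‖ξ‖]
  have hn := norm_pos_iff.2 h
  simp only [divField, dens, id, Pi.pow_apply]
  -- The derivative of `r^ν` contains `r^{ν-1}` with a truncated exponent, so `ν = 0` is treated
  -- apart.
  rcases Nat.eq_zero_or_pos ν with h0 | h0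
  · subst h0
    simp
    field_simp
  · obtain ⟨n, rfl⟩ : ∃ n, ν = n + 1 := ⟨ν - 1, by omega⟩
    simp only [Nat.add_sub_cancel]
    field_simp
    ring

/-- The infinitesimal generator of the unitary transport group. -/
def genFun {ν : ℕ} (F : X ν → ℂ) (ξ : X ν) : ℂ :=
  -(fderiv ℝ F ξ (field ξ) + (1 / 2) * (divField ξ : ℂ) * F ξ)

theorem IsAnnular.genFun {ν : ℕ} {F : X ν → ℂ} (hF : IsAnnular F) : IsAnnular (genFun F) := by
  have h1 := hF.fderiv_apply contDiff_field
  have h2 := (hF.ofReal_mul fun ξ _ => contDiff_divField.contDiffAt).const_mul (1 / 2)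
  convert! (h1.add h2).neg using 2 with ξ
  rw [ConjClass.genFun, mul_assoc]

/-- The infinitesimal generator of the weighted transport group. -/
def genWt {ν : ℕ} (s : ℝ) (F : X ν → ℂ) (ξ : X ν) : ℂ :=
  (wt s ξ : ℂ) * genFun (fun η => ((wt s η)⁻¹ : ℝ) * F η) ξ

theorem IsAnnular.inv_wt_mul {ν : ℕ} {F : X ν → ℂ} (hF : IsAnnular F) (s : ℝ) :
    IsAnnular fun η => ((wt s η)⁻¹ : ℝ) * F η :=
  hF.ofReal_mul fun ξ _ => (contDiff_wt s).contDiffAt.inv (wt_pos s ξ).ne'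

theorem IsAnnular.wt_mul {ν : ℕ} {F : X ν → ℂ} (hF : IsAnnular F) (s : ℝ) :
    IsAnnular fun η => (wt s η : ℂ) * F η :=
  hF.ofReal_mul fun _ _ => (contDiff_wt s).contDiffAt

theorem IsAnnular.genWt {ν : ℕ} {F : X ν → ℂ} (hF : IsAnnular F) (s : ℝ) :
    IsAnnular (genWt s F) :=
  (hF.inv_wt_mul s).genFun.wt_mul s

theorem genWt_zero {ν : ℕ} (F : X ν → ℂ) : genWt 0 F = genFun F := by
  ext ξ
  simp [genWt]

/-- The weighted generator is the conjugate of the unweighted one by `⟨ξ⟩^s`. Commutators can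
therefore be computed with `genFun` alone. -/
theorem genWt_wt_mul {ν : ℕ} (s : ℝ) (F : X ν → ℂ) :
    genWt s (fun η => (wt s η : ℂ) * F η) = fun ξ => (wt s ξ : ℂ) * genFun F ξ := by
  ext ξ
  rw [genWt]
  congr 2
  ext η
  rw [← mul_assoc, ← Complex.ofReal_mul, inv_mul_cancel₀ (wt_pos s η).ne']
  simp

/-- For `s = 0` the weight is `dens^{-1/2}`, whose logarithmic derivative along `b` is `-½` times
that of `dens`. -/
theorem hasFDerivAt_inv_sqrt_dens {ν : ℕ} {ξ : X ν} (h : ξ ≠ 0) :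
    ∃ L : X ν →L[ℝ] ℝ, HasFDerivAt (cobWeight 0) L ξ ∧
      L (field ξ) = -(1 / 2) * divField ξ * cobWeight 0 ξ := by
  obtain ⟨L, hL, hL2⟩ := hasFDerivAt_dens h
  have hp := dens_pos h
  have hs := Real.sqrt_pos.2 hp
  have h1 := (hasDerivAt_inv hs.ne').comp_hasFDerivAt ξ (hL.sqrt hp.ne')
  have h2 : (cobWeight 0 : X ν → ℝ) = Inv.inv ∘ fun ξ => Real.sqrt (dens ξ) := by
    ext η
    simp [cobWeight]
  refine ⟨_, by rw [h2]; exact h1, ?_⟩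
  rw [_root_.smul_apply, _root_.smul_apply, hL2]
  simp only [cobWeight, wt_zero, smul_eq_mul]
  field_simp
  rw [Real.sq_sqrt hp.le]
  ring

/-- Conjugation by `dens^{-1/2}` absorbs the term `½ div b`, so the generator is a pure derivative
along `-b` conjugated by `cobWeight`. This is the form produced by differentiating the transport
formula in `τ`. -/
theorem genWt_eq {ν : ℕ} (s : ℝ) {F : X ν → ℂ} (hF : IsAnnular F) (ξ : X ν) :
    genWt s F ξ = -((cobWeight s ξ : ℂ) *
      fderiv ℝ (fun η => ((cobWeight s η)⁻¹ : ℝ) * F η) ξ (field ξ)) := by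
  -- At the origin both sides vanish, because `field` and `F` do.
  by_cases h : ξ = 0
  · subst h
    simp [genWt, genFun, field, hF.apply_zero]
  set f := fun η => ((cobWeight s η)⁻¹ : ℝ) * F η with hf
  obtain ⟨L, hL, hL2⟩ := hasFDerivAt_inv_sqrt_dens h
  have hfd : HasFDerivAt f (fderiv ℝ f ξ) ξ :=
    ((hF.div_cobWeight s).contDiff.differentiable (by simp) ξ).hasFDerivAt
  have hprod : HasFDerivAt (fun η => (cobWeight 0 η : ℝ) • f η) _ ξ := hL.smul hfd
  have heq : (fun η => ((wt s η)⁻¹ : ℝ) * F η) =ᶠ[𝓝 ξ] fun η => (cobWeight 0 η : ℝ) • f η := by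
    filter_upwards [isOpen_ne.mem_nhds h] with η hη
    have hp := Real.sqrt_pos.2 (dens_pos hη)
    have e : (wt s η)⁻¹ = cobWeight 0 η * (cobWeight s η)⁻¹ := by
      rw [cobWeight, cobWeight, wt_zero]
      field_simp [(wt_pos s η).ne']
    rw [hf, Complex.real_smul, ← mul_assoc, ← Complex.ofReal_mul, ← e]
  have hd := (hprod.congr_of_eventuallyEq heq).fderiv
  have hv : (((wt s ξ)⁻¹ : ℝ) : ℂ) * F ξ = cobWeight 0 ξ • f ξ := heq.self_of_nhds
  rw [genWt, genFun, hd, hv]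
  simp only [_root_.add_apply, _root_.smul_apply,
    ContinuousLinearMap.smulRight_apply, hL2, Complex.real_smul, Complex.ofReal_mul]
  have hc : cobWeight s ξ = wt s ξ * cobWeight 0 ξ := by
    rw [cobWeight, cobWeight, wt_zero]; ring
  rw [hc]
  push_cast
  ring

/-- Off the origin all factors are smooth. Near `(τ, 0)` the backward flow keeps points inside the
hole of the annulus, so the family vanishes there identically. -/
theorem contDiff_transport_family {ν : ℕ} (s : ℝ) {F : X ν → ℂ} (hF : IsAnnular F) :
    ContDiff ℝ ∞ fun p : ℝ × X ν => transportFun s p.1 F p.2 := by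
  have hf := hF.div_cobWeight s
  rw [contDiff_iff_contDiffAt]
  rintro ⟨τ, ξ⟩
  simp only [IsAnnular.transportFun_eq]
  by_cases h : ξ = 0
  · subst h
    obtain ⟨r₀, h0, r₁, hs⟩ := hf.supp
    have : (fun p : ℝ × X ν => (cobWeight s p.2 : ℂ) *
        (((cobWeight s (flow (-p.1) p.2))⁻¹ : ℝ) * F (flow (-p.1) p.2))) =ᶠ[𝓝 (τ, 0)]
        fun _ => 0 := by
      have h1 : ∀ᶠ p : ℝ × X ν in 𝓝 (τ, 0), Real.exp |p.1| * ‖p.2‖ < r₀ := by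
        have hc : Continuous fun p : ℝ × X ν => Real.exp |p.1| * ‖p.2‖ := by fun_prop
        apply hc.continuousAt.eventually_lt continuousAt_const
        simpa using h0
      filter_upwards [h1] with p hp
      by_contra hne
      have h2 := (hs _ (right_ne_zero_of_mul hne)).1
      have h3 := norm_flow_le (-p.1) p.2
      rw [abs_neg] at h3
      linarith
    exact contDiffAt_const.congr_of_eventuallyEq this
  · have h1 : ContDiffAt ℝ ∞ (fun p : ℝ × X ν => (cobWeight s p.2 : ℂ)) (τ, ξ) :=
      Complex.ofRealCLM.contDiff.contDiffAt.comp _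
        ((contDiffAt_cobWeight s h).comp (τ, ξ) contDiffAt_snd)
    have h2 : ContDiffAt ℝ ∞ (fun p : ℝ × X ν => flow (-p.1) p.2) (τ, ξ) :=
      ContDiffAt.comp (g := fun p : ℝ × X ν => flow p.1 p.2)
        (f := fun p : ℝ × X ν => (-p.1, p.2)) (τ, ξ) (contDiffAt_flow (-τ) h)
        (contDiffAt_fst.neg.prodMk contDiffAt_snd)
    exact h1.mul (hf.contDiff.contDiffAt.comp (τ, ξ) h2)

variable {ν : ℕ} [NeZero ν]

theorem transport_toL2 (s τ : ℝ) {F : X ν → ℂ} (hF : IsAnnular F) :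
    transport s τ hF.toL2 = (hF.transportFun s τ).toL2 :=
  transport_toLp s τ (hF.memLp 2)

theorem hasDerivAt_transport_zero (s : ℝ) {F : X ν → ℂ} (hF : IsAnnular F) :
    HasDerivAt (fun τ => transport s τ hF.toL2) (hF.genWt s).toL2 0 := by
  have hf := hF.div_cobWeight s
  obtain ⟨r₀, h0, r₁, hs⟩ := hf.supp
  -- For `|τ| ≤ 1` radii grow by at most the factor `e`, so all supports lie in the ball of radius
  -- `e r₁`.
  refine hasDerivAt_toLp_of_contDiff (H := fun p : ℝ × X ν => transportFun s p.1 F p.2)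
    (by exact_mod_cast contDiff_infty.1 (contDiff_transport_family s hF) 2) (R := Real.exp 1 * r₁)
    ?_ ?_ ?_
  · intro τ ξ hτ hξ
    simp only [IsAnnular.transportFun_eq]
    by_contra hne
    have h2 := (hs _ (right_ne_zero_of_mul hne)).2
    have h3 := le_norm_flow (-τ) ξ
    rw [abs_neg, Real.exp_neg, inv_mul_le_iff₀ (Real.exp_pos _)] at h3
    have h4 : Real.exp |τ| * ‖flow (-τ) ξ‖ ≤ Real.exp 1 * r₁ := by
      gcongr
    linarith
  · intro τ
    rw [transport_toL2]
    exact (hF.transportFun s τ).coeFn_toL2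
  · refine (hF.genWt s).coeFn_toL2.trans (Eventually.of_forall fun ξ => ?_)
    simp only
    have hd : HasDerivAt (fun τ : ℝ => transportFun s τ F ξ)
        (fderiv ℝ (fun p : ℝ × X ν => transportFun s p.1 F p.2) (0, ξ) (1, 0)) 0 := by
      have h1 := ((contDiff_transport_family s hF).differentiable (by simp) (0, ξ)).hasFDerivAt
      have h2 : HasDerivAt (fun τ : ℝ => (τ, ξ)) ((1 : ℝ), (0 : X ν)) 0 :=
        (hasDerivAt_id 0).prodMk (hasDerivAt_const 0 ξ)
      exact h1.comp_hasDerivAt (0 : ℝ) h2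
    -- The same `τ`-derivative computed through the flow. Uniqueness of derivatives identifies it
    -- with the abstract partial derivative in `hd`.
    have hd2 : HasDerivAt (fun τ : ℝ => transportFun s τ F ξ)
        ((cobWeight s ξ : ℂ) *
          fderiv ℝ (fun η => ((cobWeight s η)⁻¹ : ℝ) * F η) ξ (-(field ξ))) 0 := by
      simp only [IsAnnular.transportFun_eq]
      have h1 : HasDerivAt (fun τ : ℝ => flow (-τ) ξ) (-(field ξ)) 0 := by
        have := HasDerivAt.scomp (h := fun τ : ℝ => -τ) (g₁ := fun τ => flow τ ξ) (x := (0 : ℝ))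
          (h' := -1) (g₁' := field ξ) (by simpa using hasDerivAt_flow ξ) (hasDerivAt_neg 0)
        rw [neg_one_smul] at this
        exact this
      have h2 : HasFDerivAt (fun η => ((cobWeight s η)⁻¹ : ℝ) * F η)
          (fderiv ℝ (fun η => ((cobWeight s η)⁻¹ : ℝ) * F η) ξ) (flow (-0) ξ) := by
        rw [neg_zero, flow_zero_left]
        exact (hf.contDiff.differentiable (by simp) ξ).hasFDerivAt
      exact (h2.comp_hasDerivAt (0 : ℝ) h1).const_mul _
    rw [genWt_eq s hF, hd.unique hd2, map_neg, mul_neg]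

/-- Local uniform boundedness of the operators lets pointwise continuity pass from a dense set to
the whole space. -/
theorem continuousAt_of_dense {H : Type*} [NormedAddCommGroup H] [NormedSpace ℂ H]
    {T : ℝ → H →L[ℂ] H} {S : Set H} (hS : Dense S) {C : ℝ} {t : ℝ}
    (hC : ∀ᶠ τ in 𝓝 t, ‖T τ‖ ≤ C) (hT : ∀ f ∈ S, ContinuousAt (fun τ => T τ f) t) (f : H) :
    ContinuousAt (fun τ => T τ f) t := by
  have hC0 : 0 ≤ C := (norm_nonneg _).trans hC.self_of_nhds
  apply continuousAt_of_locally_uniform_approx_of_continuousAt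
  intro u hu
  obtain ⟨ε, hε, hεu⟩ := Metric.mem_uniformity_dist.1 hu
  -- The divisor is `C + 1` because `C` may be zero.
  obtain ⟨g, hgS, hg⟩ := Metric.dense_iff.1 hS f (ε / (C + 1)) (by positivity)
  refine ⟨_, hC, fun τ => T τ g, hT g hg, fun τ hτ => hεu ?_⟩
  rw [dist_eq_norm, ← map_sub]
  rw [Metric.mem_ball, dist_comm, dist_eq_norm] at hgS
  calc ‖T τ (f - g)‖ ≤ C * ‖f - g‖ := (T τ).le_of_opNorm_le hτ _
    _ ≤ (C + 1) * ‖f - g‖ := by gcongr; linarith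
    _ < (C + 1) * (ε / (C + 1)) := by gcongr
    _ = ε := by field_simp

/-- The annular functions, as a set of elements of `L²`. -/
def annularSet (ν : ℕ) : Set (L2 ν) := {f | ∃ (F : X ν → ℂ) (hF : IsAnnular F), f = hF.toL2}

theorem toL2_add {ν : ℕ} {F G : X ν → ℂ} (hF : IsAnnular F) (hG : IsAnnular G) :
    (hF.add hG).toL2 = hF.toL2 + hG.toL2 := rfl

theorem toL2_const_mul {ν : ℕ} {F : X ν → ℂ} (hF : IsAnnular F) (c : ℂ) :
    (hF.const_mul c).toL2 = c • hF.toL2 := rfl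

/-- The annular functions, as a subspace of `L²`. -/
def annularSubmodule (ν : ℕ) : Submodule ℂ (L2 ν) where
  carrier := annularSet ν
  add_mem' := by
    rintro _ _ ⟨F, hF, rfl⟩ ⟨G, hG, rfl⟩
    exact ⟨_, hF.add hG, (toL2_add hF hG).symm⟩
  zero_mem' := ⟨fun _ => 0, ⟨contDiff_const, 1, one_pos, 1, by simp⟩, by
    symm
    exact (Lp.eq_zero_iff_ae_eq_zero).2 (IsAnnular.coeFn_toL2 _)⟩
  smul_mem' := by
    rintro c _ ⟨F, hF, rfl⟩
    exact ⟨_, hF.const_mul c, (toL2_const_mul hF c).symm⟩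

/-- Every test function supported off the origin is annular, and the origin is a null set in
positive dimension. -/
theorem eq_zero_of_inner_annular {h : L2 ν} (hh : ∀ F (hF : IsAnnular F), inner ℂ hF.toL2 h = 0) :
    h = 0 := by
  rw [Lp.eq_zero_iff_ae_eq_zero]
  have h1 := (isOpen_compl_singleton (x := (0 : X ν))).ae_eq_zero_of_integral_contDiff_smul_eq_zero
    (f := (h : X ν → ℂ)) (μ := volume)
    (((Lp.memLp h).locallyIntegrable (by norm_num)).locallyIntegrableOn _) (by
      intro g hg hgc hgs
      have hA : IsAnnular fun ξ => (g ξ : ℂ) := by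
        refine ⟨Complex.ofRealCLM.contDiff.comp hg, ?_⟩
        obtain ⟨r₁, hr₁⟩ := hgc.isBounded.exists_norm_le
        have h0 : (0 : X ν) ∉ tsupport g := fun h => hgs h rfl
        obtain ⟨r₀, hr₀, hb⟩ := Metric.isOpen_iff.1 (isClosed_tsupport g).isOpen_compl 0 h0
        refine ⟨r₀, hr₀, r₁, fun ξ hξ => ?_⟩
        have hξ' : ξ ∈ tsupport g := subset_tsupport _ (by simpa using hξ)
        refine ⟨?_, hr₁ ξ hξ'⟩
        by_contra hlt
        exact hb (by simpa using hlt) hξ'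
      have h2 := hh _ hA
      rw [L2.inner_def] at h2
      rw [← h2]
      apply integral_congr_ae
      filter_upwards [hA.coeFn_toL2] with ξ hξ
      rw [hξ]
      simp [mul_comm])
  filter_upwards [h1, ae_ne_zero (NeZero.pos ν)] with ξ h1 h2 using h1 h2

theorem dense_annularSet : Dense (annularSet ν) := by
  have h : (annularSubmodule ν).topologicalClosure = ⊤ := by
    rw [Submodule.topologicalClosure_eq_top_iff, Submodule.eq_bot_iff]
    intro f hf
    rw [Submodule.mem_orthogonal] at hf
    exact eq_zero_of_inner_annular fun F hF => hf _ ⟨F, hF, rfl⟩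
  exact (Submodule.dense_iff_topologicalClosure_eq_top).2 h

/-- The derivative at time zero, moved to time `t` by the group law. Here the group acts after the
generator. -/
theorem hasDerivAt_transport (s t : ℝ) {F : X ν → ℂ} (hF : IsAnnular F) :
    HasDerivAt (fun τ => transport s τ hF.toL2) (transport s t (hF.genWt s).toL2) t := by
  have h0 := hasDerivAt_transport_zero s hF
  have h1 : HasDerivAt (fun τ => transport s (τ - t) hF.toL2) (hF.genWt s).toL2 t := by
    have h2 := HasDerivAt.scomp (h := fun τ : ℝ => τ - t) (g₁ := fun τ => transport s τ hF.toL2)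
      (x := t) (h' := 1) (g₁' := (hF.genWt s).toL2) (by simpa using h0)
      ((hasDerivAt_id t).sub_const t)
    rw [one_smul] at h2
    exact h2
  have h3 := ((transport s t : L2 ν →L[ℂ] L2 ν).restrictScalars ℝ).hasFDerivAt.comp_hasDerivAt t h1
  refine h3.congr_of_eventuallyEq (Eventually.of_forall fun τ => ?_)
  simp only [Function.comp_def, ContinuousLinearMap.coe_restrictScalars']
  rw [← ContinuousLinearMap.comp_apply, ← transport_add]
  simp

theorem continuous_transport (s : ℝ) (f : L2 ν) : Continuous fun τ => transport s τ f := by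
  rw [continuous_iff_continuousAt]
  intro t
  refine continuousAt_of_dense dense_annularSet (C := Real.exp (|s| * (|t| + 1))) ?_ ?_ f
  · filter_upwards [Metric.ball_mem_nhds t one_pos] with τ hτ
    refine (norm_transport_le s τ).trans (Real.exp_le_exp.2 ?_)
    rw [Metric.mem_ball, Real.dist_eq] at hτ
    have : |τ| ≤ |t| + 1 := by
      have := abs_add_le (τ - t) t
      rw [sub_add_cancel] at this
      linarith
    gcongr
  · rintro _ ⟨F, hF, rfl⟩
    exact (hasDerivAt_transport s t hF).continuousAt

end

section

/-! ### Conjugation of bounded operators by the transport groups -/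

variable {ν : ℕ} [NeZero ν]

/-- Here the generator acts after the group. The transported function is again annular, so an
identity known on annular functions only can be used at every time `t`. -/
theorem hasDerivAt_transport_gen (s t : ℝ) {F : X ν → ℂ} (hF : IsAnnular F) :
    HasDerivAt (fun τ => transport s τ hF.toL2) ((hF.transportFun s t).genWt s).toL2 t := by
  have h0 := hasDerivAt_transport_zero s (hF.transportFun s t)
  have h2 := HasDerivAt.scomp (h := fun τ : ℝ => τ - t)
    (g₁ := fun τ => transport s τ (hF.transportFun s t).toL2)
    (x := t) (h' := 1) (g₁' := ((hF.transportFun s t).genWt s).toL2) (by simpa using h0)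
    ((hasDerivAt_id t).sub_const t)
  rw [one_smul] at h2
  refine h2.congr_of_eventuallyEq (Eventually.of_forall fun τ => ?_)
  simp only [Function.comp_def]
  rw [← transport_toL2, ← ContinuousLinearMap.comp_apply, ← transport_add, sub_add_cancel]

/-- Conjugation of an operator by the transport groups of weights `1` and `-1`. -/
def sandwich (A : L2 ν →L[ℂ] L2 ν) (τ : ℝ) : L2 ν →L[ℂ] L2 ν :=
  (transport (-1) (-τ)).comp (A.comp (transport 1 τ))

theorem sandwich_apply (A : L2 ν →L[ℂ] L2 ν) (τ : ℝ) (g : L2 ν) :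
    sandwich A τ g = transport (-1) (-τ) (A (transport 1 τ g)) := rfl

theorem inner_sandwich (A : L2 ν →L[ℂ] L2 ν) (τ : ℝ) (f g : L2 ν) :
    inner ℂ f (sandwich A τ g) = inner ℂ (transport 1 τ f) (A (transport 1 τ g)) := by
  rw [sandwich_apply, inner_transport 1 τ]

theorem sandwich_zero (A : L2 ν →L[ℂ] L2 ν) : sandwich A 0 = A := by
  ext1 g
  simp [sandwich_apply, transport_zero]

theorem sandwich_add (A B : L2 ν →L[ℂ] L2 ν) (τ : ℝ) :
    sandwich (A + B) τ = sandwich A τ + sandwich B τ := by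
  ext1 g
  simp [sandwich_apply]

theorem norm_sandwich_le (A : L2 ν →L[ℂ] L2 ν) (τ : ℝ) :
    ‖sandwich A τ‖ ≤ Real.exp (2 * |τ|) * ‖A‖ := by
  have h1 := norm_transport_le (ν := ν) (-1) (-τ)
  have h2 := norm_transport_le (ν := ν) 1 τ
  simp only [abs_neg, abs_one, one_mul] at h1 h2
  calc ‖sandwich A τ‖ ≤ ‖(transport (-1) (-τ) : L2 ν →L[ℂ] L2 ν)‖ *
        (‖A‖ * ‖(transport 1 τ : L2 ν →L[ℂ] L2 ν)‖) :=
        (ContinuousLinearMap.opNorm_comp_le _ _).trans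
          (mul_le_mul_of_nonneg_left (ContinuousLinearMap.opNorm_comp_le _ _) (norm_nonneg _))
    _ ≤ Real.exp |τ| * (‖A‖ * Real.exp |τ|) := by gcongr
    _ = _ := by
      rw [two_mul, Real.exp_add]
      ring

theorem continuous_sandwich (A : L2 ν →L[ℂ] L2 ν) (g : L2 ν) :
    Continuous fun τ => sandwich A τ g := by
  rw [continuous_iff_continuousAt]
  intro t
  have hg : ContinuousAt (fun τ => A (transport 1 τ g)) t :=
    (A.continuous.comp (continuous_transport 1 g)).continuousAt
  rw [ContinuousAt, tendsto_iff_norm_sub_tendsto_zero]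
  have h1 : Tendsto (fun τ => Real.exp |τ| * ‖A (transport 1 τ g) - A (transport 1 t g)‖ +
      ‖transport (-1) (-τ) (A (transport 1 t g)) - transport (-1) (-t) (A (transport 1 t g))‖)
      (𝓝 t) (𝓝 0) := by
    have e1 : Tendsto (fun τ : ℝ => Real.exp |τ|) (𝓝 t) (𝓝 (Real.exp |t|)) :=
      (Real.continuous_exp.comp continuous_abs).continuousAt
    have e2 := e1.mul (tendsto_iff_norm_sub_tendsto_zero.1 hg)
    have e3 := tendsto_iff_norm_sub_tendsto_zero.1
      (((continuous_transport (-1) (A (transport 1 t g))).comp continuous_neg).tendsto t)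
    simpa using e2.add e3
  refine squeeze_zero (fun _ => norm_nonneg _) (fun τ => ?_) h1
  have e : sandwich A τ g - sandwich A t g =
      transport (-1) (-τ) (A (transport 1 τ g) - A (transport 1 t g)) +
      (transport (-1) (-τ) (A (transport 1 t g)) - transport (-1) (-t) (A (transport 1 t g))) := by
    rw [sandwich_apply, sandwich_apply, map_sub]
    abel
  rw [e]
  refine (norm_add_le _ _).trans (add_le_add_left ?_ _)
  have h2 := norm_transport_le (ν := ν) (-1) (-τ)
  simp only [abs_neg, abs_one, one_mul] at h2
  exact ContinuousLinearMap.le_of_opNorm_le _ h2 _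

/-- `B` is the commutator of the generator of the transport groups with `A`, in the sense of
forms on annular functions. -/
def HasCommutator (A B : L2 ν →L[ℂ] L2 ν) : Prop :=
  ∀ (F G : X ν → ℂ) (hF : IsAnnular F) (hG : IsAnnular G),
    inner ℂ (hF.genWt 1).toL2 (A hG.toL2) + inner ℂ hF.toL2 (A (hG.genWt 1).toL2) =
      inner ℂ hF.toL2 (B hG.toL2)

/-- By duality the conjugated form is the form of `A` at the two transported functions. Its
`t`-derivative is the commutator form at these functions, which are still annular. -/
theorem inner_sandwich_sub {A B : L2 ν →L[ℂ] L2 ν} (h : HasCommutator A B) (τ : ℝ)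
    {F G : X ν → ℂ} (hF : IsAnnular F) (hG : IsAnnular G) :
    inner ℂ hF.toL2 (sandwich A τ hG.toL2 - A hG.toL2) =
      ∫ t in (0 : ℝ)..τ, inner ℂ hF.toL2 (sandwich B t hG.toL2) := by
  have hd : ∀ t, HasDerivAt (fun t => inner ℂ hF.toL2 (sandwich A t hG.toL2))
      (inner ℂ hF.toL2 (sandwich B t hG.toL2)) t := by
    intro t
    simp only [inner_sandwich]
    have h1 := hasDerivAt_transport_gen 1 t hF
    have h2 := hasDerivAt_transport_gen 1 t hG
    have h3 := (A.restrictScalars ℝ).hasFDerivAt.comp_hasDerivAt t h2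
    have h4 := h1.inner ℂ h3
    have h5 := h _ _ (hF.transportFun 1 t) (hG.transportFun 1 t)
    rw [← transport_toL2, ← transport_toL2] at h5
    rw [← h5]
    rw [add_comm]
    exact h4
  have hint := intervalIntegral.integral_eq_sub_of_hasDerivAt (a := 0) (b := τ)
    (fun t _ => hd t) ((Continuous.inner continuous_const
      (continuous_sandwich B hG.toL2)).intervalIntegrable _ _)
  rw [hint, inner_sub_right, sandwich_zero]

/-- The integral of the conjugated operators, as a linear map. -/
def sandwichIntegral (B : L2 ν →L[ℂ] L2 ν) (τ : ℝ) : L2 ν →ₗ[ℂ] L2 ν where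
  toFun g := ∫ t in (0 : ℝ)..τ, sandwich B t g
  map_add' f g := by
    simp only [map_add]
    exact intervalIntegral.integral_add ((continuous_sandwich B f).intervalIntegrable _ _)
      ((continuous_sandwich B g).intervalIntegrable _ _)
  map_smul' c f := by
    simp only [map_smul, RingHom.id_apply]
    exact intervalIntegral.integral_smul c _

theorem norm_sandwichIntegral_le (B : L2 ν →L[ℂ] L2 ν) (τ : ℝ) (g : L2 ν) :
    ‖sandwichIntegral B τ g‖ ≤ Real.exp (2 * |τ|) * ‖B‖ * |τ| * ‖g‖ := by
  have := intervalIntegral.norm_integral_le_of_norm_le_const (a := 0) (b := τ)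
    (f := fun t => sandwich B t g) (C := Real.exp (2 * |τ|) * ‖B‖ * ‖g‖) (fun t ht => by
      refine ((sandwich B t).le_of_opNorm_le (norm_sandwich_le B t) g).trans ?_
      have : |t| ≤ |τ| := by
        have := Set.abs_sub_left_of_mem_uIcc (Set.uIoc_subset_uIcc ht)
        simpa using this
      gcongr)
  rw [sub_zero] at this
  calc _ ≤ _ := this
    _ = _ := by ring

/-- The weak identity becomes a strong one because annular functions separate points; it extends to
all `g` because they are dense and both sides are continuous in `g`. -/
theorem sandwich_sub_eq_integral {A B : L2 ν →L[ℂ] L2 ν} (h : HasCommutator A B) (τ : ℝ)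
    (g : L2 ν) : sandwich A τ g - A g = ∫ t in (0 : ℝ)..τ, sandwich B t g := by
  have hc : Continuous (sandwichIntegral B τ) :=
    AddMonoidHomClass.continuous_of_bound _ _ (norm_sandwichIntegral_le B τ)
  have hcl : IsClosed {g | sandwich A τ g - A g = sandwichIntegral B τ g} :=
    isClosed_eq (by fun_prop) hc
  refine hcl.closure_subset_iff.2 ?_ (dense_annularSet g)
  rintro _ ⟨G, hG, rfl⟩
  rw [Set.mem_ofPred_eq, ← sub_eq_zero]
  apply eq_zero_of_inner_annular
  intro F hF
  rw [inner_sub_right, inner_sandwich_sub h τ hF hG, sub_eq_zero]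
  exact ((innerSL ℂ hF.toL2).intervalIntegral_comp_comm
    ((continuous_sandwich B _).intervalIntegrable _ _))

theorem contDiff_sandwich {A B : L2 ν →L[ℂ] L2 ν} (h : HasCommutator A B) (g : L2 ν) :
    ContDiff ℝ 1 fun τ => sandwich A τ g := by
  have hd : ∀ τ, HasDerivAt (fun τ => sandwich A τ g) (sandwich B τ g) τ := by
    intro τ
    have h1 : (fun τ => sandwich A τ g) = fun τ => A g + ∫ t in (0 : ℝ)..τ, sandwich B t g := by
      ext1 τ
      rw [← sandwich_sub_eq_integral h]
      abel
    rw [h1]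
    exact (intervalIntegral.integral_hasDerivAt_right
      ((continuous_sandwich B g).intervalIntegrable _ _)
      ((continuous_sandwich B g).stronglyMeasurableAtFilter _ _)
      (continuous_sandwich B g).continuousAt).const_add _
  rw [contDiff_one_iff_deriv]
  refine ⟨fun τ => (hd τ).differentiableAt, ?_⟩
  have : deriv (fun τ => sandwich A τ g) = fun τ => sandwich B τ g := funext fun τ => (hd τ).deriv
  rw [this]
  exact continuous_sandwich B g

theorem norm_sandwich_sub_le {A B : L2 ν →L[ℂ] L2 ν} (h : HasCommutator A B) (τ : ℝ) :
    ‖sandwich A τ - A‖ ≤ Real.exp (2 * |τ|) * ‖B‖ * |τ| := by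
  refine ContinuousLinearMap.opNorm_le_bound _ (by positivity) fun g => ?_
  rw [_root_.sub_apply, sandwich_sub_eq_integral h]
  exact norm_sandwichIntegral_le B τ g

/-- The second difference is the integral over `[0, τ]` of the commutator at `t` minus that at `-t`.
The part `B₂` is bounded directly, while `B₁`, which has a commutator of its own, gains another
factor `τ`. The constant `e²` bounds `e^{2|t|}` for `|t| ≤ 1`. -/
theorem norm_second_difference_le {A B B₁ B₂ C₁ : L2 ν →L[ℂ] L2 ν} (h : HasCommutator A B)
    (hB : B = B₁ + B₂) (h₁ : HasCommutator B₁ C₁) {τ : ℝ} (h0 : 0 ≤ τ) (h1 : τ ≤ 1) :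
    ‖sandwich A τ + sandwich A (-τ) - (2 : ℂ) • A‖ ≤
      2 * Real.exp 2 * (‖B₂‖ + τ * ‖C₁‖) * τ := by
  refine ContinuousLinearMap.opNorm_le_bound _ (by positivity) fun g => ?_
  have e : (sandwich A τ + sandwich A (-τ) - (2 : ℂ) • A) g =
      ∫ t in (0 : ℝ)..τ, (sandwich B t g - sandwich B (-t) g) := by
    have e1 := sandwich_sub_eq_integral h τ g
    have e2 := sandwich_sub_eq_integral h (-τ) g
    have e3 := intervalIntegral.integral_comp_neg (a := 0) (b := τ) fun t => sandwich B t g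
    rw [neg_zero, intervalIntegral.integral_symm 0 (-τ), ← e2] at e3
    have hcn : Continuous fun t => sandwich B (-t) g :=
      (continuous_sandwich B g).comp continuous_neg
    rw [intervalIntegral.integral_sub ((continuous_sandwich B g).intervalIntegrable _ _)
      (hcn.intervalIntegrable _ _), ← e1, e3]
    simp only [_root_.sub_apply, _root_.add_apply, two_smul]
    abel
  have hterm : ∀ t : ℝ, 0 ≤ t → t ≤ τ → ‖sandwich B t - sandwich B (-t)‖ ≤
      2 * Real.exp 2 * (‖B₂‖ + τ * ‖C₁‖) := by
    intro t ht0 htτ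
    have hta : |t| ≤ 1 := by rw [abs_of_nonneg ht0]; linarith
    have ht' : |-t| ≤ 1 := by rwa [abs_neg]
    have d : sandwich B t - sandwich B (-t) = (sandwich B₁ t - B₁) - (sandwich B₁ (-t) - B₁) +
        (sandwich B₂ t - sandwich B₂ (-t)) := by
      rw [hB, sandwich_add, sandwich_add]
      abel
    have b1 := norm_sandwich_sub_le h₁ t
    have b2 := norm_sandwich_sub_le h₁ (-t)
    have b3 := norm_sandwich_le B₂ t
    have b4 := norm_sandwich_le B₂ (-t)
    have b1' : ‖sandwich B₁ t - B₁‖ ≤ Real.exp 2 * ‖C₁‖ * τ := b1.trans (by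
      rw [abs_of_nonneg ht0] at hta ⊢
      have := Real.exp_le_exp.2 (show 2 * t ≤ 2 by linarith)
      gcongr)
    have b2' : ‖sandwich B₁ (-t) - B₁‖ ≤ Real.exp 2 * ‖C₁‖ * τ := b2.trans (by
      rw [abs_neg, abs_of_nonneg ht0]
      have := Real.exp_le_exp.2 (show 2 * t ≤ 2 by linarith)
      gcongr)
    have b3' : ‖sandwich B₂ t‖ ≤ Real.exp 2 * ‖B₂‖ := b3.trans (by
      gcongr; linarith)
    have b4' : ‖sandwich B₂ (-t)‖ ≤ Real.exp 2 * ‖B₂‖ := b4.trans (by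
      gcongr; linarith)
    rw [d]
    calc _ ≤ (‖sandwich B₁ t - B₁‖ + ‖sandwich B₁ (-t) - B₁‖) +
          (‖sandwich B₂ t‖ + ‖sandwich B₂ (-t)‖) :=
          (norm_add_le _ _).trans (add_le_add (norm_sub_le _ _) (norm_sub_le _ _))
      _ ≤ _ := by linarith
  rw [e]
  have := intervalIntegral.norm_integral_le_of_norm_le_const (a := 0) (b := τ)
    (f := fun t => sandwich B t g - sandwich B (-t) g)
    (C := 2 * Real.exp 2 * (‖B₂‖ + τ * ‖C₁‖) * ‖g‖) (fun t ht => by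
      rw [Set.uIoc_of_le h0] at ht
      exact (sandwich B t - sandwich B (-t)).le_of_opNorm_le (hterm t ht.1.le ht.2) g)
  rw [sub_zero, abs_of_nonneg h0] at this
  calc _ ≤ _ := this
    _ = _ := by ring

end

section

/-! ### Hilbert–Schmidt operators -/

section HilbertSchmidt

variable {α : Type*} [MeasurableSpace α] {m : Measure α} [SFinite m]

theorem eLpNorm_tensor {f g : α → ℂ} (hf : AEStronglyMeasurable f m)
    (hg : AEStronglyMeasurable g m) :
    eLpNorm (fun p : α × α => f p.1 * g p.2) 2 (m.prod m) = eLpNorm f 2 m * eLpNorm g 2 m := by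
  simp only [eLpNorm_eq_lintegral_rpow_enorm_toReal (p := 2) (by norm_num) (by norm_num),
    ENNReal.toReal_ofNat, enorm_mul]
  rw [← ENNReal.mul_rpow_of_nonneg _ _ (by norm_num),
    ← lintegral_prod_mul (hf.enorm.pow_const _) (hg.enorm.pow_const _)]
  simp only [ENNReal.mul_rpow_of_nonneg _ _ (show (0 : ℝ) ≤ 2 by norm_num)]

theorem memLp_tensor {f g : α → ℂ} (hf : MemLp f 2 m) (hg : MemLp g 2 m) :
    MemLp (fun p : α × α => f p.1 * g p.2) 2 (m.prod m) :=
  ⟨hf.1.comp_fst.mul hg.1.comp_snd, by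
    rw [eLpNorm_tensor hf.1 hg.1]
    exact ENNReal.mul_lt_top hf.2 hg.2⟩

theorem integrable_kernel_form {k : α × α → ℂ} (hk : MemLp k 2 (m.prod m)) {f g : α → ℂ}
    (hf : MemLp f 2 m) (hg : MemLp g 2 m) :
    Integrable (fun p => (starRingEnd ℂ) (f p.1) * (k p * g p.2)) (m.prod m) := by
  have h := (memLp_tensor hf.star hg).integrable_mul hk
  refine h.congr (Eventually.of_forall fun p => ?_)
  simp
  ring

/-- Cauchy–Schwarz on the product space: the form pairs the kernel with the tensor product of `F`
and `star G`, whose norm is `‖F‖ ‖G‖`. -/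
theorem norm_kernel_form_le {k : α × α → ℂ} (hk : MemLp k 2 (m.prod m)) (F G : Lp ℂ 2 m) :
    ‖∫ p, (starRingEnd ℂ) (F p.1) * (k p * G p.2) ∂(m.prod m)‖ ≤
      (eLpNorm k 2 (m.prod m)).toReal * ‖F‖ * ‖G‖ := by
  have ht := memLp_tensor (Lp.memLp F) (Lp.memLp G).star
  have h : ∫ p, (starRingEnd ℂ) (F p.1) * (k p * G p.2) ∂(m.prod m) =
      inner ℂ ht.toLp hk.toLp := by
    rw [L2.inner_def]
    apply integral_congr_ae
    filter_upwards [ht.coeFn_toLp, hk.coeFn_toLp] with p h1 h2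
    rw [h1, h2]
    simp
    ring
  rw [h]
  refine (norm_inner_le_norm _ _).trans (le_of_eq ?_)
  have e2 : eLpNorm (fun x => star ((G : α → ℂ) x)) 2 m = eLpNorm G 2 m :=
    eLpNorm_congr_norm_ae (Eventually.of_forall fun x => by simp)
  have e : eLpNorm (fun p : α × α => (F : α → ℂ) p.1 * (star (G : α → ℂ)) p.2) 2 (m.prod m) =
      eLpNorm F 2 m * eLpNorm G 2 m := by
    rw [eLpNorm_tensor (Lp.memLp F).1 (Lp.memLp G).star.1, ← e2]
    rfl
  rw [Lp.norm_toLp, Lp.norm_toLp, e, ENNReal.toReal_mul, ← Lp.norm_def, ← Lp.norm_def]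
  ring

/-- A square integrable kernel defines a bounded operator. -/
theorem exists_kernel_operator {k : α × α → ℂ} (hk : MemLp k 2 (m.prod m)) :
    ∃ K : Lp ℂ 2 m →L[ℂ] Lp ℂ 2 m, ‖K‖ ≤ (eLpNorm k 2 (m.prod m)).toReal ∧
      ∀ F G : Lp ℂ 2 m, inner ℂ F (K G) =
        ∫ p, (starRingEnd ℂ) (F p.1) * (k p * G p.2) ∂(m.prod m) := by
  have hint := fun F G : Lp ℂ 2 m => integrable_kernel_form hk (Lp.memLp F) (Lp.memLp G)
  have hfst := fun {P : α → Prop} (h : ∀ᵐ x ∂m, P x) =>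
    (Measure.quasiMeasurePreserving_fst (μ := m) (ν := m)).ae h
  have hsnd := fun {P : α → Prop} (h : ∀ᵐ x ∂m, P x) =>
    (Measure.quasiMeasurePreserving_snd (μ := m) (ν := m)).ae h
  let B : Lp ℂ 2 m →ₗ⋆[ℂ] Lp ℂ 2 m →ₗ[ℂ] ℂ := LinearMap.mk₂'ₛₗ (starRingEnd ℂ) (RingHom.id ℂ)
    (fun F G => ∫ p, (starRingEnd ℂ) (F p.1) * (k p * G p.2) ∂(m.prod m))
    (fun F F' G => by
      rw [← integral_add (hint F G) (hint F' G)]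
      apply integral_congr_ae
      filter_upwards [hfst (Lp.coeFn_add F F')] with p hp
      rw [hp, Pi.add_apply, map_add]
      ring)
    (fun c F G => by
      rw [smul_eq_mul, ← integral_const_mul]
      apply integral_congr_ae
      filter_upwards [hfst (Lp.coeFn_smul c F)] with p hp
      rw [hp, Pi.smul_apply, smul_eq_mul, map_mul]
      ring)
    (fun F G G' => by
      rw [← integral_add (hint F G) (hint F G')]
      apply integral_congr_ae
      filter_upwards [hsnd (Lp.coeFn_add G G')] with p hp
      rw [hp, Pi.add_apply]
      ring)
    (fun c F G => by
      rw [smul_eq_mul, ← integral_const_mul]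
      apply integral_congr_ae
      filter_upwards [hsnd (Lp.coeFn_smul c G)] with p hp
      rw [hp, Pi.smul_apply, smul_eq_mul, RingHom.id_apply]
      ring)
  let Bc := B.mkContinuous₂ _ (norm_kernel_form_le hk)
  let K' := InnerProductSpace.continuousLinearMapOfBilin Bc
  -- The operator attached to a sesquilinear form acts on the antilinear argument; the adjoint moves
  -- it to the linear one.
  refine ⟨ContinuousLinearMap.adjoint K', ?_, fun F G => ?_⟩
  · rw [LinearIsometryEquiv.norm_map]
    refine ContinuousLinearMap.opNorm_le_bound _ ENNReal.toReal_nonneg fun F => ?_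
    have h1 : ‖K' F‖ ^ 2 = ‖Bc F (K' F)‖ := by
      rw [← InnerProductSpace.continuousLinearMapOfBilin_apply, inner_self_eq_norm_sq_to_K]
      simp [K']
    have h2 : ‖Bc F (K' F)‖ ≤ _ := norm_kernel_form_le hk F (K' F)
    rcases (norm_nonneg (K' F)).eq_or_lt with h0 | h0
    · rw [← h0]; positivity
    · rw [← h1, sq] at h2
      exact le_of_mul_le_mul_right h2 h0
  · rw [ContinuousLinearMap.adjoint_inner_right,
      InnerProductSpace.continuousLinearMapOfBilin_apply]
    rfl

end HilbertSchmidt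

end

section

/-! ### Convolution kernels -/

variable {ν : ℕ}

theorem measurePreserving_sub_fst :
    MeasurePreserving (fun p : X ν × X ν => (p.1 - p.2, p.1)) (volume.prod volume)
      (volume.prod volume) := by
  have h := (measurePreserving_prod_add (volume : Measure (X ν)) volume).comp
    (measurePreserving_sub_prod (volume : Measure (X ν)) volume)
  have e : (fun p : X ν × X ν => (p.1 - p.2, p.1)) =
      (fun z : X ν × X ν => (z.1, z.1 + z.2)) ∘ fun z => (z.1 - z.2, z.2) := by
    ext p <;> simp
  rwa [e]

theorem memLp_sub_mul_snd {f g : X ν → ℂ} (hf : MemLp f 2 volume) (hg : MemLp g 2 volume) :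
    MemLp (fun p : X ν × X ν => f (p.1 - p.2) * g p.2) 2 (volume.prod volume) :=
  (memLp_tensor hf hg).comp_measurePreserving (measurePreserving_sub_prod _ _)

theorem memLp_sub_mul_fst {f g : X ν → ℂ} (hf : MemLp f 2 volume) (hg : MemLp g 2 volume) :
    MemLp (fun p : X ν × X ν => f (p.1 - p.2) * g p.1) 2 (volume.prod volume) :=
  (memLp_tensor hf hg).comp_measurePreserving measurePreserving_sub_fst

theorem eLpNorm_sub_mul_snd {f g : X ν → ℂ} (hf : MemLp f 2 volume) (hg : MemLp g 2 volume) :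
    eLpNorm (fun p : X ν × X ν => f (p.1 - p.2) * g p.2) 2 (volume.prod volume) =
      eLpNorm f 2 volume * eLpNorm g 2 volume := by
  have h := eLpNorm_comp_measurePreserving (p := 2) (memLp_tensor hf hg).1
    (measurePreserving_sub_prod (volume : Measure (X ν)) volume)
  rwa [eLpNorm_tensor hf.1 hg.1] at h

theorem eLpNorm_sub_mul_fst {f g : X ν → ℂ} (hf : MemLp f 2 volume) (hg : MemLp g 2 volume) :
    eLpNorm (fun p : X ν × X ν => f (p.1 - p.2) * g p.1) 2 (volume.prod volume) =
      eLpNorm f 2 volume * eLpNorm g 2 volume := by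
  have h := eLpNorm_comp_measurePreserving (p := 2) (memLp_tensor hf hg).1
    (measurePreserving_sub_fst (ν := ν))
  rwa [eLpNorm_tensor hf.1 hg.1] at h

/-- The convolution kernel with the symbol `⟨·⟩ S`. -/
def convKer (S : L2 ν) (p : X ν × X ν) : ℂ := (wt 1 (p.1 - p.2) : ℂ) * S (p.1 - p.2)

theorem aestronglyMeasurable_convKer (S : L2 ν) :
    AEStronglyMeasurable (convKer S) (volume.prod volume) := by
  have h1 : Continuous fun p : X ν × X ν => (wt 1 (p.1 - p.2) : ℂ) :=
    Complex.continuous_ofReal.comp ((contDiff_wt 1).continuous.comp (by fun_prop))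
  refine h1.aestronglyMeasurable.mul ?_
  exact (Lp.memLp S).1.comp_quasiMeasurePreserving
    (quasiMeasurePreserving_sub_of_right_invariant volume volume)

/-- The factor `S(ξ-η)` is not square integrable in both variables together. On the support of `Ψ`,
however, `η` stays in a ball, and the indicator of that ball restores square integrability. -/
theorem integrable_convKer_mul (S : L2 ν) {Ψ : X ν × X ν → ℂ} (hc : Continuous Ψ)
    (hs : HasCompactSupport Ψ) :
    Integrable (fun p => convKer S p * Ψ p) (volume.prod volume) := by
  obtain ⟨R, hR⟩ := hs.isBounded.exists_norm_le
  have hB : MemLp ((Metric.closedBall (0 : X ν) R).indicator fun _ => (1 : ℂ)) 2 volume :=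
    memLp_indicator_const 2 measurableSet_closedBall 1
      (Or.inr (isCompact_closedBall (0 : X ν) R).measure_lt_top.ne)
  have h1 := memLp_sub_mul_snd (Lp.memLp S) hB
  have hw : Continuous fun p : X ν × X ν => (wt 1 (p.1 - p.2) : ℂ) :=
    Complex.continuous_ofReal.comp ((contDiff_wt 1).continuous.comp (by fun_prop))
  have h2 : MemLp (fun p : X ν × X ν => (wt 1 (p.1 - p.2) : ℂ) * Ψ p) 2
      (volume.prod volume) :=
    (hw.mul hc).memLp_of_hasCompactSupport hs.mul_left
  refine (h1.integrable_mul h2).congr (Eventually.of_forall fun p => ?_)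
  by_cases h : Ψ p = 0
  · simp [h]
  · have hp := hR p (subset_tsupport _ h)
    have hp2 : p.2 ∈ Metric.closedBall (0 : X ν) R := by
      simpa using (norm_snd_le p).trans hp
    simp only [Pi.mul_apply, Set.indicator_of_mem hp2, convKer]
    ring

/-- The integral of a function of two variables against a convolution kernel. -/
def kint (S : L2 ν) (Ψ : X ν × X ν → ℂ) : ℂ :=
  ∫ p, convKer S p * Ψ p ∂((volume : Measure (X ν)).prod volume)

theorem kint_add_right (S : L2 ν) {Ψ Φ : X ν × X ν → ℂ} (hc : Continuous Ψ)
    (hs : HasCompactSupport Ψ) (hc' : Continuous Φ) (hs' : HasCompactSupport Φ) :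
    kint S (fun p => Ψ p + Φ p) = kint S Ψ + kint S Φ := by
  rw [kint, kint, kint, ← integral_add (integrable_convKer_mul S hc hs)
    (integrable_convKer_mul S hc' hs')]
  simp only [mul_add]

theorem kint_const_mul_right (S : L2 ν) (c : ℂ) (Ψ : X ν × X ν → ℂ) :
    kint S (fun p => c * Ψ p) = c * kint S Ψ := by
  rw [kint, kint, ← integral_const_mul]
  congr 1
  ext p
  ring

theorem kint_sum_right {ι : Type*} (s : Finset ι) (S : L2 ν) {Ψ : ι → X ν × X ν → ℂ}
    (hc : ∀ i, Continuous (Ψ i)) (hs : ∀ i, HasCompactSupport (Ψ i)) :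
    kint S (fun p => ∑ i ∈ s, Ψ i p) = ∑ i ∈ s, kint S (Ψ i) := by
  simp only [kint, Finset.mul_sum]
  exact integral_finsetSum _ fun i _ => integrable_convKer_mul S (hc i) (hs i)

theorem convKer_add (S S' : L2 ν) :
    convKer (S + S') =ᵐ[volume.prod volume] fun p => convKer S p + convKer S' p := by
  have h := (quasiMeasurePreserving_sub_of_right_invariant (volume : Measure (X ν)) volume).ae
    (Lp.coeFn_add S S')
  filter_upwards [h] with p hp
  rw [convKer, hp, Pi.add_apply, mul_add, convKer, convKer]

theorem kint_add_left (S S' : L2 ν) {Ψ : X ν × X ν → ℂ} (hc : Continuous Ψ)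
    (hs : HasCompactSupport Ψ) : kint (S + S') Ψ = kint S Ψ + kint S' Ψ := by
  rw [kint, kint, kint, ← integral_add (integrable_convKer_mul S hc hs)
    (integrable_convKer_mul S' hc hs)]
  apply integral_congr_ae
  filter_upwards [convKer_add S S'] with p hp
  rw [hp, add_mul]

/-- The unit vectors of the coordinate axes. -/
def unitVec (j : Fin ν) : X ν := EuclideanSpace.single j 1

/-- `⟨·⟩ S'` is the weak derivative of `-⟨·⟩ S` in the direction of the axis `j`. -/
def IsWeakDeriv (j : Fin ν) (S S' : L2 ν) : Prop :=
  ∀ φ : X ν → ℂ, IsTest φ →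
    ∫ ζ, (wt 1 ζ : ℂ) * S' ζ * φ ζ = ∫ ζ, (wt 1 ζ : ℂ) * S ζ * fderiv ℝ φ ζ (unitVec j)

theorem hasCompactSupport_comp_of_norm_le {Ψ : X ν × X ν → ℂ} (hs : HasCompactSupport Ψ)
    {A : X ν → X ν × X ν} {C : ℝ} (hA : ∀ ζ, ‖ζ‖ ≤ 2 * ‖A ζ‖ + C) :
    HasCompactSupport fun ζ => Ψ (A ζ) := by
  obtain ⟨R, hR⟩ := hs.isBounded.exists_norm_le
  refine HasCompactSupport.of_support_subset_isCompact
    (isCompact_closedBall (0 : X ν) (2 * R + C)) fun ζ hζ => ?_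
  have h := hR (A ζ) (subset_tsupport _ hζ)
  simpa using (hA ζ).trans (by linarith)

/-- For fixed `η`, substitute `ξ = ζ + η` and use the weak derivative in `ζ`. The sign convention of
`IsWeakDeriv` leaves no minus sign. -/
theorem kint_fderiv_fst {j : Fin ν} {S S' : L2 ν} (h : IsWeakDeriv j S S') {Ψ : X ν × X ν → ℂ}
    (hc : ContDiff ℝ ∞ Ψ) (hs : HasCompactSupport Ψ) :
    kint S (fun p => fderiv ℝ Ψ p (unitVec j, 0)) = kint S' Ψ := by
  have hcd : Continuous fun p => fderiv ℝ Ψ p (unitVec j, 0) :=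
    (hc.continuous_fderiv (by simp)).clm_apply continuous_const
  have hsd : HasCompactSupport fun p => fderiv ℝ Ψ p (unitVec j, 0) :=
    hs.fderiv_apply (𝕜 := ℝ) _
  rw [kint, kint, integral_prod_symm _ (integrable_convKer_mul S hcd hsd),
    integral_prod_symm _ (integrable_convKer_mul S' hc.continuous hs)]
  congr 1
  ext1 η
  have ht : IsTest fun ζ => Ψ (ζ + η, η) := by
    refine ⟨hc.comp (by fun_prop), hasCompactSupport_comp_of_norm_le hs (C := 0) fun ζ => ?_⟩
    have h1 := norm_fst_le (ζ + η, η)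
    have h2 := norm_snd_le (ζ + η, η)
    have h3 := norm_sub_le (ζ + η) η
    simp only [add_sub_cancel_right] at h3
    linarith
  have hfd : ∀ ζ, fderiv ℝ (fun ζ => Ψ (ζ + η, η)) ζ (unitVec j) =
      fderiv ℝ Ψ (ζ + η, η) (unitVec j, 0) := by
    intro ζ
    have h1 : HasFDerivAt Ψ (fderiv ℝ Ψ (ζ + η, η)) (ζ + η, η) :=
      (hc.differentiable (by simp) _).hasFDerivAt
    have h2 : HasFDerivAt (fun ζ : X ν => (ζ + η, η))
        ((ContinuousLinearMap.id ℝ (X ν)).prod (0 : X ν →L[ℝ] X ν)) ζ :=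
      ((hasFDerivAt_id ζ).add_const η).prodMk (hasFDerivAt_const η ζ)
    have h3 : HasFDerivAt (fun ζ => Ψ (ζ + η, η)) _ ζ := h1.comp ζ h2
    rw [h3.fderiv]
    simp
  have key := h _ ht
  simp only [hfd] at key
  rw [← integral_sub_right_eq_self _ η,
    ← integral_sub_right_eq_self (fun ζ => (wt 1 ζ : ℂ) * S ζ * _) η] at key
  simp only [sub_add_cancel] at key
  exact key.symm

/-- For fixed `ξ`, substitute `η = ξ - ζ`. The orientation of `ζ` is reversed, hence the minus sign.
-/
theorem kint_fderiv_snd {j : Fin ν} {S S' : L2 ν} (h : IsWeakDeriv j S S') {Ψ : X ν × X ν → ℂ}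
    (hc : ContDiff ℝ ∞ Ψ) (hs : HasCompactSupport Ψ) :
    kint S (fun p => fderiv ℝ Ψ p (0, unitVec j)) = -kint S' Ψ := by
  have hcd : Continuous fun p => fderiv ℝ Ψ p (0, unitVec j) :=
    (hc.continuous_fderiv (by simp)).clm_apply continuous_const
  have hsd : HasCompactSupport fun p => fderiv ℝ Ψ p (0, unitVec j) :=
    hs.fderiv_apply (𝕜 := ℝ) _
  rw [kint, kint, integral_prod _ (integrable_convKer_mul S hcd hsd),
    integral_prod _ (integrable_convKer_mul S' hc.continuous hs), ← integral_neg]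
  congr 1
  ext1 ξ
  have ht : IsTest fun ζ => Ψ (ξ, ξ - ζ) := by
    refine ⟨hc.comp (by fun_prop), hasCompactSupport_comp_of_norm_le hs (C := 0) fun ζ => ?_⟩
    have h1 := norm_fst_le (ξ, ξ - ζ)
    have h2 := norm_snd_le (ξ, ξ - ζ)
    have h3 := norm_sub_le ξ (ξ - ζ)
    simp only [sub_sub_cancel] at h3
    simp only at h1 h2
    linarith
  have hfd : ∀ ζ, fderiv ℝ (fun ζ => Ψ (ξ, ξ - ζ)) ζ (unitVec j) =
      -fderiv ℝ Ψ (ξ, ξ - ζ) (0, unitVec j) := by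
    intro ζ
    have h1 : HasFDerivAt Ψ (fderiv ℝ Ψ (ξ, ξ - ζ)) (ξ, ξ - ζ) :=
      (hc.differentiable (by simp) _).hasFDerivAt
    have h2 : HasFDerivAt (fun ζ : X ν => (ξ, ξ - ζ))
        ((0 : X ν →L[ℝ] X ν).prod (-ContinuousLinearMap.id ℝ (X ν))) ζ :=
      (hasFDerivAt_const ξ ζ).prodMk ((hasFDerivAt_id ζ).const_sub ξ)
    have h3 : HasFDerivAt (fun ζ => Ψ (ξ, ξ - ζ)) _ ζ := h1.comp ζ h2
    rw [h3.fderiv, ← map_neg]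
    simp
  have key := h _ ht
  simp only [hfd] at key
  rw [← integral_sub_left_eq_self _ volume ξ,
    ← integral_sub_left_eq_self (fun ζ => (wt 1 ζ : ℂ) * S ζ * _) volume ξ] at key
  simp only [sub_sub_cancel, mul_neg, integral_neg] at key
  simp only [convKer]
  rw [key, neg_neg]

theorem sum_unitVec (v : X ν) : ∑ j, v j • unitVec j = v := by
  ext i
  simp [unitVec, Pi.single_apply]

theorem contDiff_field_apply (j : Fin ν) : ContDiff ℝ ∞ fun ξ : X ν => field ξ j :=
  (EuclideanSpace.proj j : X ν →L[ℝ] ℝ).contDiff.comp contDiff_field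

theorem hasFDerivAt_speed_norm (ξ : X ν) :
    ∃ L : X ν →L[ℝ] ℝ, HasFDerivAt (fun ξ : X ν => speed ν ‖ξ‖) L ξ ∧
      L ξ = speed ν ‖ξ‖ * (-((ν : ℝ) + 1) * (4 * Real.pi ^ 2 * ‖ξ‖ ^ 2) /
        (1 + 4 * Real.pi ^ 2 * ‖ξ‖ ^ 2)) := by
  have hd : DifferentiableAt ℝ (fun ξ : X ν => speed ν ‖ξ‖) ξ :=
    contDiff_speed_norm.differentiable (by simp) ξ
  refine ⟨_, hd.hasFDerivAt, ?_⟩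
  by_cases h : ξ = 0
  · subst h
    simp
  · obtain ⟨h1, h2⟩ := fderiv_comp_norm_field h (hasDerivAt_speed ν ‖ξ‖)
    rw [← h1.fderiv, field, map_smul, smul_eq_mul] at h2
    have hp := speed_pos ν ‖ξ‖
    -- The derivative is known in the direction `field ξ = speed · ξ`; dividing by the positive
    -- speed gives it in the direction `ξ`.
    apply mul_left_cancel₀ hp.ne'
    rw [h2]
    ring

/-- Shows that the explicit expression `divField` is the divergence of `b`: with `σ` the speed,
`div(σξ) = νσ + ξ·∇σ`. -/
theorem sum_fderiv_field (ξ : X ν) :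
    ∑ j, fderiv ℝ (fun ξ : X ν => field ξ j) ξ (unitVec j) = divField ξ := by
  obtain ⟨L, hL, hL2⟩ := hasFDerivAt_speed_norm ξ
  have h : ∀ j : Fin ν, fderiv ℝ (fun ξ : X ν => field ξ j) ξ (unitVec j) =
      speed ν ‖ξ‖ + ξ j * L (unitVec j) := by
    intro j
    have h1 : HasFDerivAt (fun ξ : X ν => speed ν ‖ξ‖ * ξ j) _ ξ :=
      hL.mul (EuclideanSpace.proj j : X ν →L[ℝ] ℝ).hasFDerivAt
    have h2 : (fun ξ : X ν => field ξ j) = fun ξ : X ν => speed ν ‖ξ‖ * ξ j := by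
      ext η
      simp [field]
    rw [h2, h1.fderiv]
    simp [unitVec]
  have h3 : ∑ j, ξ j * L (unitVec j) = L ξ := by
    conv_rhs => rw [← sum_unitVec ξ, map_sum]
    simp
  simp only [h]
  rw [Finset.sum_add_distrib, h3, hL2, divField]
  simp
  ring

theorem hasFDerivAt_field_apply (j : Fin ν) (ξ : X ν) :
    HasFDerivAt (fun ξ : X ν => field ξ j) (fderiv ℝ (fun ξ : X ν => field ξ j) ξ) ξ :=
  ((contDiff_field_apply j).differentiable (by simp) ξ).hasFDerivAt

theorem fderiv_field_fst_smul {Θ : X ν × X ν → ℂ} (hc : ContDiff ℝ ∞ Θ) (j : Fin ν)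
    (p : X ν × X ν) :
    fderiv ℝ (fun p : X ν × X ν => (field p.1 j : ℝ) • Θ p) p (unitVec j, 0) =
      (field p.1 j : ℝ) • fderiv ℝ Θ p (unitVec j, 0) +
        (fderiv ℝ (fun ξ : X ν => field ξ j) p.1 (unitVec j)) • Θ p := by
  have e1 : HasFDerivAt (fun p : X ν × X ν => field p.1 j)
      ((fderiv ℝ (fun ξ : X ν => field ξ j) p.1).comp
        (ContinuousLinearMap.fst ℝ (X ν) (X ν))) p :=
    (hasFDerivAt_field_apply j p.1).comp p hasFDerivAt_fst
  rw [(e1.fun_smul (hc.differentiable (by simp) p).hasFDerivAt).fderiv]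
  rfl

theorem fderiv_field_snd_smul {Θ : X ν × X ν → ℂ} (hc : ContDiff ℝ ∞ Θ) (j : Fin ν)
    (p : X ν × X ν) :
    fderiv ℝ (fun p : X ν × X ν => (field p.2 j : ℝ) • Θ p) p (0, unitVec j) =
      (field p.2 j : ℝ) • fderiv ℝ Θ p (0, unitVec j) +
        (fderiv ℝ (fun ξ : X ν => field ξ j) p.2 (unitVec j)) • Θ p := by
  have e1 : HasFDerivAt (fun p : X ν × X ν => field p.2 j)
      ((fderiv ℝ (fun ξ : X ν => field ξ j) p.2).comp
        (ContinuousLinearMap.snd ℝ (X ν) (X ν))) p :=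
    (hasFDerivAt_field_apply j p.2).comp p hasFDerivAt_snd
  rw [(e1.fun_smul (hc.differentiable (by simp) p).hasFDerivAt).fderiv]
  rfl

/-- Product rule on the doubled space: the derivative along `(b, b)` is the divergence of the field
times `Θ`, minus the divergence of the field multiplied by `Θ`. -/
theorem fderiv_apply_field {Θ : X ν × X ν → ℂ} (hc : ContDiff ℝ ∞ Θ) (p : X ν × X ν) :
    fderiv ℝ Θ p (field p.1, field p.2) =
      (∑ j, (fderiv ℝ (fun p : X ν × X ν => (field p.1 j : ℝ) • Θ p) p (unitVec j, 0) +
        fderiv ℝ (fun p : X ν × X ν => (field p.2 j : ℝ) • Θ p) p (0, unitVec j))) +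
        (-1 : ℂ) * (((divField p.1 + divField p.2 : ℝ) : ℂ) * Θ p) := by
  have e : ((field p.1, field p.2) : X ν × X ν) =
      ∑ j, ((field p.1 j) • ((unitVec j, 0) : X ν × X ν) +
        (field p.2 j) • ((0, unitVec j) : X ν × X ν)) := by
    rw [Finset.sum_add_distrib]
    ext1
    · simp [Prod.fst_sum, sum_unitVec]
    · simp [Prod.snd_sum, sum_unitVec]
  rw [e, map_sum]
  simp only [fderiv_field_fst_smul hc, fderiv_field_snd_smul hc, map_add, map_smul]
  rw [← sum_fderiv_field, ← sum_fderiv_field, ← Finset.sum_add_distrib, Complex.ofReal_sum,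
    Finset.sum_mul, Finset.mul_sum, ← Finset.sum_add_distrib]
  refine Finset.sum_congr rfl fun j _ => ?_
  simp only [Complex.real_smul, Complex.ofReal_add]
  ring

theorem hasCompactSupport_sum {ι : Type*} (s : Finset ι) {Ψ : ι → X ν × X ν → ℂ}
    (h : ∀ i, HasCompactSupport (Ψ i)) : HasCompactSupport fun p => ∑ i ∈ s, Ψ i p := by
  classical
  induction s using Finset.induction_on with
  | empty => exact HasCompactSupport.zero
  | insert i s hi ih =>
    simp only [Finset.sum_insert hi]
    exact (h i).add ih

theorem kint_sum_add (S : L2 ν) {P Q : Fin ν → X ν × X ν → ℂ} {D : X ν × X ν → ℂ}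
    (hP : ∀ j, Continuous (P j)) (hQ : ∀ j, Continuous (Q j)) (hD : Continuous D)
    (sP : ∀ j, HasCompactSupport (P j)) (sQ : ∀ j, HasCompactSupport (Q j))
    (sD : HasCompactSupport D) :
    kint S (fun p => (∑ j, (P j p + Q j p)) + (-1 : ℂ) * D p) =
      ∑ j, (kint S (P j) + kint S (Q j)) - kint S D := by
  have c : ∀ j, Continuous fun p => P j p + Q j p := fun j => (hP j).add (hQ j)
  have k : ∀ j, HasCompactSupport fun p => P j p + Q j p := fun j => (sP j).add (sQ j)
  rw [kint_add_right (Ψ := fun p => ∑ j, (P j p + Q j p)) (Φ := fun p => (-1 : ℂ) * D p) S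
    (continuous_finsetSum _ fun j _ => c j)
    (hasCompactSupport_sum _ k) (continuous_const.mul hD) sD.mul_left,
    kint_sum_right _ S c k, kint_const_mul_right, neg_one_mul, ← sub_eq_add_neg]
  congr 1
  exact Finset.sum_congr rfl fun j _ => kint_add_right S (hP j) (sP j) (hQ j) (sQ j)

theorem kint_sub_right (S : L2 ν) {Ψ Φ : X ν × X ν → ℂ} (hc : Continuous Ψ)
    (hs : HasCompactSupport Ψ) (hc' : Continuous Φ) (hs' : HasCompactSupport Φ) :
    kint S (fun p => Ψ p - Φ p) = kint S Ψ - kint S Φ := by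
  rw [kint, kint, kint, ← integral_sub (integrable_convKer_mul S hc hs)
    (integrable_convKer_mul S hc' hs')]
  simp only [mul_sub]

theorem hasCompactSupport_fun_smul {b : X ν × X ν → ℝ} {Θ : X ν × X ν → ℂ}
    (hs : HasCompactSupport Θ) : HasCompactSupport fun p => b p • Θ p :=
  hs.mono fun p hp => by
    simp only [Function.mem_support] at hp ⊢
    exact right_ne_zero_of_smul hp

/-- The two integrations by parts have opposite signs, so only the difference of `b` at the two
points appears. -/
theorem kint_fderiv_smul_add {j : Fin ν} {S S' : L2 ν} (h : IsWeakDeriv j S S')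
    {b : X ν → ℝ} (hb : ContDiff ℝ ∞ b) {Θ : X ν × X ν → ℂ} (hc : ContDiff ℝ ∞ Θ)
    (hs : HasCompactSupport Θ) :
    kint S (fun p => fderiv ℝ (fun p : X ν × X ν => b p.1 • Θ p) p (unitVec j, 0)) +
      kint S (fun p => fderiv ℝ (fun p : X ν × X ν => b p.2 • Θ p) p (0, unitVec j)) =
      kint S' (fun p => ((b p.1 - b p.2 : ℝ) : ℂ) * Θ p) := by
  have c1 : ContDiff ℝ ∞ fun p : X ν × X ν => b p.1 • Θ p := (hb.comp contDiff_fst).smul hc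
  have c2 : ContDiff ℝ ∞ fun p : X ν × X ν => b p.2 • Θ p := (hb.comp contDiff_snd).smul hc
  have s1 : HasCompactSupport fun p : X ν × X ν => b p.1 • Θ p :=
    hasCompactSupport_fun_smul hs
  have s2 : HasCompactSupport fun p : X ν × X ν => b p.2 • Θ p :=
    hasCompactSupport_fun_smul hs
  rw [kint_fderiv_fst h c1 s1, kint_fderiv_snd h c2 s2, ← sub_eq_add_neg,
    ← kint_sub_right _ c1.continuous s1 c2.continuous s2]
  congr 1
  ext p
  simp only [Complex.real_smul, Complex.ofReal_sub]
  ring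

theorem continuous_fderiv_smul {b : X ν × X ν → ℝ} (hb : ContDiff ℝ ∞ b) {Θ : X ν × X ν → ℂ}
    (hc : ContDiff ℝ ∞ Θ) (v : X ν × X ν) :
    Continuous fun p => fderiv ℝ (fun p => b p • Θ p) p v :=
  ((hb.smul hc).continuous_fderiv (by simp)).clm_apply continuous_const

theorem hasCompactSupport_fderiv_smul {b : X ν × X ν → ℝ} {Θ : X ν × X ν → ℂ}
    (hs : HasCompactSupport Θ) (v : X ν × X ν) :
    HasCompactSupport fun p => fderiv ℝ (fun p => b p • Θ p) p v :=
  HasCompactSupport.fderiv_apply (𝕜 := ℝ) (f := fun p => b p • Θ p)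
    (hasCompactSupport_fun_smul hs) v

/-- Integration by parts along the vector field `(b(ξ), b(η))`. -/
theorem kint_fderiv_field {S : L2 ν} {S' : Fin ν → L2 ν} (h : ∀ j, IsWeakDeriv j S (S' j))
    {Θ : X ν × X ν → ℂ} (hc : ContDiff ℝ ∞ Θ) (hs : HasCompactSupport Θ) :
    kint S (fun p => fderiv ℝ Θ p (field p.1, field p.2)) =
      ∑ j, kint (S' j) (fun p => ((field p.1 j - field p.2 j : ℝ) : ℂ) * Θ p) -
        kint S (fun p => ((divField p.1 + divField p.2 : ℝ) : ℂ) * Θ p) := by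
  have cdiv : Continuous fun p : X ν × X ν => ((divField p.1 + divField p.2 : ℝ) : ℂ) * Θ p := by
    have := (contDiff_divField (ν := ν)).continuous
    have := hc.continuous
    fun_prop
  have hb1 : ∀ j, ContDiff ℝ ∞ fun p : X ν × X ν => field p.1 j := fun j =>
    ContDiff.comp (contDiff_field_apply j) contDiff_fst
  have hb2 : ∀ j, ContDiff ℝ ∞ fun p : X ν × X ν => field p.2 j := fun j =>
    ContDiff.comp (contDiff_field_apply j) contDiff_snd
  rw [show (fun p => fderiv ℝ Θ p (field p.1, field p.2)) = _ from funext (fderiv_apply_field hc),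
    kint_sum_add S (fun j => continuous_fderiv_smul (hb1 j) hc _)
      (fun j => continuous_fderiv_smul (hb2 j) hc _) cdiv
      (fun j => hasCompactSupport_fderiv_smul hs _)
      (fun j => hasCompactSupport_fderiv_smul hs _) hs.mul_left]
  congr 1
  exact Finset.sum_congr rfl fun j _ => kint_fderiv_smul_add (h j) (contDiff_field_apply j) hc hs

end

section

/-! ### Symbols -/

variable {ν : ℕ} {F : Type*} [NormedAddCommGroup F] [NormedSpace ℝ F]

theorem wt_add (s t : ℝ) (ξ : X ν) : wt (s + t) ξ = wt s ξ * wt t ξ := by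
  rw [wt, wt, wt, add_div, Real.rpow_add (wt_base_pos ξ)]

theorem wt_le_wt {s t : ℝ} (h : s ≤ t) (ξ : X ν) : wt s ξ ≤ wt t ξ :=
  Real.rpow_le_rpow_of_exponent_le (by nlinarith [sq_nonneg ‖ξ‖]) (by linarith)

theorem wt_one (ξ : X ν) : wt 1 ξ = jap ξ := by
  rw [wt, jap, Real.sqrt_eq_rpow]

theorem jap_rpow (s : ℝ) (ξ : X ν) : jap ξ ^ s = wt s ξ := by
  rw [jap, Real.sqrt_eq_rpow, ← Real.rpow_mul (wt_base_pos ξ).le, wt]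
  ring_nf

theorem norm_le_wt_one (ξ : X ν) : ‖ξ‖ ≤ wt 1 ξ := by
  rw [wt_one, jap]
  exact Real.le_sqrt_of_sq_le (by linarith)

/-- Smooth functions all of whose derivatives are `O(⟨x⟩^m)`. -/
def IsSymbol (m : ℝ) (f : X ν → F) : Prop :=
  ContDiff ℝ ∞ f ∧ ∀ n : ℕ, ∃ C : ℝ, ∀ x, ‖iteratedFDeriv ℝ n f x‖ ≤ C * wt m x

theorem sum_mul_choose_le {n : ℕ} {a b c d : ℕ → ℝ} {v w : ℝ}
    (ha : ∀ k ≤ n, 0 ≤ a k ∧ a k ≤ c k * v) (hb : ∀ k ≤ n, 0 ≤ b k ∧ b k ≤ d k * w) :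
    ∑ i ∈ Finset.range (n + 1), (n.choose i : ℝ) * a i * b (n - i) ≤
      (∑ i ∈ Finset.range (n + 1), (n.choose i : ℝ) * c i * d (n - i)) * (v * w) := by
  rw [Finset.sum_mul]
  refine Finset.sum_le_sum fun i hi => ?_
  have hi' : i ≤ n := Nat.lt_succ_iff.1 (Finset.mem_range.1 hi)
  obtain ⟨ha1, ha2⟩ := ha i hi'
  obtain ⟨hb1, hb2⟩ := hb (n - i) (Nat.sub_le _ _)
  have h := mul_le_mul ha2 hb2 hb1 (ha1.trans ha2)
  calc (n.choose i : ℝ) * a i * b (n - i) = n.choose i * (a i * b (n - i)) := by ring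
    _ ≤ n.choose i * (c i * v * (d (n - i) * w)) := by gcongr
    _ = _ := by ring

theorem IsSymbol.smul {m m' : ℝ} {f : X ν → ℝ} {g : X ν → F} (hf : IsSymbol m f)
    (hg : IsSymbol m' g) : IsSymbol (m + m') fun x => f x • g x := by
  refine ⟨hf.1.smul hg.1, fun n => ?_⟩
  choose c hc using hf.2
  choose d hd using hg.2
  refine ⟨∑ i ∈ Finset.range (n + 1), (n.choose i : ℝ) * c i * d (n - i), fun x =>
    (norm_iteratedFDeriv_smul_le (N := ∞) hf.1 hg.1 x (mod_cast le_top)).trans ?_⟩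
  rw [wt_add]
  exact sum_mul_choose_le (fun k _ => ⟨norm_nonneg _, hc k x⟩) fun k _ => ⟨norm_nonneg _, hd k x⟩

theorem IsSymbol.mono {m m' : ℝ} {f : X ν → F} (hf : IsSymbol m f) (h : m ≤ m') :
    IsSymbol m' f := by
  refine ⟨hf.1, fun n => ?_⟩
  obtain ⟨C, hC⟩ := hf.2 n
  refine ⟨|C|, fun x => (hC x).trans ?_⟩
  have := wt_le_wt h x
  have := wt_pos m x
  gcongr
  exact le_abs_self C

theorem IsSymbol.fderiv {m : ℝ} {f : X ν → F} (hf : IsSymbol m f) :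
    IsSymbol m (fderiv ℝ f) := by
  refine ⟨hf.1.fderiv_right (by simp), fun n => ?_⟩
  obtain ⟨C, hC⟩ := hf.2 (n + 1)
  exact ⟨C, fun x => by rw [norm_iteratedFDeriv_fderiv]; exact hC x⟩

theorem isSymbol_const (c : F) : IsSymbol 0 (fun _ : X ν => c) := by
  refine ⟨contDiff_const, fun n => ?_⟩
  rcases n with - | n
  · exact ⟨‖c‖, fun x => by simp⟩
  · exact ⟨0, fun x => by simp [iteratedFDeriv_succ_const]⟩

theorem isSymbol_clm (L : X ν →L[ℝ] F) : IsSymbol 1 L := by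
  refine ⟨L.contDiff, fun n => ?_⟩
  rcases n with - | n
  · refine ⟨‖L‖, fun x => ?_⟩
    rw [norm_iteratedFDeriv_zero]
    exact (L.le_opNorm x).trans (mul_le_mul_of_nonneg_left (norm_le_wt_one x) (norm_nonneg _))
  · obtain ⟨C, hC⟩ := ((isSymbol_const L).mono zero_le_one).2 n
    refine ⟨C, fun x => ?_⟩
    rw [← norm_iteratedFDeriv_fderiv, show _root_.fderiv ℝ L = fun _ => L from
      funext fun x => L.fderiv]
    exact hC x

theorem IsSymbol.clm_comp {m : ℝ} {f : X ν → F} (hf : IsSymbol m f) {G : Type*}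
    [NormedAddCommGroup G] [NormedSpace ℝ G] (L : F →L[ℝ] G) : IsSymbol m fun x => L (f x) := by
  refine ⟨L.contDiff.comp hf.1, fun n => ?_⟩
  obtain ⟨C, hC⟩ := hf.2 n
  refine ⟨‖L‖ * C, fun x => ?_⟩
  refine (L.norm_iteratedFDeriv_comp_left hf.1.contDiffAt (mod_cast le_top)).trans ?_
  rw [mul_assoc]
  exact mul_le_mul_of_nonneg_left (hC x) (norm_nonneg _)

theorem fderiv_wt (s : ℝ) : _root_.fderiv ℝ (wt s : X ν → ℝ) =
    fun x => (s * wt (s - 2) x) • innerSL ℝ x := by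
  ext1 x
  have h1 : HasFDerivAt (fun x : X ν => 1 + ‖x‖ ^ 2) (2 • innerSL ℝ x) x :=
    (hasStrictFDerivAt_norm_sq x).hasFDerivAt.const_add 1
  have h2 : HasFDerivAt (wt s) _ x := h1.rpow_const (p := s / 2) (Or.inl (wt_base_pos x).ne')
  rw [h2.fderiv, wt, show (s - 2) / 2 = s / 2 - 1 by ring]
  ext v
  simp
  ring

/-- The gradient of `⟨x⟩^s` is `s⟨x⟩^{s-2}x`. By the Leibniz rule its derivatives involve only
lower-order derivatives of `⟨x⟩^{s-2}`, so the induction on the order runs over all `s` at once. -/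
theorem isSymbol_wt (s : ℝ) : IsSymbol s (wt s : X ν → ℝ) := by
  refine ⟨contDiff_wt s, fun n => ?_⟩
  induction n using Nat.strong_induction_on generalizing s with
  | _ n ih =>
    rcases n with - | n
    · exact ⟨1, fun x => by simp [abs_of_pos (wt_pos s x)]⟩
    · choose c hc using fun k (hk : k ≤ n) => ih k (by omega) (s - 2)
      choose d hd using (isSymbol_clm (ν := ν) (innerSL ℝ : X ν →L[ℝ] _)).2
      refine ⟨‖s‖ * |∑ i ∈ Finset.range (n + 1), (n.choose i : ℝ) *
        (if hk : i ≤ n then c i hk else 0) * d (n - i)|, fun x => ?_⟩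
      rw [← norm_iteratedFDeriv_fderiv, fderiv_wt]
      simp only [mul_smul]
      rw [iteratedFDeriv_const_smul_apply' (a := s)
        (f := fun x : X ν => wt (s - 2) x • (innerSL ℝ : X ν →L[ℝ] _) x)
        (((contDiff_wt (s - 2)).smul (innerSL ℝ : X ν →L[ℝ] _).contDiff).contDiffAt.of_le (mod_cast le_top)), norm_smul]
      have h := (norm_iteratedFDeriv_smul_le (N := ∞) (n := n) (contDiff_wt (s - 2))
        (innerSL ℝ : X ν →L[ℝ] _).contDiff x (mod_cast le_top)).trans
        (sum_mul_choose_le (c := fun k => if hk : k ≤ n then c k hk else 0)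
          (fun k hk => ⟨norm_nonneg _, by simpa [hk] using hc k hk x⟩)
          fun k _ => ⟨norm_nonneg _, hd k x⟩)
      rw [← wt_add] at h
      have h2 : wt (s - 2 + 1) x ≤ wt s x := wt_le_wt (by linarith) x
      refine (mul_le_mul_of_nonneg_left (h.trans (mul_le_mul (le_abs_self _) h2
        (wt_pos _ _).le (abs_nonneg _))) (norm_nonneg _)).trans_eq (mul_assoc _ _ _).symm

theorem IsSymbol.hasTemperateGrowth {f : X ν → F} (hf : IsSymbol 0 f) :
    Function.HasTemperateGrowth f := by
  refine ⟨hf.1, fun n => ?_⟩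
  obtain ⟨C, hC⟩ := hf.2 n
  exact ⟨0, C, fun x => by simpa using hC x⟩

theorem IsSymbol.comp_clm {f : X ν → F} (hf : IsSymbol 0 f) (L : X ν →L[ℝ] X ν) :
    IsSymbol 0 fun x => f (L x) := by
  refine ⟨hf.1.comp L.contDiff, fun n => ?_⟩
  obtain ⟨C, hC⟩ := hf.2 n
  refine ⟨C * ‖L‖ ^ n, fun x => ?_⟩
  have h := L.iteratedFDeriv_comp_right hf.1 x (i := n) (mod_cast le_top)
  rw [show (fun x => f (L x)) = f ∘ L from rfl, h, wt_zero, mul_one]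
  refine (ContinuousMultilinearMap.norm_compContinuousLinearMap_le _ _).trans ?_
  rw [Finset.prod_const, Finset.card_univ, Fintype.card_fin]
  have := hC (L x)
  simp only [wt_zero, mul_one] at this
  gcongr

/-- The weight has order `-ν-1` and the identity has order 1, so the total order is `-ν ≤ 0`. -/
theorem isSymbol_uField : IsSymbol 0 (uField ν) := by
  have h := (isSymbol_wt (-(ν : ℝ) - 1)).smul (isSymbol_clm (ContinuousLinearMap.id ℝ (X ν)))
  have e : (uField ν) = fun x => wt (-(ν : ℝ) - 1) x • (ContinuousLinearMap.id ℝ (X ν)) x := by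
    ext1 x
    rw [uField, jap_rpow]
    rfl
  rw [e]
  exact h.mono (by linarith [(Nat.cast_nonneg ν : (0 : ℝ) ≤ ν)])

theorem isClassU_uField : IsClassU (uField ν) := by
  refine ⟨isSymbol_uField.1, fun n => ?_, fun x hx => ?_⟩
  · obtain ⟨C, hC⟩ := isSymbol_uField.2 n
    exact ⟨C, fun x => by simpa using hC x⟩
  · rw [uField, jap_rpow, inner_smul_right, real_inner_self_eq_norm_sq]
    have := wt_pos (-(ν : ℝ) - 1) x
    have := norm_pos_iff.2 hx
    positivity

/-- The factors `2π` convert between the frequency `ξ` and the momentum `2πξ`. -/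
theorem field_eq (ξ : X ν) : field ξ = (2 * Real.pi)⁻¹ • uField ν ((2 * Real.pi) • ξ) := by
  rw [uField, jap_rpow, wt, field, speed, norm_smul, smul_smul, smul_smul, Real.norm_of_nonneg
    (by positivity), mul_pow, mul_pow]
  congr 1
  have := Real.pi_pos
  field_simp
  norm_num
  ring_nf

theorem isSymbol_field : IsSymbol 0 (field : X ν → X ν) := by
  have h := ((isSymbol_uField (ν := ν)).comp_clm
    ((2 * Real.pi) • ContinuousLinearMap.id ℝ (X ν))).clm_comp
    ((2 * Real.pi)⁻¹ • ContinuousLinearMap.id ℝ (X ν))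
  convert! h using 2 with ξ
  exact field_eq ξ

theorem isSymbol_field_apply (j : Fin ν) : IsSymbol 0 fun ξ : X ν => field ξ j :=
  isSymbol_field.clm_comp (EuclideanSpace.proj j : X ν →L[ℝ] ℝ)

theorem isSymbol_fderiv_field (i j : Fin ν) :
    IsSymbol 0 fun ξ : X ν => _root_.fderiv ℝ (fun ξ : X ν => field ξ j) ξ (unitVec i) :=
  (isSymbol_field_apply j).fderiv.clm_comp (ContinuousLinearMap.apply ℝ ℝ (unitVec i))

theorem IsSymbol.add {m : ℝ} {f g : X ν → F} (hf : IsSymbol m f) (hg : IsSymbol m g) :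
    IsSymbol m fun x => f x + g x := by
  refine ⟨hf.1.add hg.1, fun n => ?_⟩
  obtain ⟨C, hC⟩ := hf.2 n
  obtain ⟨D, hD⟩ := hg.2 n
  refine ⟨C + D, fun x => ?_⟩
  rw [fun_iteratedFDeriv_add_apply (hf.1.contDiffAt.of_le (mod_cast le_top))
    (hg.1.contDiffAt.of_le (mod_cast le_top)), add_mul]
  exact (norm_add_le _ _).trans (add_le_add (hC x) (hD x))

theorem IsSymbol.sum {ι : Type*} (s : Finset ι) {m : ℝ} (hm : 0 ≤ m) {f : ι → X ν → F}
    (hf : ∀ i, IsSymbol m (f i)) : IsSymbol m fun x => ∑ i ∈ s, f i x := by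
  classical
  induction s using Finset.induction_on with
  | empty => simpa using (isSymbol_const (0 : F)).mono hm
  | insert i s hi ih =>
    simp only [Finset.sum_insert hi]
    exact (hf i).add ih

theorem isSymbol_divField : IsSymbol 0 (divField : X ν → ℝ) := by
  have h := IsSymbol.sum Finset.univ le_rfl fun j => isSymbol_fderiv_field (ν := ν) j j
  simpa only [sum_fderiv_field] using h

theorem IsSymbol.bounded {f : X ν → F} (hf : IsSymbol 0 f) : ∃ C, ∀ x, ‖f x‖ ≤ C := by
  obtain ⟨C, hC⟩ := hf.2 0
  exact ⟨C, fun x => by simpa using hC x⟩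

end

section

/-! ### Bounded operators with convolution kernels, and their commutators -/

variable {ν : ℕ}

theorem wt_one_sq (ξ : X ν) : wt 1 ξ ^ 2 = 1 + ‖ξ‖ ^ 2 := by
  rw [wt_one, jap, Real.sq_sqrt (wt_base_pos ξ).le]

/-- Lets the weights of `H^1` in `ξ` and `η` absorb the growth `⟨ξ-η⟩` carried by the transform of
an element of `H^{-1}`. -/
theorem wt_one_sub_le (ξ η : X ν) : wt 1 (ξ - η) ≤ 2 * (wt 1 ξ * wt 1 η) := by
  refine le_of_sq_le_sq ?_ (by have := wt_pos 1 ξ; have := wt_pos 1 η; positivity)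
  rw [mul_pow, mul_pow, wt_one_sq, wt_one_sq, wt_one_sq]
  have h := norm_sub_le ξ η
  have h2 : ‖ξ - η‖ ^ 2 ≤ (‖ξ‖ + ‖η‖) ^ 2 := pow_le_pow_left₀ (norm_nonneg _) h 2
  nlinarith [sq_nonneg (‖ξ‖ - ‖η‖), mul_nonneg (sq_nonneg ‖ξ‖) (sq_nonneg ‖η‖), sq_nonneg ‖ξ‖,
    sq_nonneg ‖η‖]

/-- The decay of the vector field `b` and of its divergence. -/
def decay (ξ : X ν) : ℝ := wt (-(ν : ℝ)) ξ

theorem decay_pos (ξ : X ν) : 0 < decay ξ := wt_pos _ _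

theorem decay_le_one (ξ : X ν) : decay ξ ≤ 1 := by
  have h := wt_le_wt (s := -(ν : ℝ)) (t := 0) (by simp) ξ
  simpa [decay] using h

/-- The square is `⟨ξ⟩^{-2ν}`, integrable because `2ν > ν`. The decay exponent of `u` and the
positivity of the dimension are used here. -/
theorem memLp_decay (hν : 0 < ν) : MemLp (fun ξ : X ν => (decay ξ : ℂ)) 2 volume := by
  have hc : Continuous fun ξ : X ν => (decay ξ : ℂ) :=
    Complex.continuous_ofReal.comp (contDiff_wt _).continuous
  rw [memLp_two_iff_integrable_sq_norm hc.aestronglyMeasurable]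
  have h := integrable_rpow_neg_one_add_norm_sq (E := X ν) (μ := volume) (r := 2 * ν) (by
    rw [finrank_euclideanSpace_fin]
    have : (0 : ℝ) < ν := mod_cast hν
    linarith)
  refine h.congr (Eventually.of_forall fun ξ => ?_)
  simp only [Complex.norm_real, Real.norm_eq_abs, sq_abs, decay, wt]
  rw [← Real.rpow_mul_natCast (wt_base_pos ξ).le]
  congr 1
  push_cast
  ring

theorem speed_norm_le_wt (ξ : X ν) : speed ν ‖ξ‖ ≤ wt (-(ν : ℝ) - 1) ξ := by
  rw [speed, wt, show (-(ν : ℝ) - 1) / 2 = -((ν : ℝ) + 1) / 2 by ring]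
  refine Real.rpow_le_rpow_of_nonpos (wt_base_pos ξ) ?_ ?_
  · have h1 : (1 : ℝ) ≤ 4 * Real.pi ^ 2 := by nlinarith [Real.pi_gt_three]
    nlinarith [sq_nonneg ‖ξ‖]
  · have : (0 : ℝ) ≤ ν := Nat.cast_nonneg ν
    linarith

theorem norm_field_le (ξ : X ν) : ‖field ξ‖ ≤ decay ξ := by
  rw [field, norm_smul, Real.norm_of_nonneg (speed_pos ν _).le, decay,
    show -(ν : ℝ) = -(ν : ℝ) - 1 + 1 by ring, wt_add]
  have := wt_pos (-(ν : ℝ) - 1) ξ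
  gcongr
  · exact speed_norm_le_wt ξ
  · exact norm_le_wt_one ξ

theorem abs_field_apply_le (j : Fin ν) (ξ : X ν) : |field ξ j| ≤ decay ξ :=
  (PiLp.norm_apply_le (field ξ) j).trans (norm_field_le ξ)

/-- The divergence is the speed times `ν - (ν+1)q` with `0 ≤ q ≤ 1`, which is bounded by `2ν + 1`.
-/
theorem abs_divField_le (ξ : X ν) : |divField ξ| ≤ (2 * ν + 1) * decay ξ := by
  have h0 : speed ν ‖ξ‖ ≤ decay ξ := (speed_norm_le_wt ξ).trans (wt_le_wt (by linarith) ξ)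
  have h1 := one_le_speed_base ‖ξ‖
  have hq0 : 0 ≤ 4 * Real.pi ^ 2 * ‖ξ‖ ^ 2 / (1 + 4 * Real.pi ^ 2 * ‖ξ‖ ^ 2) := by positivity
  have hq1 : 4 * Real.pi ^ 2 * ‖ξ‖ ^ 2 / (1 + 4 * Real.pi ^ 2 * ‖ξ‖ ^ 2) ≤ 1 := by
    rw [div_le_one (by linarith)]
    linarith
  rw [divField, abs_mul, abs_of_pos (speed_pos ν _), mul_comm, mul_div_assoc]
  have hn : (0 : ℝ) ≤ ν := Nat.cast_nonneg ν
  refine mul_le_mul ?_ h0 (speed_pos ν _).le (by positivity)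
  rw [abs_le]
  constructor <;> nlinarith

/-- Smooth coefficients with the decay of the vector field. -/
def IsCoef (c : X ν × X ν → ℝ) : Prop :=
  ContDiff ℝ ∞ c ∧ ∃ C : ℝ, 0 ≤ C ∧ ∀ p, |c p| ≤ C * (decay p.1 + decay p.2)

theorem IsCoef.mul {c c' : X ν × X ν → ℝ} (h : IsCoef c) (h' : IsCoef c') :
    IsCoef fun p => c p * c' p := by
  obtain ⟨C, hC, h1⟩ := h.2
  obtain ⟨C', hC', h2⟩ := h'.2
  refine ⟨h.1.mul h'.1, C * (2 * C'), by positivity, fun p => ?_⟩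
  rw [abs_mul]
  have hd1 := decay_pos p.1
  have hd2 := decay_pos p.2
  have h3 : |c' p| ≤ 2 * C' := (h2 p).trans (by
    nlinarith [decay_le_one p.1, decay_le_one p.2])
  calc |c p| * |c' p| ≤ C * (decay p.1 + decay p.2) * (2 * C') :=
        mul_le_mul (h1 p) h3 (abs_nonneg _) (by positivity)
    _ = _ := by ring

theorem IsCoef.add {c c' : X ν × X ν → ℝ} (h : IsCoef c) (h' : IsCoef c') :
    IsCoef fun p => c p + c' p := by
  obtain ⟨C, hC, h1⟩ := h.2
  obtain ⟨C', hC', h2⟩ := h'.2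
  refine ⟨h.1.add h'.1, C + C', by positivity, fun p => ?_⟩
  rw [add_mul]
  exact (abs_add_le _ _).trans (add_le_add (h1 p) (h2 p))

/-- The coefficient `s β(ξ) + t β(η)`. -/
def twoPoint (s t : ℝ) (β : X ν → ℝ) (p : X ν × X ν) : ℝ := s * β p.1 + t * β p.2

theorem isCoef_twoPoint (s t : ℝ) {β : X ν → ℝ} (hβ : ContDiff ℝ ∞ β) {C : ℝ}
    (h : ∀ ξ, |β ξ| ≤ C * decay ξ) : IsCoef (twoPoint s t β) := by
  have hC : 0 ≤ C := by
    have := (abs_nonneg _).trans (h 0)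
    exact nonneg_of_mul_nonneg_left this (decay_pos 0)
  refine ⟨(contDiff_const.mul (hβ.comp contDiff_fst)).add
    (contDiff_const.mul (hβ.comp contDiff_snd)), (|s| + |t|) * C, by positivity, fun p => ?_⟩
  have h1 := h p.1
  have h2 := h p.2
  have hd1 := decay_pos p.1
  have hd2 := decay_pos p.2
  calc |twoPoint s t β p| ≤ |s| * |β p.1| + |t| * |β p.2| := by
        rw [twoPoint, ← abs_mul, ← abs_mul]
        exact abs_add_le _ _
    _ ≤ |s| * (C * decay p.1) + |t| * (C * decay p.2) := by gcongr
    _ ≤ (|s| + |t|) * C * (decay p.1 + decay p.2) := by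
        have e1 : 0 ≤ |s| * C * decay p.2 := by positivity
        have e2 : 0 ≤ |t| * C * decay p.1 := by positivity
        nlinarith

/-- The derivative of a coefficient along the vector field `(b(ξ), b(η))`. -/
def lieCoef (c : X ν × X ν → ℝ) (p : X ν × X ν) : ℝ := fderiv ℝ c p (field p.1, field p.2)

theorem lieCoef_twoPoint (s t : ℝ) {β : X ν → ℝ} (hβ : ContDiff ℝ ∞ β) :
    lieCoef (twoPoint s t β) = twoPoint s t fun ξ => fderiv ℝ β ξ (field ξ) := by
  ext p
  have h1 : HasFDerivAt (fun p : X ν × X ν => β p.1)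
      ((fderiv ℝ β p.1).comp (ContinuousLinearMap.fst ℝ (X ν) (X ν))) p :=
    (hβ.differentiable (by simp) p.1).hasFDerivAt.comp p hasFDerivAt_fst
  have h2 : HasFDerivAt (fun p : X ν × X ν => β p.2)
      ((fderiv ℝ β p.2).comp (ContinuousLinearMap.snd ℝ (X ν) (X ν))) p :=
    (hβ.differentiable (by simp) p.2).hasFDerivAt.comp p hasFDerivAt_snd
  have h3 : HasFDerivAt (twoPoint s t β) _ p := (h1.const_mul s).add (h2.const_mul t)
  rw [lieCoef, h3.fderiv, twoPoint]
  rfl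

/-- The decay comes from the vector field; from `β` only bounded derivatives are needed. So
differentiating a coefficient along the flow gives a coefficient again. -/
theorem isCoef_lieCoef_twoPoint (s t : ℝ) {β : X ν → ℝ} (hβ : IsSymbol 0 β) :
    IsCoef (lieCoef (twoPoint s t β)) := by
  rw [lieCoef_twoPoint s t hβ.1]
  obtain ⟨C, hC⟩ := hβ.fderiv.bounded
  refine isCoef_twoPoint s t (C := C) ((hβ.1.fderiv_right (m := ∞) (by simp)).clm_apply
    contDiff_field) fun ξ => ?_
  refine ((fderiv ℝ β ξ).le_opNorm _).trans ?_
  exact mul_le_mul (hC ξ) (norm_field_le ξ) (norm_nonneg _) ((norm_nonneg _).trans (hC ξ))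

/-- The coefficient `b_j(η) - b_j(ξ)`. -/
def fieldCoef (j : Fin ν) : X ν × X ν → ℝ := twoPoint (-1) 1 fun ξ => field ξ j

/-- The coefficient `½ (d(ξ) + d(η))`, where `d` is the divergence of `b`. -/
def divCoef : X ν × X ν → ℝ := twoPoint (1 / 2) (1 / 2) divField

theorem isCoef_fieldCoef (j : Fin ν) : IsCoef (fieldCoef j) :=
  isCoef_twoPoint _ _ (contDiff_field_apply j) (C := 1) fun ξ => by
    simpa using abs_field_apply_le j ξ

theorem isCoef_divCoef : IsCoef (divCoef : X ν × X ν → ℝ) :=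
  isCoef_twoPoint _ _ contDiff_divField abs_divField_le

/-- The form with the kernel `⟨ξ - η⟩ S(ξ - η) c(ξ, η)`. -/
def cform (S : L2 ν) (c : X ν × X ν → ℝ) (f g : X ν → ℂ) : ℂ :=
  kint S fun p => (c p : ℂ) * ((starRingEnd ℂ) (f p.1) * g p.2)

/-- The operator `K` represents a form, up to the weights `⟨ξ⟩`. -/
def Represents (K : L2 ν →L[ℂ] L2 ν) (Q : (X ν → ℂ) → (X ν → ℂ) → ℂ) : Prop :=
  ∀ (f g : X ν → ℂ) (hf : IsAnnular f) (hg : IsAnnular g),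
    inner ℂ (hf.wt_mul 1).toL2 (K (hg.wt_mul 1).toL2) = Q f g

/-- The kernel `⟨ξ⟩⁻¹⟨η⟩⁻¹⟨ξ-η⟩ S(ξ-η) c(ξ,η)` is dominated by `|S(ξ-η)|` times a square integrable
function of `ξ` plus one of `η`. Translation gives its `L²` norm on the product, so the operator is
Hilbert–Schmidt. The constant depends on `c` only, which matters later when `S` varies with a
parameter. -/
theorem exists_operator_of_isCoef (hν : 0 < ν) {c : X ν × X ν → ℝ} (hc : IsCoef c) :
    ∃ M : ℝ, 0 ≤ M ∧ ∀ S : L2 ν, ∃ K : L2 ν →L[ℂ] L2 ν, ‖K‖ ≤ M * ‖S‖ ∧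
      Represents K (cform S c) := by
  obtain ⟨C, hC, hb⟩ := hc.2
  have hD : MemLp (fun ξ : X ν => ((2 * C : ℝ) : ℂ) * (decay ξ : ℂ)) 2 volume :=
    (memLp_decay hν).const_mul _
  set D : X ν → ℂ := fun ξ : X ν => ((2 * C : ℝ) : ℂ) * (decay ξ : ℂ) with hDdef
  have hnD : ∀ ξ, ‖D ξ‖ = 2 * C * decay ξ := fun ξ => by
    have h := decay_pos ξ
    simp only [hDdef, ← Complex.ofReal_mul, Complex.norm_real]
    exact Real.norm_of_nonneg (by positivity)
  refine ⟨2 * (eLpNorm D 2 volume).toReal, by positivity, fun S => ?_⟩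
  set k : X ν × X ν → ℂ := fun p =>
    (((wt 1 p.1)⁻¹ * (wt 1 p.2)⁻¹ * c p : ℝ) : ℂ) * convKer S p with hk
  have hm : AEStronglyMeasurable k (volume.prod volume) := by
    refine Continuous.aestronglyMeasurable ?_ |>.mul (aestronglyMeasurable_convKer S)
    have h1 := (contDiff_wt (ν := ν) 1).continuous
    have h2 := hc.1.continuous
    refine Complex.continuous_ofReal.comp (Continuous.mul (Continuous.mul ?_ ?_) h2)
    · exact (h1.comp continuous_fst).inv₀ fun p => (wt_pos _ _).ne'
    · exact (h1.comp continuous_snd).inv₀ fun p => (wt_pos _ _).ne'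
  have hle : ∀ p, ‖k p‖ ≤ ‖‖S (p.1 - p.2) * D p.1‖ + ‖S (p.1 - p.2) * D p.2‖‖ := by
    intro p
    have w1 := wt_pos 1 p.1
    have w2 := wt_pos 1 p.2
    have h1 := wt_one_sub_le p.1 p.2
    have h2 := hb p
    have h3 : (wt 1 p.1)⁻¹ * (wt 1 p.2)⁻¹ * wt 1 (p.1 - p.2) ≤ 2 := by
      rw [← mul_inv, inv_mul_le_iff₀ (by positivity)]
      linarith
    have w3 := wt_pos 1 (p.1 - p.2)
    rw [Real.norm_of_nonneg (by positivity), norm_mul (S (p.1 - p.2)), norm_mul (S (p.1 - p.2)),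
      hnD, hnD]
    simp only [hk, convKer, norm_mul, Complex.norm_real, Real.norm_eq_abs, abs_inv,
      abs_of_pos w1, abs_of_pos w2, abs_of_pos w3]
    calc (wt 1 p.1)⁻¹ * (wt 1 p.2)⁻¹ * |c p| * (wt 1 (p.1 - p.2) * ‖S (p.1 - p.2)‖) =
          ((wt 1 p.1)⁻¹ * (wt 1 p.2)⁻¹ * wt 1 (p.1 - p.2)) * |c p| * ‖S (p.1 - p.2)‖ := by ring
      _ ≤ 2 * (C * (decay p.1 + decay p.2)) * ‖S (p.1 - p.2)‖ := by gcongr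
      _ = _ := by ring
  have m1 := memLp_sub_mul_fst (Lp.memLp S) hD
  have m2 := memLp_sub_mul_snd (Lp.memLp S) hD
  have hkL : MemLp k 2 (volume.prod volume) :=
    (m1.norm.add m2.norm).of_le hm (Eventually.of_forall hle)
  have hkn : (eLpNorm k 2 (volume.prod volume)).toReal ≤
      2 * (eLpNorm D 2 volume).toReal * ‖S‖ := by
    have h1 : eLpNorm k 2 (volume.prod volume) ≤
        eLpNorm S 2 volume * eLpNorm D 2 volume + eLpNorm S 2 volume * eLpNorm D 2 volume := by
      refine (eLpNorm_mono hle).trans ((eLpNorm_add_le m1.1.norm m2.1.norm (by norm_num)).trans ?_)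
      rw [eLpNorm_norm, eLpNorm_norm, eLpNorm_sub_mul_fst (Lp.memLp S) hD,
        eLpNorm_sub_mul_snd (Lp.memLp S) hD]
    have hS := Lp.eLpNorm_ne_top S
    have h2 := ENNReal.toReal_mono (by finiteness [hD.2.ne]) h1
    rw [ENNReal.toReal_add (by finiteness [hD.2.ne]) (by finiteness [hD.2.ne]),
      ENNReal.toReal_mul, ← Lp.norm_def] at h2
    linarith
  obtain ⟨K, hK, hform⟩ := exists_kernel_operator hkL
  refine ⟨K, hK.trans hkn, fun f g hf hg => ?_⟩
  rw [hform, cform, kint]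
  apply integral_congr_ae
  have e1 := (Measure.quasiMeasurePreserving_fst (μ := (volume : Measure (X ν)))
    (ν := (volume : Measure (X ν)))).ae (hf.wt_mul 1).coeFn_toL2
  have e2 := (Measure.quasiMeasurePreserving_snd (μ := (volume : Measure (X ν)))
    (ν := (volume : Measure (X ν)))).ae (hg.wt_mul 1).coeFn_toL2
  filter_upwards [e1, e2] with p h1 h2
  rw [h1, h2, hk]
  have w1 : (wt 1 p.1 : ℂ) ≠ 0 := Complex.ofReal_ne_zero.2 (wt_pos 1 p.1).ne'
  have w2 : (wt 1 p.2 : ℂ) ≠ 0 := Complex.ofReal_ne_zero.2 (wt_pos 1 p.2).ne'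
  simp only [map_mul, Complex.conj_ofReal]
  push_cast
  field_simp

/-- Forms act on `f`, operators on `⟨ξ⟩f`. Since the weighted generator on `⟨ξ⟩f` is `⟨ξ⟩ genFun f`,
the identity of forms is the commutator identity, and every annular function has the shape `⟨ξ⟩f`.
-/
theorem hasCommutator_of_represents {A B : L2 ν →L[ℂ] L2 ν} {Q Q' : (X ν → ℂ) → (X ν → ℂ) → ℂ}
    (hA : Represents A Q) (hB : Represents B Q')
    (h : ∀ f g, IsAnnular f → IsAnnular g → Q (genFun f) g + Q f (genFun g) = Q' f g) :
    HasCommutator A B := by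
  have key : ∀ (f g : X ν → ℂ) (hf : IsAnnular f) (hg : IsAnnular g),
      inner ℂ ((hf.wt_mul 1).genWt 1).toL2 (A (hg.wt_mul 1).toL2) +
        inner ℂ (hf.wt_mul 1).toL2 (A ((hg.wt_mul 1).genWt 1).toL2) =
        inner ℂ (hf.wt_mul 1).toL2 (B (hg.wt_mul 1).toL2) := by
    intro f g hf hg
    have e : ∀ (f : X ν → ℂ) (hf : IsAnnular f), ((hf.wt_mul 1).genWt 1).toL2 =
        (hf.genFun.wt_mul 1).toL2 := by
      intro f hf
      simp only [IsAnnular.toL2, genWt_wt_mul]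
    rw [e f hf, e g hg, hA _ _ hf.genFun hg, hA _ _ hf hg.genFun, hB _ _ hf hg, h f g hf hg]
  intro F G hF hG
  have e : ∀ (F : X ν → ℂ), F = fun ξ => (wt 1 ξ : ℂ) * (((wt 1 ξ)⁻¹ : ℝ) * F ξ) := by
    intro F
    ext ξ
    have w1 : (wt 1 ξ : ℂ) ≠ 0 := Complex.ofReal_ne_zero.2 (wt_pos 1 ξ).ne'
    push_cast
    field_simp
  have := key _ _ (hF.inv_wt_mul 1) (hG.inv_wt_mul 1)
  simp only [IsAnnular.toL2] at this ⊢
  simpa only [← e] using this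

theorem hasCompactSupport_tensor {f g : X ν → ℂ} (hf : HasCompactSupport f)
    (hg : HasCompactSupport g) :
    HasCompactSupport fun p : X ν × X ν => (starRingEnd ℂ) (f p.1) * g p.2 := by
  refine HasCompactSupport.intro (hf.isCompact.prod hg.isCompact) fun p hp => ?_
  rw [Set.mem_prod, not_and_or] at hp
  rcases hp with hp | hp
  · simp [image_eq_zero_of_notMem_tsupport hp]
  · simp [image_eq_zero_of_notMem_tsupport hp]

theorem contDiff_tensor {f g : X ν → ℂ} (hf : ContDiff ℝ ∞ f) (hg : ContDiff ℝ ∞ g) :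
    ContDiff ℝ ∞ fun p : X ν × X ν => (starRingEnd ℂ) (f p.1) * g p.2 :=
  (Complex.conjCLE.contDiff.comp (hf.comp contDiff_fst)).mul (hg.comp contDiff_snd)

theorem fderiv_coef_tensor {c : X ν × X ν → ℝ} (hc : ContDiff ℝ ∞ c) {f g : X ν → ℂ}
    (hf : ContDiff ℝ ∞ f) (hg : ContDiff ℝ ∞ g) (p v : X ν × X ν) :
    fderiv ℝ (fun p : X ν × X ν => (c p : ℂ) * ((starRingEnd ℂ) (f p.1) * g p.2)) p v =
      (fderiv ℝ c p v : ℂ) * ((starRingEnd ℂ) (f p.1) * g p.2) +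
        (c p : ℂ) * ((starRingEnd ℂ) (fderiv ℝ f p.1 v.1) * g p.2 +
          (starRingEnd ℂ) (f p.1) * fderiv ℝ g p.2 v.2) := by
  have h1 : HasFDerivAt (fun p : X ν × X ν => (c p : ℂ))
      (Complex.ofRealCLM.comp (fderiv ℝ c p)) p :=
    Complex.ofRealCLM.hasFDerivAt.comp p (hc.differentiable (by simp) p).hasFDerivAt
  have h2 : HasFDerivAt (fun p : X ν × X ν => f p.1)
      ((fderiv ℝ f p.1).comp (ContinuousLinearMap.fst ℝ (X ν) (X ν))) p :=
    (hf.differentiable (by simp) p.1).hasFDerivAt.comp p hasFDerivAt_fst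
  have h3 : HasFDerivAt (fun p : X ν × X ν => (starRingEnd ℂ) (f p.1))
      ((Complex.conjCLE : ℂ →L[ℝ] ℂ).comp
        ((fderiv ℝ f p.1).comp (ContinuousLinearMap.fst ℝ (X ν) (X ν)))) p :=
    (Complex.conjCLE : ℂ →L[ℝ] ℂ).hasFDerivAt.comp p h2
  have h4 : HasFDerivAt (fun p : X ν × X ν => g p.2)
      ((fderiv ℝ g p.2).comp (ContinuousLinearMap.snd ℝ (X ν) (X ν))) p :=
    (hg.differentiable (by simp) p.2).hasFDerivAt.comp p hasFDerivAt_snd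
  have h5 : HasFDerivAt (fun p : X ν × X ν => (c p : ℂ) * ((starRingEnd ℂ) (f p.1) * g p.2)) _ p :=
    h1.mul (h3.mul h4)
  rw [h5.fderiv]
  simp
  ring

/-- The form of the commutator of the generator with the operator of kernel
`⟨ξ - η⟩ S(ξ - η) c(ξ, η)`. -/
def lieForm (S : L2 ν) (S' : Fin ν → L2 ν) (c : X ν × X ν → ℝ) (f g : X ν → ℂ) : ℂ :=
  cform S (fun p => divCoef p * c p + lieCoef c p) f g +
    ∑ j, cform (S' j) (fun p => fieldCoef j p * c p) f g

/-- Integration by parts along `(b(ξ), b(η))` moves the derivatives from `f` and `g` to the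
convolution symbol and to the coefficient `c`. -/
theorem cform_genFun {S : L2 ν} {S' : Fin ν → L2 ν} (h : ∀ j, IsWeakDeriv j S (S' j))
    {c : X ν × X ν → ℝ} (hc : ContDiff ℝ ∞ c) {f g : X ν → ℂ} (hf : IsAnnular f)
    (hg : IsAnnular g) :
    cform S c (genFun f) g + cform S c f (genFun g) = lieForm S S' c f g := by
  have hT := contDiff_tensor hf.contDiff hg.contDiff
  have sT := hasCompactSupport_tensor hf.hasCompactSupport hg.hasCompactSupport
  have hcc : ContDiff ℝ ∞ fun p => (c p : ℂ) := Complex.ofRealCLM.contDiff.comp hc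
  have cΘ := hcc.mul hT
  have sΘ : HasCompactSupport fun p => (c p : ℂ) * ((starRingEnd ℂ) (f p.1) * g p.2) :=
    sT.mul_left
  have key := kint_fderiv_field h cΘ sΘ
  have cd : Continuous fun p : X ν × X ν => ((divField p.1 + divField p.2 : ℝ) : ℂ) := by
    have := (contDiff_divField (ν := ν)).continuous
    fun_prop
  have cl : Continuous (lieCoef c) := by
    have h1 := (contDiff_field (ν := ν)).continuous
    exact (hc.continuous_fderiv (by simp)).clm_apply
      ((h1.comp continuous_fst).prodMk (h1.comp continuous_snd))
  have cD : Continuous fun p => fderiv ℝ (fun p : X ν × X ν =>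
      (c p : ℂ) * ((starRingEnd ℂ) (f p.1) * g p.2)) p (field p.1, field p.2) := by
    have h1 := (contDiff_field (ν := ν)).continuous
    exact (cΘ.continuous_fderiv (by simp)).clm_apply
      ((h1.comp continuous_fst).prodMk (h1.comp continuous_snd))
  have sD : HasCompactSupport fun p => fderiv ℝ (fun p : X ν × X ν =>
      (c p : ℂ) * ((starRingEnd ℂ) (f p.1) * g p.2)) p (field p.1, field p.2) :=
    HasCompactSupport.intro sΘ.isCompact fun p hp => by
      rw [fderiv_of_notMem_tsupport (𝕜 := ℝ) hp]
      rfl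
  have hT1 := contDiff_tensor hf.genFun.contDiff hg.contDiff
  have sT1 := hasCompactSupport_tensor hf.genFun.hasCompactSupport hg.hasCompactSupport
  have hT2 := contDiff_tensor hf.contDiff hg.genFun.contDiff
  have sT2 := hasCompactSupport_tensor hf.hasCompactSupport hg.genFun.hasCompactSupport
  have k1 : Continuous fun p => (c p : ℂ) * ((starRingEnd ℂ) (genFun f p.1) * g p.2) :=
    hcc.continuous.mul hT1.continuous
  have k2 : Continuous fun p => (c p : ℂ) * ((starRingEnd ℂ) (f p.1) * genFun g p.2) :=
    hcc.continuous.mul hT2.continuous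
  have l1 : HasCompactSupport fun p => (c p : ℂ) * ((starRingEnd ℂ) (genFun f p.1) * g p.2) :=
    sT1.mul_left
  have l2 : HasCompactSupport fun p => (c p : ℂ) * ((starRingEnd ℂ) (f p.1) * genFun g p.2) :=
    sT2.mul_left
  have k3 : Continuous fun p => ((divCoef p * c p + lieCoef c p : ℝ) : ℂ) *
      ((starRingEnd ℂ) (f p.1) * g p.2) := by
    refine Continuous.mul ?_ hT.continuous
    have h1 := (isCoef_divCoef (ν := ν)).1.continuous
    have h2 := hc.continuous
    fun_prop
  have l3 : HasCompactSupport fun p => ((divCoef p * c p + lieCoef c p : ℝ) : ℂ) *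
      ((starRingEnd ℂ) (f p.1) * g p.2) := sT.mul_left
  have k4 : Continuous fun p => (-1 : ℂ) * fderiv ℝ (fun p : X ν × X ν =>
      (c p : ℂ) * ((starRingEnd ℂ) (f p.1) * g p.2)) p (field p.1, field p.2) :=
    continuous_const.mul cD
  have l4 : HasCompactSupport fun p => (-1 : ℂ) * fderiv ℝ (fun p : X ν × X ν =>
      (c p : ℂ) * ((starRingEnd ℂ) (f p.1) * g p.2)) p (field p.1, field p.2) := sD.mul_left
  have k5 : Continuous fun p => (-1 : ℂ) * (((divField p.1 + divField p.2 : ℝ) : ℂ) *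
      ((c p : ℂ) * ((starRingEnd ℂ) (f p.1) * g p.2))) :=
    continuous_const.mul (cd.mul cΘ.continuous)
  have l5 : HasCompactSupport fun p => (-1 : ℂ) * (((divField p.1 + divField p.2 : ℝ) : ℂ) *
      ((c p : ℂ) * ((starRingEnd ℂ) (f p.1) * g p.2))) := sΘ.mul_left.mul_left
  -- The two generators contribute `-½ div b` at each point. This is written as `+½` minus the full
  -- divergence, which then cancels against the divergence term of the integration by parts.
  have e1 : cform S c (genFun f) g + cform S c f (genFun g) =
      cform S (fun p => divCoef p * c p + lieCoef c p) f g +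
        ((-1 : ℂ) * kint S (fun p => fderiv ℝ (fun p : X ν × X ν =>
      (c p : ℂ) * ((starRingEnd ℂ) (f p.1) * g p.2)) p (field p.1, field p.2)) +
      (-1 : ℂ) * kint S (fun p => ((divField p.1 + divField p.2 : ℝ) : ℂ) *
        ((c p : ℂ) * ((starRingEnd ℂ) (f p.1) * g p.2)))) := by
    rw [cform, cform, cform, ← kint_const_mul_right, ← kint_const_mul_right,
      ← kint_add_right S k1 l1 k2 l2, ← kint_add_right S k4 l4 k5 l5,
      ← kint_add_right (Φ := fun p => (-1 : ℂ) * fderiv ℝ (fun p : X ν × X ν =>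
        (c p : ℂ) * ((starRingEnd ℂ) (f p.1) * g p.2)) p (field p.1, field p.2) +
        (-1 : ℂ) * (((divField p.1 + divField p.2 : ℝ) : ℂ) *
        ((c p : ℂ) * ((starRingEnd ℂ) (f p.1) * g p.2)))) S k3 l3 (k4.add k5) (l4.add l5)]
    congr 1
    ext p
    rw [fderiv_coef_tensor hc hf.contDiff hg.contDiff]
    simp only [genFun, divCoef, twoPoint, lieCoef, map_neg, map_add, map_mul, Complex.conj_ofReal]
    push_cast
    simp only [map_div₀, map_one, map_ofNat]
    ring
  rw [e1, key, lieForm]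
  congr 1
  rw [mul_sub, neg_one_mul, neg_one_mul, sub_neg_eq_add, add_neg_cancel_right,
    ← Finset.sum_neg_distrib]
  refine Finset.sum_congr rfl fun j _ => ?_
  rw [cform, ← neg_one_mul, ← kint_const_mul_right]
  congr 1
  ext p
  simp only [fieldCoef, twoPoint]
  push_cast
  ring

theorem Represents.add {K K' : L2 ν →L[ℂ] L2 ν} {Q Q' : (X ν → ℂ) → (X ν → ℂ) → ℂ}
    (h : Represents K Q) (h' : Represents K' Q') :
    Represents (K + K') fun f g => Q f g + Q' f g := fun f g hf hg => by
  rw [_root_.add_apply, inner_add_right, h f g hf hg, h' f g hf hg]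

theorem Represents.sum {ι : Type*} (s : Finset ι) {K : ι → L2 ν →L[ℂ] L2 ν}
    {Q : ι → (X ν → ℂ) → (X ν → ℂ) → ℂ} (h : ∀ i, Represents (K i) (Q i)) :
    Represents (∑ i ∈ s, K i) fun f g => ∑ i ∈ s, Q i f g := fun f g hf hg => by
  rw [_root_.sum_apply, inner_sum]
  exact Finset.sum_congr rfl fun i _ => h i f g hf hg

theorem exists_operator_lieForm (hν : 0 < ν) {c : X ν × X ν → ℝ}
    (h0 : IsCoef fun p => divCoef p * c p + lieCoef c p)
    (hj : ∀ j, IsCoef fun p => fieldCoef j p * c p) :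
    ∃ M : ℝ, 0 ≤ M ∧ ∀ (S : L2 ν) (S' : Fin ν → L2 ν), ∃ K : L2 ν →L[ℂ] L2 ν,
      ‖K‖ ≤ M * (‖S‖ + ∑ j, ‖S' j‖) ∧ Represents K (lieForm S S' c) := by
  obtain ⟨M₀, hM₀, H0⟩ := exists_operator_of_isCoef hν h0
  choose M hM H using fun j => exists_operator_of_isCoef hν (hj j)
  have hsum : ∀ j, M j ≤ ∑ j, M j := fun j =>
    Finset.single_le_sum (fun j _ => hM j) (Finset.mem_univ j)
  have hs0 : 0 ≤ ∑ j, M j := Finset.sum_nonneg fun j _ => hM j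
  refine ⟨M₀ + ∑ j, M j, by positivity, fun S S' => ?_⟩
  obtain ⟨K₀, hK₀, hQ₀⟩ := H0 S
  choose K hK hQ using fun j => H j (S' j)
  refine ⟨K₀ + ∑ j, K j, ?_, hQ₀.add (Represents.sum _ hQ)⟩
  refine (norm_add_le _ _).trans ?_
  rw [mul_add]
  refine add_le_add (hK₀.trans ?_) ((norm_sum_le _ _).trans ?_)
  · exact mul_le_mul_of_nonneg_right (by linarith) (norm_nonneg _)
  · rw [Finset.mul_sum]
    refine Finset.sum_le_sum fun j _ => (hK j).trans ?_
    exact mul_le_mul_of_nonneg_right (by linarith [hsum j]) (norm_nonneg _)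

theorem lieForm_one (S : L2 ν) (S' : Fin ν → L2 ν) (f g : X ν → ℂ) :
    lieForm S S' (fun _ => 1) f g = cform S divCoef f g + ∑ j, cform (S' j) (fieldCoef j) f g := by
  have h : lieCoef (fun _ : X ν × X ν => (1 : ℝ)) = 0 := by
    ext p
    simp [lieCoef]
  simp [lieForm, h]

theorem exists_operator_lieForm_one (hν : 0 < ν) :
    ∃ M : ℝ, 0 ≤ M ∧ ∀ (S : L2 ν) (S' : Fin ν → L2 ν), ∃ K : L2 ν →L[ℂ] L2 ν,
      ‖K‖ ≤ M * (‖S‖ + ∑ j, ‖S' j‖) ∧ Represents K (lieForm S S' fun _ => 1) := by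
  refine exists_operator_lieForm hν ?_ fun j => ?_
  · have h : lieCoef (fun _ : X ν × X ν => (1 : ℝ)) = 0 := by
      ext p
      simp [lieCoef]
    simpa [h] using isCoef_divCoef (ν := ν)
  · simpa using isCoef_fieldCoef j

theorem hasCommutator_lieForm_one {S : L2 ν} {S' : Fin ν → L2 ν}
    (h : ∀ j, IsWeakDeriv j S (S' j)) {A B : L2 ν →L[ℂ] L2 ν}
    (hA : Represents A (cform S fun _ => 1)) (hB : Represents B (lieForm S S' fun _ => 1)) :
    HasCommutator A B :=
  hasCommutator_of_represents hA hB fun _ _ hf hg => cform_genFun h contDiff_const hf hg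

/-- The first commutator is a sum of forms of the same type, with symbol `S` and coefficient
`divCoef` or symbol `S' i` and coefficient `fieldCoef i`. The commutator formula applies to each,
and products and flow derivatives of these coefficients still decay. -/
theorem exists_second_commutator (hν : 0 < ν) :
    ∃ M : ℝ, 0 ≤ M ∧ ∀ (S : L2 ν) (S' : Fin ν → L2 ν) (S'' : Fin ν → Fin ν → L2 ν),
      (∀ j, IsWeakDeriv j S (S' j)) → (∀ i j, IsWeakDeriv j (S' i) (S'' i j)) →
      ∀ B : L2 ν →L[ℂ] L2 ν, Represents B (lieForm S S' fun _ => 1) →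
        ∃ C : L2 ν →L[ℂ] L2 ν,
          ‖C‖ ≤ M * (‖S‖ + ∑ j, ‖S' j‖ + ∑ i, ∑ j, ‖S'' i j‖) ∧ HasCommutator B C := by
  obtain ⟨M₀, hM₀, H0⟩ := exists_operator_lieForm (c := divCoef) hν
    ((isCoef_divCoef.mul isCoef_divCoef).add (isCoef_lieCoef_twoPoint _ _ isSymbol_divField))
    fun j => (isCoef_fieldCoef j).mul isCoef_divCoef
  choose M hM H using fun i => exists_operator_lieForm (c := fieldCoef i) hν
    ((isCoef_divCoef.mul (isCoef_fieldCoef i)).add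
      (isCoef_lieCoef_twoPoint _ _ (isSymbol_field_apply i)))
    fun j => (isCoef_fieldCoef j).mul (isCoef_fieldCoef i)
  have hsum : ∀ j, M j ≤ ∑ j, M j := fun j =>
    Finset.single_le_sum (fun j _ => hM j) (Finset.mem_univ j)
  have hs0 : 0 ≤ ∑ j, M j := Finset.sum_nonneg fun j _ => hM j
  refine ⟨M₀ + ∑ j, M j, by positivity, fun S S' S'' h h' B hB => ?_⟩
  obtain ⟨K₀, hK₀, hQ₀⟩ := H0 S S'
  choose K hK hQ using fun i => H i (S' i) (S'' i)
  refine ⟨K₀ + ∑ j, K j, ?_, ?_⟩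
  · have e1 : 0 ≤ ∑ j, ‖S' j‖ := Finset.sum_nonneg fun _ _ => norm_nonneg _
    have e2 : 0 ≤ ∑ i, ∑ j, ‖S'' i j‖ :=
      Finset.sum_nonneg fun _ _ => Finset.sum_nonneg fun _ _ => norm_nonneg _
    have e3 : ‖∑ j, K j‖ ≤ (∑ j, M j) * (∑ j, ‖S' j‖ + ∑ i, ∑ j, ‖S'' i j‖) := by
      refine (norm_sum_le _ _).trans ?_
      rw [← Finset.sum_add_distrib, Finset.mul_sum]
      refine Finset.sum_le_sum fun j _ => (hK j).trans ?_
      have : 0 ≤ ∑ i, ‖S'' j i‖ := Finset.sum_nonneg fun _ _ => norm_nonneg _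
      exact mul_le_mul_of_nonneg_right (hsum j) (by positivity)
    refine (norm_add_le _ _).trans ((add_le_add hK₀ e3).trans ?_)
    have := norm_nonneg S
    nlinarith [mul_nonneg hM₀ e2, mul_nonneg hs0 this]
  · refine hasCommutator_of_represents hB (hQ₀.add (Represents.sum _ hQ)) fun f g hf hg => ?_
    rw [lieForm_one, lieForm_one, ← cform_genFun h isCoef_divCoef.1 hf hg]
    simp only [← cform_genFun (h' _) (isCoef_fieldCoef _).1 hf hg, Finset.sum_add_distrib]
    ring

end

section

/-! ### Sobolev spaces on the frequency side -/

open FourierTransform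

variable {ν : ℕ} {s : ℝ}

/-- The weight `⟨ξ⟩^s`, as a complex function. -/
def wtC (s : ℝ) (ξ : X ν) : ℂ := (wt s ξ : ℂ)

theorem hasTemperateGrowth_wtC (s : ℝ) : Function.HasTemperateGrowth (wtC s : X ν → ℂ) :=
  Function.Complex.hasTemperateGrowth_ofReal.comp (hasTemperateGrowth_wt s)

theorem wtC_neg_mul (s : ℝ) (ξ : X ν) : wtC (-s) ξ * wtC s ξ = 1 := by
  rw [wtC, wtC, ← Complex.ofReal_mul, ← wt_add]
  simp

/-- The Fourier transform of the Bessel potential, as an isometry of `H^s` onto `L²`. -/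
def freqIso (s : ℝ) : Sob ν s →ₗᵢ[ℂ] L2 ν :=
  (Lp.fourierTransformₗᵢ (X ν) ℂ).toLinearIsometry.comp ⟨Sob.toL2, fun _ => rfl⟩

theorem freqIso_apply (f : Sob ν s) : freqIso s f = 𝓕 (Sob.toL2 f) := rfl

theorem fourier_toDistr (f : Sob ν s) :
    𝓕 f.toDistr = TemperedDistribution.smulLeftCLM ℂ (wtC (-s)) (freqIso s f : 𝓢'(X ν, ℂ)) := by
  have h := congrArg (fun T : 𝓢'(X ν, ℂ) => 𝓕 T) (Sob.toL2_spec f)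
  simp only [TemperedDistribution.fourier_besselPotential_eq_smulLeftCLM_fourier_apply,
    Lp.fourier_toTemperedDistribution_eq] at h
  rw [freqIso_apply, ← h]
  change _ = TemperedDistribution.smulLeftCLM ℂ (wtC (-s))
    (TemperedDistribution.smulLeftCLM ℂ (wtC s) _)
  rw [TemperedDistribution.smulLeftCLM_smulLeftCLM_apply (hasTemperateGrowth_wtC s)
    (hasTemperateGrowth_wtC (-s))]
  have e : (wtC s * wtC (-s) : X ν → ℂ) = fun _ => 1 := by
    ext ξ
    rw [Pi.mul_apply, mul_comm, wtC_neg_mul]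
  rw [e, TemperedDistribution.smulLeftCLM_const, one_smul]

theorem toDistr_fourier_apply (f : Sob ν s) (ψ : 𝓢(X ν, ℂ)) :
    f.toDistr (𝓕 ψ) = ∫ ξ, wtC (-s) ξ * freqIso s f ξ * ψ ξ := by
  rw [← TemperedDistribution.fourier_apply, fourier_toDistr,
    TemperedDistribution.smulLeftCLM_apply_apply, Lp.toTemperedDistribution_apply]
  congr 1
  ext ξ
  rw [SchwartzMap.smulLeftCLM_apply_apply (hasTemperateGrowth_wtC _), smul_eq_mul, smul_eq_mul]
  ring

theorem toDistr_apply (f : Sob ν s) (φ : 𝓢(X ν, ℂ)) :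
    f.toDistr φ = ∫ ξ, wtC (-s) ξ * freqIso s f ξ * (𝓕⁻ φ : 𝓢(X ν, ℂ)) ξ := by
  rw [← toDistr_fourier_apply, fourier_fourierInv_eq]

theorem freqIso_surjective (s : ℝ) : Function.Surjective (freqIso s : Sob ν s → L2 ν) := by
  intro F
  have h : TemperedDistribution.besselPotential (X ν) ℂ s
      (TemperedDistribution.besselPotential (X ν) ℂ (-s) ((𝓕⁻ F : L2 ν) : 𝓢'(X ν, ℂ))) =
      ((𝓕⁻ F : L2 ν) : 𝓢'(X ν, ℂ)) := by
    simp
  let f : Sob ν s := ⟨TemperedDistribution.besselPotential (X ν) ℂ (-s)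
    ((𝓕⁻ F : L2 ν) : 𝓢'(X ν, ℂ)), ⟨𝓕⁻ F, h⟩⟩
  have h2 : Sob.toL2 f = 𝓕⁻ F := by
    apply Sob.coe_L2_injective
    simp only [← Sob.toL2_spec]
    exact h
  exact ⟨f, by rw [freqIso_apply, h2, fourier_fourierInv_eq]⟩

/-- The Fourier transform of the Bessel potential, as an isometric isomorphism `H^s ≃ L²`. -/
def freq (s : ℝ) : Sob ν s ≃ₗᵢ[ℂ] L2 ν := LinearIsometryEquiv.ofSurjective (freqIso s)
  (freqIso_surjective s)

theorem freq_apply (f : Sob ν s) : freq s f = freqIso s f := rfl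

theorem locallyIntegrable_mul_L2 {w : X ν → ℂ} (hw : Continuous w) (F : L2 ν) :
    LocallyIntegrable (fun ξ => w ξ * F ξ) volume := by
  have h : LocallyIntegrable F volume := (Lp.memLp F).locallyIntegrable (by norm_num)
  exact h.continuous_smul hw

/-- Both distributions are compared through their Fourier transforms, where membership in `H^s` is
encoded by the factor `⟨ξ⟩^s`. Testing on compactly supported smooth functions gives equality almost
everywhere. -/
theorem toDistr_eq_coe_iff (f : Sob ν s) (g : L2 ν) : f.toDistr = (g : 𝓢'(X ν, ℂ)) ↔
    freq s f =ᵐ[volume] fun ξ => (wt s ξ : ℂ) * (𝓕 g : L2 ν) ξ := by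
  have h0 : f.toDistr = (g : 𝓢'(X ν, ℂ)) ↔
      ∀ ψ : 𝓢(X ν, ℂ), ∫ ξ, wtC (-s) ξ * freq s f ξ * ψ ξ = ∫ ξ, ψ ξ * (𝓕 g : L2 ν) ξ := by
    have e : ∀ ψ : 𝓢(X ν, ℂ), (g : 𝓢'(X ν, ℂ)) (𝓕 ψ) = ∫ ξ, ψ ξ * (𝓕 g : L2 ν) ξ := by
      intro ψ
      rw [← TemperedDistribution.fourier_apply, Lp.fourier_toTemperedDistribution_eq,
        Lp.toTemperedDistribution_apply]
      rfl
    constructor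
    · intro h ψ
      rw [← e, ← h, toDistr_fourier_apply, freq_apply]
    · intro h
      ext φ
      have h1 := h (𝓕⁻ φ)
      rw [← e, fourier_fourierInv_eq] at h1
      rw [← h1, toDistr_apply, freq_apply]
  rw [h0]
  constructor
  · intro h
    have hc : Continuous (wtC (-s) : X ν → ℂ) := (hasTemperateGrowth_wtC (-s)).1.continuous
    have hae := ae_eq_of_integral_contDiff_smul_eq (μ := volume)
      (locallyIntegrable_mul_L2 hc (freq s f))
      ((Lp.memLp (𝓕 g : L2 ν)).locallyIntegrable (by norm_num)) (fun ρ hρ hs => ?_)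
    · filter_upwards [hae] with ξ hξ
      rw [← hξ, ← wtC, ← mul_assoc, mul_comm (wtC s ξ), wtC_neg_mul, one_mul]
    · have hs' : HasCompactSupport fun ξ => (ρ ξ : ℂ) := 
        hs.mono fun ξ hξ => by simpa using hξ
      have hρ' : ContDiff ℝ ∞ fun ξ => (ρ ξ : ℂ) := Complex.ofRealCLM.contDiff.comp hρ
      have h1 := h (hs'.toSchwartzMap hρ')
      simp only [HasCompactSupport.toSchwartzMap_toFun] at h1
      simp only [Complex.real_smul]
      rw [← h1]
      congr 1
      ext ξ
      ring
  · intro h ψ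
    apply integral_congr_ae
    filter_upwards [h] with ξ hξ
    rw [hξ, ← wtC, ← mul_assoc, wtC_neg_mul]
    ring

/-- A Schwartz function, as an element of `H^s`. -/
def ofSchwartz (s : ℝ) (φ : 𝓢(X ν, ℂ)) : Sob ν s :=
  ⟨(φ : 𝓢'(X ν, ℂ)), SchwartzMap.memSobolev φ⟩

theorem toDistr_ofSchwartz (s : ℝ) (φ : 𝓢(X ν, ℂ)) :
    (ofSchwartz s φ).toDistr = ((φ.toLp 2 volume : L2 ν) : 𝓢'(X ν, ℂ)) := by
  rw [Lp.toTemperedDistribution_toLp_eq]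
  rfl

theorem freq_ofSchwartz (s : ℝ) (φ : 𝓢(X ν, ℂ)) :
    freq s (ofSchwartz s φ) = (SchwartzMap.smulLeftCLM ℂ (wtC s) (𝓕 φ)).toLp 2 volume := by
  ext1
  have h := (toDistr_eq_coe_iff (ofSchwartz s φ) _).1 (toDistr_ofSchwartz s φ)
  rw [SchwartzMap.toLp_fourier_eq] at h
  have h2 := SchwartzMap.coeFn_toLp (SchwartzMap.smulLeftCLM ℂ (wtC s) (𝓕 φ)) 2 volume
  have h3 := SchwartzMap.coeFn_toLp (𝓕 φ : 𝓢(X ν, ℂ)) 2 volume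
  filter_upwards [h, h2, h3] with ξ h1 h2 h3
  rw [h1, h2, h3, SchwartzMap.smulLeftCLM_apply_apply (hasTemperateGrowth_wtC s)]
  rfl

theorem continuous_ofSchwartz (s : ℝ) : Continuous (ofSchwartz s : 𝓢(X ν, ℂ) → Sob ν s) := by
  rw [← (freq s : Sob ν s ≃ₗᵢ[ℂ] L2 ν).comp_continuous_iff]
  have h : (freq s : Sob ν s → L2 ν) ∘ ofSchwartz s = fun φ : 𝓢(X ν, ℂ) =>
      SchwartzMap.toLpCLM ℂ ℂ 2 (volume : Measure (X ν))
        (SchwartzMap.smulLeftCLM ℂ (wtC s) (fourierCLM ℂ 𝓢(X ν, ℂ) φ)) :=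
    funext fun φ => freq_ofSchwartz s φ
  rw [h]
  fun_prop

theorem continuous_toDistr_apply (φ : 𝓢(X ν, ℂ)) :
    Continuous fun f : Sob ν s => f.toDistr φ := by
  have h : (fun f : Sob ν s => f.toDistr φ) = fun f : Sob ν s =>
      Lp.toTemperedDistributionCLM ℂ (volume : Measure (X ν)) 2 (freq s f)
        (SchwartzMap.smulLeftCLM ℂ (wtC (-s)) (𝓕⁻ φ)) := by
    ext f
    have := congrArg (fun T : 𝓢'(X ν, ℂ) => T (𝓕⁻ φ)) (fourier_toDistr f)
    simp only [TemperedDistribution.fourier_apply, fourier_fourierInv_eq] at this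
    rw [this]
    rfl
  rw [h]
  have h1 : Continuous fun F : L2 ν =>
      Lp.toTemperedDistributionCLM ℂ (volume : Measure (X ν)) 2 F :=
    ContinuousLinearMap.continuous _
  exact ((PointwiseConvergenceCLM.evalCLM (RingHom.id ℂ) ℂ _).continuous.comp h1).comp
    (freq s).continuous

end

section

/-! ### Multipliers of `H^{-1}` -/

open FourierTransform
open scoped LineDeriv

variable {ν : ℕ}

theorem norm_sq_toLp (φ : 𝓢(X ν, ℂ)) :
    ‖(φ.toLp 2 volume : L2 ν)‖ ^ 2 = ∫ x, ‖φ x‖ ^ 2 := by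
  have h1 := inner_self_eq_norm_sq (𝕜 := ℂ) (φ.toLp 2 volume : L2 ν)
  rw [← h1, L2.inner_def, ← integral_re (L2.integrable_inner _ _)]
  apply integral_congr_ae
  filter_upwards [SchwartzMap.coeFn_toLp φ 2 volume] with x hx
  rw [hx]
  exact inner_self_eq_norm_sq (𝕜 := ℂ) (φ x)

theorem norm_toLp_fourierInv (φ : 𝓢(X ν, ℂ)) :
    ‖((𝓕⁻ φ : 𝓢(X ν, ℂ)).toLp 2 volume : L2 ν)‖ = ‖(φ.toLp 2 volume : L2 ν)‖ := by
  rw [← SchwartzMap.toLp_fourierInv_eq]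
  exact (Lp.fourierTransformₗᵢ (X ν) ℂ).symm.norm_map _

theorem norm_toLp_le_of_le {φ ψ : 𝓢(X ν, ℂ)} {C : ℝ} (h : ∀ x, ‖φ x‖ ≤ C * ‖ψ x‖) :
    ‖(φ.toLp 2 volume : L2 ν)‖ ≤ C * ‖(ψ.toLp 2 volume : L2 ν)‖ := by
  apply Lp.norm_le_mul_norm_of_ae_le_mul
  filter_upwards [SchwartzMap.coeFn_toLp φ 2 volume, SchwartzMap.coeFn_toLp ψ 2 volume]
    with x h1 h2
  rw [h1, h2]
  exact h x

theorem integrable_norm_sq (φ : 𝓢(X ν, ℂ)) : Integrable (fun x => ‖φ x‖ ^ 2) volume :=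
  (memLp_two_iff_integrable_sq_norm φ.continuous.aestronglyMeasurable).1 (φ.memLp 2 volume)

/-- The `H^1` norm of a Schwartz function, on the side of the inverse Fourier transform. -/
def sobNorm (φ : 𝓢(X ν, ℂ)) : ℝ :=
  ‖((SchwartzMap.smulLeftCLM ℂ (wtC 1) (𝓕⁻ φ)).toLp 2 volume : L2 ν)‖

theorem sobNorm_nonneg (φ : 𝓢(X ν, ℂ)) : 0 ≤ sobNorm φ := norm_nonneg _

theorem hasTemperateGrowth_inner (v : X ν) :
    Function.HasTemperateGrowth fun x : X ν => inner ℝ x v :=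
  ((innerSL ℝ).flip v).hasTemperateGrowth

theorem inner_unitVec (x : X ν) (j : Fin ν) : inner ℝ x (unitVec j) = x j := by
  simp [unitVec, EuclideanSpace.inner_single_right]

theorem integral_sq_coord (φ : 𝓢(X ν, ℂ)) (j : Fin ν) :
    ∫ ξ : X ν, ξ j ^ 2 * ‖(𝓕⁻ φ : 𝓢(X ν, ℂ)) ξ‖ ^ 2 =
      (1 / (2 * Real.pi) ^ 2) * ‖((∂_{unitVec j} φ : 𝓢(X ν, ℂ)).toLp 2 volume : L2 ν)‖ ^ 2 := by
  have hp := Real.pi_pos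
  rw [← norm_toLp_fourierInv, norm_sq_toLp, ← integral_const_mul]
  congr 1
  ext ξ
  rw [SchwartzMap.fourierInv_lineDerivOp_eq, _root_.smul_apply,
    SchwartzMap.smulLeftCLM_apply_apply (hasTemperateGrowth_inner _), inner_unitVec, norm_smul,
    norm_smul, norm_neg, norm_mul, norm_mul, Complex.norm_I, Complex.norm_real,
    Real.norm_of_nonneg hp.le, Real.norm_eq_abs]
  simp only [Complex.norm_ofNat, mul_one, mul_pow, sq_abs]
  field_simp

theorem norm_sq_eq_sum (ξ : X ν) : ‖ξ‖ ^ 2 = ∑ j, ξ j ^ 2 := by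
  rw [EuclideanSpace.norm_sq_eq]
  simp

/-- Plancherel together with `⟨ξ⟩² = 1 + ∑ ξ_j²`; each `ξ_j` is a derivative divided by `2π`, up to
a unimodular constant. -/
theorem sobNorm_sq (φ : 𝓢(X ν, ℂ)) :
    sobNorm φ ^ 2 = ‖(φ.toLp 2 volume : L2 ν)‖ ^ 2 + ∑ j : Fin ν, (1 / (2 * Real.pi) ^ 2) *
      ‖((∂_{(unitVec j : X ν)} φ : 𝓢(X ν, ℂ)).toLp 2 volume : L2 ν)‖ ^ 2 := by
  have hint : ∀ j, Integrable (fun ξ : X ν => ξ j ^ 2 * ‖(𝓕⁻ φ : 𝓢(X ν, ℂ)) ξ‖ ^ 2) volume := by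
    intro j
    refine (integrable_norm_sq (SchwartzMap.smulLeftCLM ℂ (fun x : X ν => inner ℝ x (unitVec j))
      (𝓕⁻ φ))).congr (Eventually.of_forall fun ξ => ?_)
    simp only
    rw [SchwartzMap.smulLeftCLM_apply_apply (hasTemperateGrowth_inner _), inner_unitVec, norm_smul,
      mul_pow, Real.norm_eq_abs, sq_abs]
  simp only [← integral_sq_coord]
  rw [sobNorm, norm_sq_toLp, ← norm_toLp_fourierInv φ, norm_sq_toLp (𝓕⁻ φ),
    ← integral_finsetSum _ fun j _ => hint j, ← integral_add (integrable_norm_sq _)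
    (integrable_finsetSum _ fun j _ => hint j)]
  congr 1
  ext ξ
  rw [SchwartzMap.smulLeftCLM_apply_apply (hasTemperateGrowth_wtC 1), norm_smul, mul_pow, wtC,
    Complex.norm_real, Real.norm_eq_abs, sq_abs, wt_one_sq, norm_sq_eq_sum, ← Finset.sum_mul]
  ring

/-- In terms of first derivatives the bound is the Leibniz rule. Duality turns it into the
multiplier bound on `H^{-1}`. -/
theorem sobNorm_smul_le {a : X ν → ℂ} (ha : Function.HasTemperateGrowth a) {A : ℝ}
    (h0 : ∀ x, ‖a x‖ ≤ A) (h1 : ∀ x, ‖fderiv ℝ a x‖ ≤ A) (φ : 𝓢(X ν, ℂ)) :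
    sobNorm (SchwartzMap.smulLeftCLM ℂ a φ) ≤ (2 * ν + 2) * A * sobNorm φ := by
  have hA : 0 ≤ A := (norm_nonneg _).trans (h0 0)
  have hp := Real.pi_gt_three
  set q : ℝ := 1 / (2 * Real.pi) ^ 2 with hq
  have hq0 : 0 ≤ q := by positivity
  have hq1 : q ≤ 1 := by
    rw [hq, div_le_one (by positivity)]
    nlinarith
  have e1 : ‖((SchwartzMap.smulLeftCLM ℂ a φ).toLp 2 volume : L2 ν)‖ ≤
      A * ‖(φ.toLp 2 volume : L2 ν)‖ := by
    apply norm_toLp_le_of_le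
    intro x
    rw [SchwartzMap.smulLeftCLM_apply_apply ha, norm_smul]
    exact mul_le_mul_of_nonneg_right (h0 x) (norm_nonneg _)
  have e2 : ∀ j : Fin ν,
      ‖((∂_{(unitVec j : X ν)} (SchwartzMap.smulLeftCLM ℂ a φ) : 𝓢(X ν, ℂ)).toLp 2 volume :
        L2 ν)‖ ≤ A * ‖(φ.toLp 2 volume : L2 ν)‖ +
        A * ‖((∂_{unitVec j} φ : 𝓢(X ν, ℂ)).toLp 2 volume : L2 ν)‖ := by
    intro j
    -- The commutator of the derivative with the multiplication, which is multiplication by the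
    -- derivative of `a`.
    set χ : 𝓢(X ν, ℂ) := ∂_{unitVec j} (SchwartzMap.smulLeftCLM ℂ a φ) -
      SchwartzMap.smulLeftCLM ℂ a (∂_{unitVec j} φ) with hχ
    have hχ1 : ∀ x, ‖χ x‖ ≤ A * ‖φ x‖ := by
      intro x
      have hf : HasFDerivAt (fun x => a x • φ x) _ x :=
        (ha.1.differentiable (by simp) x).hasFDerivAt.fun_smul (SchwartzMap.hasFDerivAt φ x)
      have e3 : χ x = fderiv ℝ a x (unitVec j) * φ x := by
        rw [hχ, _root_.sub_apply, SchwartzMap.lineDerivOp_apply_eq_fderiv,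
          SchwartzMap.smulLeftCLM_apply ha, SchwartzMap.smulLeftCLM_apply_apply ha,
          SchwartzMap.lineDerivOp_apply_eq_fderiv]
        rw [hf.fderiv]
        simp [smul_eq_mul]
      rw [e3, norm_mul]
      refine mul_le_mul_of_nonneg_right (((fderiv ℝ a x).le_opNorm _).trans ?_) (norm_nonneg _)
      have : ‖(unitVec j : X ν)‖ = 1 := by simp [unitVec]
      rw [this, mul_one]
      exact h1 x
    have e4 : (∂_{unitVec j} (SchwartzMap.smulLeftCLM ℂ a φ) : 𝓢(X ν, ℂ)) =
        χ + SchwartzMap.smulLeftCLM ℂ a (∂_{unitVec j} φ) := by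
      rw [hχ, sub_add_cancel]
    have e5 : ((χ + SchwartzMap.smulLeftCLM ℂ a (∂_{unitVec j} φ)).toLp 2 volume : L2 ν) =
        χ.toLp 2 volume + (SchwartzMap.smulLeftCLM ℂ a (∂_{unitVec j} φ)).toLp 2 volume :=
      map_add (SchwartzMap.toLpCLM ℂ ℂ 2 (volume : Measure (X ν))) _ _
    rw [e4, e5]
    refine (norm_add_le _ _).trans (add_le_add (norm_toLp_le_of_le hχ1) ?_)
    apply norm_toLp_le_of_le
    intro x
    rw [SchwartzMap.smulLeftCLM_apply_apply ha, norm_smul]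
    exact mul_le_mul_of_nonneg_right (h0 x) (norm_nonneg _)
  have hn : (0 : ℝ) ≤ ν := Nat.cast_nonneg ν
  refine le_of_sq_le_sq ?_ (by have := sobNorm_nonneg φ; positivity)
  set N := ‖(φ.toLp 2 volume : L2 ν)‖ with hN
  have key : ∀ j : Fin ν, q * ‖((∂_{(unitVec j : X ν)} (SchwartzMap.smulLeftCLM ℂ a φ) :
      𝓢(X ν, ℂ)).toLp 2 volume : L2 ν)‖ ^ 2 ≤ 2 * A ^ 2 * N ^ 2 + 2 * A ^ 2 *
        (q * ‖((∂_{unitVec j} φ : 𝓢(X ν, ℂ)).toLp 2 volume : L2 ν)‖ ^ 2) := by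
    intro j
    set D := ‖((∂_{unitVec j} φ : 𝓢(X ν, ℂ)).toLp 2 volume : L2 ν)‖
    have h := pow_le_pow_left₀ (norm_nonneg _) (e2 j) 2
    have h3 : (A * N + A * D) ^ 2 ≤ 2 * A ^ 2 * N ^ 2 + 2 * A ^ 2 * D ^ 2 := by
      nlinarith [sq_nonneg (A * N - A * D)]
    have h4 := mul_le_mul_of_nonneg_left (h.trans h3) hq0
    have h5 : q * (2 * A ^ 2 * N ^ 2) ≤ 2 * A ^ 2 * N ^ 2 :=
      mul_le_of_le_one_left (by positivity) hq1
    linarith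
  have e1' := pow_le_pow_left₀ (norm_nonneg _) e1 2
  rw [mul_pow] at e1'
  have e3 := sobNorm_sq φ
  have e4 := sobNorm_sq (SchwartzMap.smulLeftCLM ℂ a φ)
  rw [← hq, ← hN] at e3
  rw [← hq] at e4
  set P := ∑ j : Fin ν, q * ‖((∂_{(unitVec j : X ν)} φ : 𝓢(X ν, ℂ)).toLp 2 volume : L2 ν)‖ ^ 2
    with hPd
  have hs : ∑ j : Fin ν, q * ‖((∂_{(unitVec j : X ν)} (SchwartzMap.smulLeftCLM ℂ a φ) :
      𝓢(X ν, ℂ)).toLp 2 volume : L2 ν)‖ ^ 2 ≤ ν * (2 * A ^ 2 * N ^ 2) + 2 * A ^ 2 * P := by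
    refine (Finset.sum_le_sum fun j _ => key j).trans (le_of_eq ?_)
    rw [Finset.sum_add_distrib, Finset.sum_const, Finset.card_univ, Fintype.card_fin,
      hPd, Finset.mul_sum, nsmul_eq_mul]
  have hP : 0 ≤ P := Finset.sum_nonneg fun j _ => by positivity
  have hAN : 0 ≤ A ^ 2 * N ^ 2 := mul_nonneg (sq_nonneg _) (sq_nonneg _)
  have hAP : 0 ≤ A ^ 2 * P := mul_nonneg (sq_nonneg _) hP
  rw [e4, mul_pow, e3]
  refine (add_le_add e1' hs).trans ?_
  generalize N ^ 2 = n at *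
  generalize sobNorm φ = z at *
  clear_value P
  clear e1 e2 e3 e4 e1' hs key hPd hN
  nlinarith [mul_nonneg hn hAN, mul_nonneg hn hAP, mul_nonneg (mul_nonneg hn hn) hAN,
    mul_nonneg (mul_nonneg hn hn) hAP]

theorem norm_star_L2 (F : L2 ν) : ‖(star F : L2 ν)‖ = ‖F‖ := by
  rw [Lp.norm_def, Lp.norm_def]
  congr 1
  apply eLpNorm_congr_norm_ae
  filter_upwards [Lp.coeFn_star F] with x hx
  rw [hx, Pi.star_apply, norm_star]

theorem norm_integral_mul_le (F G : L2 ν) : ‖∫ x, F x * G x‖ ≤ ‖F‖ * ‖G‖ := by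
  have h : ∫ x, F x * G x = inner ℂ (star F) G := by
    rw [L2.inner_def]
    apply integral_congr_ae
    filter_upwards [Lp.coeFn_star F] with x hx
    rw [hx]
    simp [mul_comm]
  rw [h, ← norm_star_L2 F]
  exact norm_inner_le_norm _ _

theorem toDistr_neg_one_apply (T : Sob ν (-1)) (φ : 𝓢(X ν, ℂ)) :
    T.toDistr φ = ∫ ξ, freq (-1) T ξ *
      ((SchwartzMap.smulLeftCLM ℂ (wtC 1) (𝓕⁻ φ)).toLp 2 volume : L2 ν) ξ := by
  rw [toDistr_apply]
  apply integral_congr_ae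
  filter_upwards [SchwartzMap.coeFn_toLp (SchwartzMap.smulLeftCLM ℂ (wtC 1) (𝓕⁻ φ)) 2 volume]
    with ξ hξ
  rw [hξ, SchwartzMap.smulLeftCLM_apply_apply (hasTemperateGrowth_wtC 1), neg_neg, smul_eq_mul,
    freq_apply]
  ring

theorem norm_toDistr_apply_le (T : Sob ν (-1)) (φ : 𝓢(X ν, ℂ)) :
    ‖T.toDistr φ‖ ≤ ‖T‖ * sobNorm φ := by
  rw [toDistr_neg_one_apply, ← (freq (-1)).norm_map T]
  exact norm_integral_mul_le _ _

/-- A distribution that is bounded in the `H^1` norm belongs to `H^{-1}`. -/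
theorem exists_sob_of_le {T : 𝓢'(X ν, ℂ)} {C : ℝ} (hC : 0 ≤ C)
    (h : ∀ φ, ‖T φ‖ ≤ C * sobNorm φ) : ∃ S : Sob ν (-1), S.toDistr = T ∧ ‖S‖ ≤ C := by
  let ℓ : 𝓢(X ν, ℂ) →ₗ[ℂ] ℂ := T.toLinearMap ∘ₗ (fourierCLM ℂ 𝓢(X ν, ℂ)).toLinearMap ∘ₗ
    (SchwartzMap.smulLeftCLM ℂ (wtC (-1))).toLinearMap
  have hℓ : ∀ ψ, ℓ ψ = T (𝓕 (SchwartzMap.smulLeftCLM ℂ (wtC (-1)) ψ)) := fun _ => rfl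
  have hw : ∀ ψ : 𝓢(X ν, ℂ), SchwartzMap.smulLeftCLM ℂ (wtC 1)
      (SchwartzMap.smulLeftCLM ℂ (wtC (-1)) ψ) = ψ := by
    intro ψ
    ext ξ
    rw [SchwartzMap.smulLeftCLM_apply_apply (hasTemperateGrowth_wtC _),
      SchwartzMap.smulLeftCLM_apply_apply (hasTemperateGrowth_wtC _), smul_smul, mul_comm,
      wtC_neg_mul, one_smul]
  let e : 𝓢(X ν, ℂ) →ₗ[ℂ] L2 ν := (SchwartzMap.toLpCLM ℂ ℂ 2 (volume : Measure (X ν))).toLinearMap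
  have hd : DenseRange e := SchwartzMap.denseRange_toLpCLM ENNReal.ofNat_ne_top
  have hb : ∀ ψ, ‖ℓ ψ‖ ≤ C * ‖e ψ‖ := by
    intro ψ
    rw [hℓ]
    refine (h _).trans (le_of_eq ?_)
    rw [sobNorm, fourierInv_fourier_eq, hw]
    rfl
  let L : L2 ν →L[ℂ] ℂ := ℓ.extendOfNorm e
  have hL : ∀ ψ, L (e ψ) = ℓ ψ := LinearMap.extendOfNorm_eq hd ⟨C, hb⟩
  have hLn : ‖L‖ ≤ C :=
    L.opNorm_le_bound hC fun F => LinearMap.norm_extendOfNorm_apply_le hd C hb F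
  let g : L2 ν := (InnerProductSpace.toDual ℂ (L2 ν)).symm L
  have hg : ∀ F, inner ℂ g F = L F := fun F => InnerProductSpace.toDual_symm_apply
  -- The pairing of distributions is bilinear while the Riesz representative acts antilinearly,
  -- hence the conjugation.
  refine ⟨(freq (-1)).symm (star g), ?_, ?_⟩
  · ext φ
    have h1 : φ = 𝓕 (SchwartzMap.smulLeftCLM ℂ (wtC (-1))
        (SchwartzMap.smulLeftCLM ℂ (wtC 1) (𝓕⁻ φ))) := by
      have e1 : SchwartzMap.smulLeftCLM ℂ (wtC (-1))
          (SchwartzMap.smulLeftCLM ℂ (wtC 1) (𝓕⁻ φ)) = 𝓕⁻ φ := by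
        ext ξ
        rw [SchwartzMap.smulLeftCLM_apply_apply (hasTemperateGrowth_wtC _),
          SchwartzMap.smulLeftCLM_apply_apply (hasTemperateGrowth_wtC _), smul_smul,
          wtC_neg_mul, one_smul]
      rw [e1, fourier_fourierInv_eq]
    conv_rhs => rw [h1, ← hℓ, ← hL, ← hg]
    rw [toDistr_neg_one_apply, L2.inner_def, LinearIsometryEquiv.apply_symm_apply]
    apply integral_congr_ae
    filter_upwards [Lp.coeFn_star g] with ξ hξ
    rw [hξ]
    simp [e, mul_comm]
  · rw [LinearIsometryEquiv.norm_map, norm_star_L2]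
    simpa [g] using hLn

/-- Multiplication by a function that is bounded with its first derivatives, in `H^{-1}`. -/
theorem exists_smulLeft {a : X ν → ℂ} (ha : Function.HasTemperateGrowth a) {A : ℝ}
    (h0 : ∀ x, ‖a x‖ ≤ A) (h1 : ∀ x, ‖fderiv ℝ a x‖ ≤ A) (T : Sob ν (-1)) :
    ∃ S : Sob ν (-1), S.toDistr = TemperedDistribution.smulLeftCLM ℂ a T.toDistr ∧
      ‖S‖ ≤ (2 * ν + 2) * A * ‖T‖ := by
  have hA : 0 ≤ A := (norm_nonneg _).trans (h0 0)
  refine exists_sob_of_le (by positivity) fun φ => ?_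
  rw [TemperedDistribution.smulLeftCLM_apply_apply]
  refine (norm_toDistr_apply_le T _).trans ?_
  calc ‖T‖ * sobNorm (SchwartzMap.smulLeftCLM ℂ a φ) ≤ ‖T‖ * ((2 * ν + 2) * A * sobNorm φ) :=
        mul_le_mul_of_nonneg_left (sobNorm_smul_le ha h0 h1 φ) (norm_nonneg _)
    _ = _ := by ring

/-- Multiplication by a coordinate is a derivative on the frequency side. -/
theorem isWeakDeriv_freq (j : Fin ν) {S S' : Sob ν (-1)} (h : S'.toDistr =
    TemperedDistribution.smulLeftCLM ℂ (fun x : X ν => ((x j : ℝ) : ℂ)) S.toDistr) :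
    IsWeakDeriv j (freq (-1) S) ((2 * Real.pi * Complex.I) • freq (-1) S') := by
  intro φ hφ
  set ψ : 𝓢(X ν, ℂ) := hφ.2.toSchwartzMap hφ.1 with hψ
  have h1 := toDistr_fourier_apply S (∂_{unitVec j} ψ)
  have h2 := toDistr_fourier_apply S' ψ
  have hx : Function.HasTemperateGrowth fun x : X ν => ((x j : ℝ) : ℂ) :=
    Function.Complex.hasTemperateGrowth_ofReal.comp
      (EuclideanSpace.proj j : X ν →L[ℝ] ℝ).hasTemperateGrowth
  -- The Fourier transform of a derivative is `2πi x_j` times the transform; this is the origin of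
  -- the factor in the statement.
  have h3 : S.toDistr (𝓕 (∂_{unitVec j} ψ)) = (2 * Real.pi * Complex.I) * S'.toDistr (𝓕 ψ) := by
    rw [h, TemperedDistribution.smulLeftCLM_apply_apply, ← smul_eq_mul, ← map_smul]
    congr 1
    rw [SchwartzMap.fourier_lineDerivOp_eq]
    congr 1
    ext x
    rw [SchwartzMap.smulLeftCLM_apply_apply (hasTemperateGrowth_inner _), inner_unitVec,
      SchwartzMap.smulLeftCLM_apply_apply hx, Complex.real_smul, smul_eq_mul]
  rw [h1, h2, ← integral_const_mul] at h3
  have e1 : ∫ ζ, (wt 1 ζ : ℂ) * ((2 * Real.pi * Complex.I) • freq (-1) S' : L2 ν) ζ * φ ζ =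
      ∫ ξ, (2 * Real.pi * Complex.I) * (wtC (- -1) ξ * freqIso (-1) S' ξ * ψ ξ) := by
    apply integral_congr_ae
    filter_upwards [Lp.coeFn_smul (2 * Real.pi * Complex.I) (freq (-1) S')] with ζ hζ
    rw [hζ, Pi.smul_apply, neg_neg, wtC, freq_apply, smul_eq_mul, hψ,
      HasCompactSupport.toSchwartzMap_toFun]
    ring
  rw [e1, ← h3]
  congr 1
  ext ζ
  rw [neg_neg, wtC, freq_apply, SchwartzMap.lineDerivOp_apply_eq_fderiv]
  rfl

end

section

/-! ### Density of test functions in the Schwartz space -/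

variable {ν : ℕ}

theorem exists_norm_iteratedFDeriv_one_sub_le {χ : X ν → ℂ} (hχ : IsTest χ) (m : ℕ) :
    ∃ C : ℝ, ∀ x, ‖iteratedFDeriv ℝ m (fun x => 1 - χ x) x‖ ≤ C := by
  have hc : Continuous (iteratedFDeriv ℝ m χ) :=
    hχ.1.continuous_iteratedFDeriv (mod_cast le_top)
  obtain ⟨C, hC⟩ := hc.bounded_above_of_compact_support (hχ.2.iteratedFDeriv m)
  refine ⟨1 + C, fun x => ?_⟩
  have hm : ContDiff ℝ m χ := hχ.1.of_le (mod_cast le_top)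
  have hs := iteratedFDeriv_sub_apply (x := x) (contDiffAt_const (c := (1 : ℂ))) hm.contDiffAt
  change ‖iteratedFDeriv ℝ m ((fun _ => 1) - χ) x‖ ≤ _
  rw [hs]
  refine (norm_sub_le _ _).trans (add_le_add ?_ (hC x))
  rcases eq_or_ne m 0 with rfl | h
  · simp
  · rw [iteratedFDeriv_const_of_ne h]
    simp

/-- The dilated cutoff `χ(x / n)`. -/
def dilate (χ : X ν → ℂ) (n : ℕ) (x : X ν) : ℂ := χ ((n + 1 : ℝ)⁻¹ • x)

theorem isTest_dilate {χ : X ν → ℂ} (hχ : IsTest χ) (n : ℕ) : IsTest (dilate χ n) := by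
  refine ⟨hχ.1.comp (contDiff_const_smul _), ?_⟩
  have h : (n + 1 : ℝ)⁻¹ ≠ 0 := by positivity
  exact hχ.2.comp_homeomorph (Homeomorph.smulOfNeZero _ h)

theorem IsTest.hasTemperateGrowth {χ : X ν → ℂ} (hχ : IsTest χ) : Function.HasTemperateGrowth χ :=
  (hχ.2.toSchwartzMap hχ.1).hasTemperateGrowth

theorem norm_iteratedFDeriv_one_sub_dilate_le {χ : X ν → ℂ} (hχ : IsTest χ) {m : ℕ} {C : ℝ}
    (hC : ∀ x, ‖iteratedFDeriv ℝ m (fun x => 1 - χ x) x‖ ≤ C) (n : ℕ) (x : X ν) :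
    ‖iteratedFDeriv ℝ m (fun x => 1 - dilate χ n x) x‖ ≤ C := by
  have h0 : (0 : ℝ) ≤ (n + 1 : ℝ)⁻¹ := by positivity
  have h1 : (n + 1 : ℝ)⁻¹ ≤ 1 := by
    rw [inv_le_one₀ (by positivity)]
    simp
  let L : X ν →L[ℝ] X ν := (n + 1 : ℝ)⁻¹ • ContinuousLinearMap.id ℝ (X ν)
  have hL : ‖L‖ ≤ 1 := by
    refine ContinuousLinearMap.opNorm_le_bound _ zero_le_one fun x => ?_
    change ‖(n + 1 : ℝ)⁻¹ • x‖ ≤ _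
    rw [norm_smul, Real.norm_of_nonneg h0]
    exact mul_le_mul_of_nonneg_right h1 (norm_nonneg _)
  have hd : ContDiff ℝ ∞ fun x => 1 - χ x := contDiff_const.sub hχ.1
  have e : (fun x => 1 - dilate χ n x) = (fun x => 1 - χ x) ∘ L := rfl
  rw [e, L.iteratedFDeriv_comp_right hd x (mod_cast le_top)]
  refine (ContinuousMultilinearMap.norm_compContinuousLinearMap_le _ _).trans ?_
  have hC0 : 0 ≤ C := (norm_nonneg _).trans (hC 0)
  calc _ ≤ C * 1 := by
        refine mul_le_mul (hC _) ?_ (Finset.prod_nonneg fun _ _ => norm_nonneg _) hC0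
        exact Finset.prod_le_one (fun _ _ => norm_nonneg _) fun _ _ => hL
    _ = C := mul_one C

/-- Cutoffs of a Schwartz function converge to it in the Schwartz space. -/
theorem tendsto_smul_dilate {χ : X ν → ℂ} (hχ : IsTest χ) (h1 : ∀ x, ‖x‖ ≤ 1 → χ x = 1)
    (φ : 𝓢(X ν, ℂ)) :
    Tendsto (fun n => SchwartzMap.smulLeftCLM ℂ (dilate χ n) φ) atTop (𝓝 φ) := by
  rw [(schwartz_withSeminorms ℂ (X ν) ℂ).tendsto_nhds_atTop]
  rintro ⟨k, m⟩ ε hε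
  choose C hC using exists_norm_iteratedFDeriv_one_sub_le hχ
  have hC0 : ∀ i, 0 ≤ C i := fun i => (norm_nonneg _).trans (hC i 0)
  set K : ℝ := ∑ i ∈ Finset.range (m + 1), (m.choose i : ℝ) * C i *
    SchwartzMap.seminorm ℂ (k + 1) (m - i) φ with hK
  have hK0 : 0 ≤ K := Finset.sum_nonneg fun i _ =>
    mul_nonneg (mul_nonneg (Nat.cast_nonneg _) (hC0 i)) (apply_nonneg _ _)
  obtain ⟨N, hN⟩ := exists_nat_gt (K / ε)
  refine ⟨N, fun n hn => ?_⟩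
  rw [SchwartzMap.schwartzSeminormFamily_apply, ← neg_sub, map_neg_eq_map]
  have hn0 : (0 : ℝ) < n + 1 := by positivity
  refine lt_of_le_of_lt (SchwartzMap.seminorm_le_bound ℂ k m _ (M := K / (n + 1))
    (by positivity) fun x => ?_) ?_
  · have hf : ⇑(φ - SchwartzMap.smulLeftCLM ℂ (dilate χ n) φ) =
        fun x => (1 - dilate χ n x) • φ x := by
      ext x
      rw [_root_.sub_apply, SchwartzMap.smulLeftCLM_apply_apply
        (isTest_dilate hχ n).hasTemperateGrowth, smul_eq_mul, smul_eq_mul]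
      ring
    rw [hf]
    -- Inside the ball the cutoff is identically 1 and the difference vanishes with its derivatives.
    -- Outside, one extra power of `‖x‖`, taken from the seminorm of index `k + 1`, yields the
    -- factor `1/(n+1)`.
    rcases lt_or_ge ‖x‖ (n + 1) with hx | hx
    · have hz : (fun x => (1 - dilate χ n x) • φ x) =ᶠ[𝓝 x] fun _ => 0 := by
        have : Metric.ball (0 : X ν) (n + 1) ∈ 𝓝 x :=
          Metric.isOpen_ball.mem_nhds (by simpa using hx)
        filter_upwards [this] with y hy
        have hy' : ‖y‖ < n + 1 := by simpa using hy
        rw [dilate, h1, sub_self, zero_smul]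
        rw [norm_smul, norm_inv, Real.norm_of_nonneg hn0.le, inv_mul_le_one₀ hn0]
        exact hy'.le
      rw [(Filter.EventuallyEq.iteratedFDeriv ℝ hz m).eq_of_nhds]
      have : iteratedFDeriv ℝ m (fun _ : X ν => (0 : ℂ)) x = 0 := by
        rw [iteratedFDeriv_fun_zero]
        rfl
      rw [this, norm_zero, mul_zero]
      positivity
    · have hd : ContDiff ℝ ∞ fun x => 1 - dilate χ n x :=
        contDiff_const.sub (isTest_dilate hχ n).1
      have hle := norm_iteratedFDeriv_smul_le hd (φ.smooth ⊤) x (n := m) (mod_cast le_top)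
      have hx0 : 0 < ‖x‖ := hn0.trans_le hx
      rw [le_div_iff₀ hn0]
      calc ‖x‖ ^ k * ‖iteratedFDeriv ℝ m (fun x => (1 - dilate χ n x) • φ x) x‖ * (n + 1)
          ≤ ‖x‖ ^ k * (∑ i ∈ Finset.range (m + 1), (m.choose i : ℝ) *
            ‖iteratedFDeriv ℝ i (fun x => 1 - dilate χ n x) x‖ *
            ‖iteratedFDeriv ℝ (m - i) φ x‖) * ‖x‖ := by gcongr
        _ = ∑ i ∈ Finset.range (m + 1), (m.choose i : ℝ) *
            ‖iteratedFDeriv ℝ i (fun x => 1 - dilate χ n x) x‖ *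
            (‖x‖ ^ (k + 1) * ‖iteratedFDeriv ℝ (m - i) φ x‖) := by
          rw [Finset.mul_sum, Finset.sum_mul]
          exact Finset.sum_congr rfl fun i _ => by ring
        _ ≤ K := by
          refine Finset.sum_le_sum fun i _ => ?_
          have e1 := norm_iteratedFDeriv_one_sub_dilate_le hχ (hC i) n x
          have e2 := SchwartzMap.le_seminorm ℂ (k + 1) (m - i) φ x
          have e3 := hC0 i
          gcongr
  · rw [div_lt_iff₀ hn0]
    rw [div_lt_iff₀ hε] at hN
    have : (N : ℝ) ≤ n := by exact_mod_cast hn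
    nlinarith

/-- Every Schwartz function is a limit of test functions in the Schwartz space. -/
theorem exists_tendsto_test (φ : 𝓢(X ν, ℂ)) : ∃ u : ℕ → 𝓢(X ν, ℂ),
    (∀ n, HasCompactSupport (u n)) ∧ Tendsto u atTop (𝓝 φ) := by
  let b : ContDiffBump (0 : X ν) := ⟨1, 2, one_pos, one_lt_two⟩
  have hb : IsTest fun x => (b x : ℂ) :=
    ⟨Complex.ofRealCLM.contDiff.comp b.contDiff,
      b.hasCompactSupport.mono fun x hx => by simpa using hx⟩
  refine ⟨_, fun n => ?_, tendsto_smul_dilate hb (fun x hx => ?_) φ⟩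
  · rw [SchwartzMap.smulLeftCLM_apply (isTest_dilate hb n).hasTemperateGrowth]
    exact (isTest_dilate hb n).2.mono fun x hx => by
      intro h
      simp [h] at hx
  · rw [b.one_of_mem_closedBall (by simpa using hx)]
    simp

/-- Continuous functions on the Schwartz space that agree on test functions are equal. -/
theorem eq_of_eq_on_test {Y : Type*} [TopologicalSpace Y] [T2Space Y] {f g : 𝓢(X ν, ℂ) → Y}
    (hf : Continuous f) (hg : Continuous g)
    (h : ∀ φ : 𝓢(X ν, ℂ), HasCompactSupport φ → f φ = g φ) : f = g := by
  ext φ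
  obtain ⟨u, hu, hlim⟩ := exists_tendsto_test φ
  refine tendsto_nhds_unique ((hf.tendsto φ).comp hlim) ?_
  refine ((hg.tendsto φ).comp hlim).congr fun n => (h _ (hu n)).symm

end

section

/-! ### Real multipliers and the decomposition of a potential -/

variable {ν : ℕ}

theorem hasTemperateGrowth_coe {a : X ν → ℝ} (ha : Function.HasTemperateGrowth a) :
    Function.HasTemperateGrowth fun x => (a x : ℂ) :=
  Function.Complex.hasTemperateGrowth_ofReal.comp ha

theorem hasTemperateGrowth_coord (j : Fin ν) :
    Function.HasTemperateGrowth fun x : X ν => x j :=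
  (EuclideanSpace.proj j : X ν →L[ℝ] ℝ).hasTemperateGrowth

/-- The distribution `S` is the product `a T`. -/
def IsMul (a : X ν → ℝ) (T S : Sob ν (-1)) : Prop :=
  S.toDistr = TemperedDistribution.smulLeftCLM ℂ (fun x => (a x : ℂ)) T.toDistr

theorem IsMul.of_mul {a b c : X ν → ℝ} (ha : Function.HasTemperateGrowth a)
    (hc : Function.HasTemperateGrowth c) {T S R : Sob ν (-1)} (h : IsMul a T S)
    (h' : IsMul b T R) (e : ∀ x, b x = c x * a x) : IsMul c S R := by
  rw [IsMul, h, h', TemperedDistribution.smulLeftCLM_smulLeftCLM_apply (hasTemperateGrowth_coe ha)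
    (hasTemperateGrowth_coe hc)]
  congr 1
  congr 1
  ext x
  rw [e x, Complex.ofReal_mul, Pi.mul_apply, mul_comm]

theorem IsMul.trans {a b c : X ν → ℝ} (ha : Function.HasTemperateGrowth a)
    (hc : Function.HasTemperateGrowth c) {T S R : Sob ν (-1)} (h : IsMul a T S)
    (h' : IsMul c S R) (e : ∀ x, b x = c x * a x) : IsMul b T R := by
  rw [IsMul, h', h, TemperedDistribution.smulLeftCLM_smulLeftCLM_apply (hasTemperateGrowth_coe ha)
    (hasTemperateGrowth_coe hc)]
  congr 1
  congr 1
  ext x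
  rw [e x, Complex.ofReal_mul, Pi.mul_apply, mul_comm]

theorem IsMul.add {a b c : X ν → ℝ} (ha : Function.HasTemperateGrowth a)
    (hb : Function.HasTemperateGrowth b) {T S R v : Sob ν (-1)} (h : IsMul a T S)
    (h' : IsMul b T R) (hv : IsMul c T v) (e : ∀ x, c x = a x + b x) : v = S + R := by
  apply Sob.toDistr_injective
  rw [map_add, h, h', hv, ← _root_.add_apply, ← TemperedDistribution.smulLeftCLM_add
    (hasTemperateGrowth_coe ha) (hasTemperateGrowth_coe hb)]
  congr 1
  congr 1
  ext x
  rw [e x, Complex.ofReal_add, Pi.add_apply]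

theorem norm_fderiv_coe_le {a : X ν → ℝ} (ha : ContDiff ℝ ∞ a) (x : X ν) :
    ‖fderiv ℝ (fun x => (a x : ℂ)) x‖ ≤ ‖fderiv ℝ a x‖ := by
  have h : HasFDerivAt (fun x => (a x : ℂ)) (Complex.ofRealCLM.comp (fderiv ℝ a x)) x :=
    Complex.ofRealCLM.hasFDerivAt.comp x (ha.differentiable (by simp) x).hasFDerivAt
  rw [h.fderiv]
  refine (ContinuousLinearMap.opNorm_comp_le _ _).trans ?_
  simp

theorem exists_isMul {a : X ν → ℝ} (ha : Function.HasTemperateGrowth a) {A : ℝ}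
    (h0 : ∀ x, |a x| ≤ A) (h1 : ∀ x, ‖fderiv ℝ a x‖ ≤ A) (T : Sob ν (-1)) :
    ∃ S : Sob ν (-1), IsMul a T S ∧ ‖S‖ ≤ (2 * ν + 2) * A * ‖T‖ :=
  exists_smulLeft (hasTemperateGrowth_coe ha) (fun x => by simpa using h0 x)
    (fun x => (norm_fderiv_coe_le ha.1 x).trans (h1 x)) T

theorem IsSymbol.exists_isMul {a : X ν → ℝ} (ha : IsSymbol 0 a) :
    ∃ K : ℝ, 0 ≤ K ∧ ∀ T : Sob ν (-1), ∃ S, IsMul a T S ∧ ‖S‖ ≤ K * ‖T‖ := by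
  obtain ⟨A, hA⟩ := ha.bounded
  obtain ⟨B, hB⟩ := ha.fderiv.bounded
  have hA0 := (norm_nonneg _).trans (hA 0)
  refine ⟨(2 * ν + 2) * max A B, by positivity, fun T => ?_⟩
  exact ConjClass.exists_isMul ha.hasTemperateGrowth (fun x => (hA x).trans (le_max_left _ _))
    (fun x => (hB x).trans (le_max_right _ _)) T

theorem wt_le_wt_smul {ε : ℝ} (hε : 0 < ε) (hε1 : ε ≤ 1) {α : ℝ} (hα : 0 ≤ α) (x : X ν) :
    wt α x ≤ ε ^ (-α) * wt α (ε • x) := by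
  have h1 : 1 + ‖x‖ ^ 2 ≤ ε ^ (-2 : ℝ) * (1 + ‖ε • x‖ ^ 2) := by
    rw [norm_smul, Real.norm_of_nonneg hε.le, Real.rpow_neg hε.le, Real.rpow_two, mul_add, mul_one,
      mul_pow, inv_mul_cancel_left₀ (by positivity)]
    have : 1 ≤ (ε ^ 2)⁻¹ := by
      rw [one_le_inv₀ (by positivity)]
      nlinarith
    linarith
  have h2 := Real.rpow_le_rpow (wt_base_pos x).le h1 (by positivity : 0 ≤ α / 2)
  rw [Real.mul_rpow (by positivity) (wt_base_pos _).le, ← Real.rpow_mul hε.le] at h2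
  have e : -2 * (α / 2) = -α := by ring
  rwa [e] at h2

/-- The function `⟨x⟩^α (1 + ε²|x|²)^{-1}`. -/
def cutWt (α ε : ℝ) (x : X ν) : ℝ := wt α x * wt (-2) (ε • x)

theorem cutWt_pos (α ε : ℝ) (x : X ν) : 0 < cutWt α ε x := mul_pos (wt_pos _ _) (wt_pos _ _)

/-- For `ε ≤ 1` one has `⟨x⟩ ≤ ε⁻¹⟨εx⟩`; the remaining power `⟨εx⟩^{α-2}` is at most 1 because `α ≤
2`. -/
theorem cutWt_le {ε : ℝ} (hε : 0 < ε) (hε1 : ε ≤ 1) {α : ℝ} (hα : 0 ≤ α) (hα2 : α ≤ 2)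
    (x : X ν) : cutWt α ε x ≤ ε ^ (-α) := by
  have h1 := mul_le_mul_of_nonneg_right (wt_le_wt_smul hε hε1 hα x) (wt_pos (-2) (ε • x)).le
  have h2 : wt (α - 2) (ε • x) ≤ 1 := by
    simpa using wt_le_wt (by linarith : α - 2 ≤ 0) (ε • x)
  have h3 : wt α (ε • x) * wt (-2) (ε • x) = wt (α - 2) (ε • x) := by
    rw [← wt_add, ← sub_eq_add_neg]
  calc cutWt α ε x ≤ ε ^ (-α) * (wt α (ε • x) * wt (-2) (ε • x)) := by
        rw [cutWt]
        linarith
    _ ≤ ε ^ (-α) * 1 := by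
        rw [h3]
        exact mul_le_mul_of_nonneg_left h2 (by positivity)
    _ = _ := mul_one _

theorem hasTemperateGrowth_wt_smul (s ε : ℝ) :
    Function.HasTemperateGrowth fun x : X ν => wt s (ε • x) :=
  (hasTemperateGrowth_wt s).comp (ε • ContinuousLinearMap.id ℝ (X ν)).hasTemperateGrowth

theorem hasTemperateGrowth_cutWt (α ε : ℝ) : Function.HasTemperateGrowth (cutWt α ε : X ν → ℝ) :=
  (hasTemperateGrowth_wt α).mul (hasTemperateGrowth_wt_smul _ _)

theorem norm_fderiv_wt_le (s : ℝ) (x : X ν) :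
    ‖fderiv ℝ (wt s : X ν → ℝ) x‖ ≤ |s| * wt (s - 1) x := by
  rw [fderiv_wt, norm_smul, innerSL_apply_norm, norm_mul, Real.norm_eq_abs,
    Real.norm_of_nonneg (wt_pos _ _).le, mul_assoc]
  refine mul_le_mul_of_nonneg_left ?_ (abs_nonneg _)
  have e : wt (s - 1) x = wt (s - 2) x * wt 1 x := by
    rw [← wt_add]
    ring_nf
  rw [e]
  exact mul_le_mul_of_nonneg_left (norm_le_wt_one x) (wt_pos _ _).le

theorem norm_fderiv_cutWt_le {ε : ℝ} (hε : 0 < ε) (hε1 : ε ≤ 1) {α : ℝ} (hα : 0 ≤ α)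
    (hα2 : α ≤ 2) (x : X ν) :
    ‖fderiv ℝ (cutWt α ε : X ν → ℝ) x‖ ≤ 4 * ε ^ (-α) := by
  let L : X ν →L[ℝ] X ν := ε • ContinuousLinearMap.id ℝ (X ν)
  have hL : ‖L‖ ≤ 1 := by
    refine ContinuousLinearMap.opNorm_le_bound _ zero_le_one fun x => ?_
    change ‖ε • x‖ ≤ _
    rw [norm_smul, Real.norm_of_nonneg hε.le]
    exact mul_le_mul_of_nonneg_right hε1 (norm_nonneg _)
  have d1 : HasFDerivAt (wt α : X ν → ℝ) _ x :=
    ((contDiff_wt α).differentiable (by simp) x).hasFDerivAt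
  have d2 : HasFDerivAt (fun x : X ν => wt (-2) (ε • x))
      ((fderiv ℝ (wt (-2)) (ε • x)).comp L) x :=
    ((contDiff_wt (-2)).differentiable (by simp) (ε • x)).hasFDerivAt.comp x L.hasFDerivAt
  have d3 : HasFDerivAt (cutWt α ε : X ν → ℝ) _ x := d1.fun_mul d2
  rw [d3.fderiv]
  have p1 := wt_pos α x
  have p2 := wt_pos (-2) (ε • x)
  have b1 : ‖(fderiv ℝ (wt (-2)) (ε • x)).comp L‖ ≤ 2 * wt (-2) (ε • x) := by
    refine (ContinuousLinearMap.opNorm_comp_le _ _).trans ?_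
    have h := norm_fderiv_wt_le (-2) (ε • x)
    have h' := wt_le_wt (by norm_num : (-2 - 1 : ℝ) ≤ -2) (ε • x)
    rw [abs_neg, abs_two] at h
    calc _ ≤ ‖fderiv ℝ (wt (-2)) (ε • x)‖ * 1 := mul_le_mul_of_nonneg_left hL (norm_nonneg _)
      _ ≤ _ := by linarith
  have b2 : ‖fderiv ℝ (wt α) x‖ ≤ 2 * wt α x := by
    refine (norm_fderiv_wt_le α x).trans ?_
    rw [abs_of_nonneg hα]
    exact mul_le_mul hα2 (wt_le_wt (by linarith) x) (wt_pos _ _).le (by norm_num)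
  have h := cutWt_le hε hε1 hα hα2 x
  refine (norm_add_le _ _).trans ?_
  rw [norm_smul, norm_smul, Real.norm_of_nonneg p1.le, Real.norm_of_nonneg p2.le]
  calc _ ≤ wt α x * (2 * wt (-2) (ε • x)) + wt (-2) (ε • x) * (2 * wt α x) := by gcongr
    _ = 4 * cutWt α ε x := by
      rw [cutWt]
      ring
    _ ≤ _ := by linarith

theorem exists_isMul_cutWt {ε : ℝ} (hε : 0 < ε) (hε1 : ε ≤ 1) {α : ℝ} (hα : 0 ≤ α) (hα2 : α ≤ 2)
    (T : Sob ν (-1)) :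
    ∃ S, IsMul (cutWt α ε) T S ∧ ‖S‖ ≤ 4 * (2 * ν + 2) * ‖T‖ * ε ^ (-α) := by
  have hp : 0 < ε ^ (-α) := Real.rpow_pos_of_pos hε _
  obtain ⟨S, hS, hn⟩ := exists_isMul (hasTemperateGrowth_cutWt α ε) (A := 4 * ε ^ (-α))
    (fun x => by
      rw [abs_of_pos (cutWt_pos _ _ _)]
      linarith [cutWt_le hε hε1 hα hα2 x])
    (norm_fderiv_cutWt_le hε hε1 hα hα2) T
  exact ⟨S, hS, hn.trans (le_of_eq (by ring))⟩

theorem isSymbol_coord (j : Fin ν) : IsSymbol 1 fun x : X ν => x j :=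
  isSymbol_clm (EuclideanSpace.proj j : X ν →L[ℝ] ℝ)

theorem isSymbol_coord_mul {m : ℝ} {a : X ν → ℝ} (ha : IsSymbol m a) (j : Fin ν) :
    IsSymbol (1 + m) fun x => x j * a x := (isSymbol_coord j).smul ha

/-- A partition of unity at the scale `1/ε`: `1 = ⟨εx⟩^{-2} + ε²|x|²⟨εx⟩^{-2}`. Its two terms
produce the two parts of the potential. -/
theorem wt_neg_two_smul (ε : ℝ) (x : X ν) :
    wt (-2) (ε • x) * (1 + ε ^ 2 * (wt 2 x - 1)) = 1 := by
  have h1 : wt 2 x = 1 + ‖x‖ ^ 2 := by simp [wt]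
  have h2 : wt (-2) (ε • x) = (1 + ε ^ 2 * ‖x‖ ^ 2)⁻¹ := by
    rw [wt_neg, wt]
    simp [norm_smul, mul_pow]
  rw [h1, h2, add_sub_cancel_left, inv_mul_cancel₀ (by positivity)]

/-- Multiply the partition `1 = ⟨εx⟩^{-2} + ε²|x|²⟨εx⟩^{-2}` by `⟨x⟩^{-1-μ}T`. The first term is
`⟨x⟩^{-2}` times a cutoff of `⟨x⟩^{1-μ}T`, so two coordinates may be multiplied in, at the cost
`ε^{μ-1}`. The second is `⟨x⟩^{-1} - ⟨x⟩^{-3}` times `ε²` and a cutoff of `⟨x⟩^{2-μ}T`, so one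
coordinate may be multiplied in, with norm `O(ε^μ)`. -/
theorem exists_decomposition {μ : ℝ} (hμ : 0 < μ) (hμ1 : μ ≤ 1) {T v : Sob ν (-1)}
    (hv : IsMul (wt (-(1 + μ))) T v) :
    ∃ C : ℝ, 0 ≤ C ∧ ∀ ε : ℝ, 0 < ε → ε ≤ 1 → ∃ (v₁ v₂ : Sob ν (-1))
      (x₁ x₂ : Fin ν → Sob ν (-1)) (y₁ : Fin ν → Fin ν → Sob ν (-1)), v = v₁ + v₂ ∧
      (∀ j, IsMul (fun x => x j) v₁ (x₁ j)) ∧ (∀ j, IsMul (fun x => x j) v₂ (x₂ j)) ∧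
      (∀ i j, IsMul (fun x => x j) (x₁ i) (y₁ i j)) ∧
      ‖v₁‖ ≤ C * ε ^ (μ - 1) ∧ (∀ j, ‖x₁ j‖ ≤ C * ε ^ (μ - 1)) ∧
      (∀ i j, ‖y₁ i j‖ ≤ C * ε ^ (μ - 1)) ∧ ‖v₂‖ ≤ C * ε ^ μ ∧ ∀ j, ‖x₂ j‖ ≤ C * ε ^ μ := by
  set b : X ν → ℝ := fun x => wt (-1) x + -wt (-3) x
  have sa : IsSymbol (-2) (wt (-2) : X ν → ℝ) := isSymbol_wt _
  have sb : IsSymbol (-1) b :=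
    (isSymbol_wt (-1)).add (((isSymbol_wt (-3)).mono (by norm_num)).clm_comp
      (-ContinuousLinearMap.id ℝ ℝ))
  obtain ⟨K₁, hK₁, H₁⟩ := (sa.mono (by norm_num : (-2 : ℝ) ≤ 0)).exists_isMul
  choose K₂ hK₂ H₂ using fun j =>
    ((isSymbol_coord_mul sa j).mono (by norm_num : (1 + -2 : ℝ) ≤ 0)).exists_isMul
  choose K₃ hK₃ H₃ using fun i j => ((isSymbol_coord_mul (isSymbol_coord_mul sa i) j).mono
    (by norm_num : (1 + (1 + -2) : ℝ) ≤ 0)).exists_isMul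
  obtain ⟨K₄, hK₄, H₄⟩ := (sb.mono (by norm_num : (-1 : ℝ) ≤ 0)).exists_isMul
  choose K₅ hK₅ H₅ using fun j =>
    ((isSymbol_coord_mul sb j).mono (by norm_num : (1 + -1 : ℝ) ≤ 0)).exists_isMul
  set M : ℝ := K₁ + ∑ j, K₂ j + ∑ i, ∑ j, K₃ i j + K₄ + ∑ j, K₅ j
  have s₂ : 0 ≤ ∑ j, K₂ j := Finset.sum_nonneg fun j _ => hK₂ j
  have s₃' : ∀ i, 0 ≤ ∑ j, K₃ i j := fun i => Finset.sum_nonneg fun j _ => hK₃ i j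
  have s₃ : 0 ≤ ∑ i, ∑ j, K₃ i j := Finset.sum_nonneg fun i _ => s₃' i
  have s₅ : 0 ≤ ∑ j, K₅ j := Finset.sum_nonneg fun j _ => hK₅ j
  have l₁ : K₁ ≤ M := by linarith
  have l₂ : ∀ j, K₂ j ≤ M := fun j => by
    have := Finset.single_le_sum (fun j _ => hK₂ j) (Finset.mem_univ j)
    linarith
  have l₃ : ∀ i j, K₃ i j ≤ M := fun i j => by
    have h1 := Finset.single_le_sum (fun j _ => hK₃ i j) (Finset.mem_univ j)
    have h2 := Finset.single_le_sum (fun i _ => s₃' i) (Finset.mem_univ i)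
    linarith
  have l₄ : K₄ ≤ M := by linarith
  have l₅ : ∀ j, K₅ j ≤ M := fun j => by
    have := Finset.single_le_sum (fun j _ => hK₅ j) (Finset.mem_univ j)
    linarith
  have hM : 0 ≤ M := hK₁.trans l₁
  set D : ℝ := 4 * (2 * ν + 2) * ‖T‖
  have hD : 0 ≤ D := by positivity
  refine ⟨M * D, by positivity, fun ε hε hε1 => ?_⟩
  obtain ⟨P, hP, nP⟩ := exists_isMul_cutWt hε hε1 (by linarith : 0 ≤ 1 - μ) (by linarith) T
  obtain ⟨Q, hQ, nQ⟩ := exists_isMul_cutWt hε hε1 (by linarith : 0 ≤ 2 - μ) (by linarith) T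
  have eP : -(1 - μ) = μ - 1 := by ring
  rw [eP] at nP
  -- The prefactor `ε²` of the partition beats the loss `ε^{-(2-μ)}`.
  have nQ' : ‖((ε ^ 2 : ℝ) : ℂ) • Q‖ ≤ D * ε ^ μ := by
    rw [norm_smul, Complex.norm_real, Real.norm_of_nonneg (by positivity)]
    have e : ε ^ μ = ε ^ 2 * ε ^ (-(2 - μ)) := by
      rw [← Real.rpow_two, ← Real.rpow_add hε]
      ring_nf
    rw [e]
    nlinarith [mul_le_mul_of_nonneg_left nQ (sq_nonneg ε)]
  have hQ' : IsMul (fun x => ε ^ 2 * cutWt (2 - μ) ε x) T (((ε ^ 2 : ℝ) : ℂ) • Q) := by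
    have : IsMul (fun _ => ε ^ 2) Q (((ε ^ 2 : ℝ) : ℂ) • Q) := by
      rw [IsMul, map_smul, TemperedDistribution.smulLeftCLM_const]
    exact hQ.trans (hasTemperateGrowth_cutWt _ _) (.const _) this fun _ => rfl
  set R := ((ε ^ 2 : ℝ) : ℂ) • Q
  have key : ∀ {K : ℝ} {S U : Sob ν (-1)} {t : ℝ}, 0 ≤ K → K ≤ M → ‖S‖ ≤ K * ‖U‖ → ‖U‖ ≤ D * t →
      ‖S‖ ≤ M * D * t := by
    intro K S U t hK hKM hS hU
    calc ‖S‖ ≤ K * ‖U‖ := hS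
      _ ≤ M * (D * t) := mul_le_mul hKM hU (norm_nonneg _) hM
      _ = _ := by ring
  obtain ⟨v₁, hv₁, nv₁⟩ := H₁ P
  choose x₁ hx₁ nx₁ using fun j => H₂ j P
  choose y₁ hy₁ ny₁ using fun i j => H₃ i j P
  obtain ⟨v₂, hv₂, nv₂⟩ := H₄ R
  choose x₂ hx₂ nx₂ using fun j => H₅ j R
  have ta := (sa.mono (by norm_num : (-2 : ℝ) ≤ 0)).hasTemperateGrowth
  have tb := (sb.mono (by norm_num : (-1 : ℝ) ≤ 0)).hasTemperateGrowth
  have tc := fun j => ((isSymbol_coord_mul sa j).mono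
    (by norm_num : (1 + -2 : ℝ) ≤ 0)).hasTemperateGrowth
  have tR : Function.HasTemperateGrowth fun x : X ν => ε ^ 2 * cutWt (2 - μ) ε x :=
    (Function.HasTemperateGrowth.const (ε ^ 2)).mul (hasTemperateGrowth_cutWt _ _)
  refine ⟨v₁, v₂, x₁, x₂, y₁, ?_, fun j => ?_, fun j => ?_, fun i j => ?_,
    key hK₁ l₁ nv₁ nP, fun j => key (hK₂ j) (l₂ j) (nx₁ j) nP,
    fun i j => key (hK₃ i j) (l₃ i j) (ny₁ i j) nP, key hK₄ l₄ nv₂ nQ',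
    fun j => key (hK₅ j) (l₅ j) (nx₂ j) nQ'⟩
  · have g₁ : IsMul (fun x => wt (-2) x * cutWt (1 - μ) ε x) T v₁ :=
      hP.trans (hasTemperateGrowth_cutWt _ _) ta hv₁ fun _ => rfl
    have g₂ : IsMul (fun x => b x * (ε ^ 2 * cutWt (2 - μ) ε x)) T v₂ :=
      hQ'.trans tR tb hv₂ fun _ => rfl
    refine g₁.add (ta.mul (hasTemperateGrowth_cutWt _ _)) (tb.mul tR) g₂ hv fun x => ?_
    have e1 : wt (1 - μ) x = wt 2 x * wt (-(1 + μ)) x := by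
      rw [← wt_add]
      ring_nf
    have e2 : wt (2 - μ) x = wt 3 x * wt (-(1 + μ)) x := by
      rw [← wt_add]
      ring_nf
    have e3 : wt (-2) x * wt 2 x = 1 := by
      rw [← wt_add]
      simp
    have e4 : wt (-1) x * wt 3 x = wt 2 x := by
      rw [← wt_add]
      norm_num
    have e5 : wt (-3) x * wt 3 x = 1 := by
      rw [← wt_add]
      simp
    have e6 := wt_neg_two_smul ε x
    change wt (-(1 + μ)) x = wt (-2) x * (wt (1 - μ) x * wt (-2) (ε • x)) +
      (wt (-1) x + -wt (-3) x) * (ε ^ 2 * (wt (2 - μ) x * wt (-2) (ε • x)))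
    rw [e1, e2]
    linear_combination (-wt (-(1 + μ)) x) * e6 - wt (-(1 + μ)) x * wt (-2) (ε • x) * e3 -
      ε ^ 2 * wt (-(1 + μ)) x * wt (-2) (ε • x) * e4 +
      ε ^ 2 * wt (-(1 + μ)) x * wt (-2) (ε • x) * e5
  · exact hv₁.of_mul ta (hasTemperateGrowth_coord j) (hx₁ j) fun _ => rfl
  · exact hv₂.of_mul tb (hasTemperateGrowth_coord j) (hx₂ j) fun _ => rfl
  · exact (hx₁ i).of_mul (tc i) (hasTemperateGrowth_coord j) (hy₁ i j) fun _ => rfl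

end

section

/-! ### The distribution of a multiplication operator -/

variable {ν : ℕ}

/-- The operator `V` is the multiplication by the distribution `v` on Schwartz functions. -/
def IsPotential (V : Sob ν 1 →L[ℂ] Sob ν (-1)) (v : Sob ν (-1)) : Prop :=
  ∀ φ : 𝓢(X ν, ℂ), (V (ofSchwartz 1 φ)).toDistr =
    TemperedDistribution.smulLeftCLM ℂ φ v.toDistr

/-- Tested on a fixed `ψ`, both sides are continuous in `φ` for the Schwartz topology; for the
right-hand side the roles of `φ` and `ψ` are exchanged. -/
theorem isPotential_of_test {V : Sob ν 1 →L[ℂ] Sob ν (-1)} {v : Sob ν (-1)}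
    (h : ∀ φ : 𝓢(X ν, ℂ), HasCompactSupport φ → (V (ofSchwartz 1 φ)).toDistr =
      TemperedDistribution.smulLeftCLM ℂ φ v.toDistr) : IsPotential V v := by
  intro φ
  ext ψ
  have h1 : Continuous fun φ : 𝓢(X ν, ℂ) => (V (ofSchwartz 1 φ)).toDistr ψ :=
    (continuous_toDistr_apply ψ).comp (V.continuous.comp (continuous_ofSchwartz 1))
  have h2 : Continuous fun φ : 𝓢(X ν, ℂ) => v.toDistr (SchwartzMap.smulLeftCLM ℂ ψ φ) :=
    v.toDistr.continuous.comp (SchwartzMap.smulLeftCLM ℂ ψ).continuous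
  have e : ∀ φ : 𝓢(X ν, ℂ), TemperedDistribution.smulLeftCLM ℂ φ v.toDistr ψ =
      v.toDistr (SchwartzMap.smulLeftCLM ℂ ψ φ) := by
    intro φ
    rw [TemperedDistribution.smulLeftCLM_apply_apply]
    congr 1
    ext x
    rw [SchwartzMap.smulLeftCLM_apply_apply φ.hasTemperateGrowth,
      SchwartzMap.smulLeftCLM_apply_apply ψ.hasTemperateGrowth, smul_eq_mul, smul_eq_mul, mul_comm]
  rw [e]
  exact congrFun (eq_of_eq_on_test h1 h2 fun φ hφ => by rw [h φ hφ, e]) φ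

/-- The potential is `⟨x⟩^{-s}T`; it suffices to insert `⟨x⟩^{-s}φ` in place of `φ` in the
hypothesis. -/
theorem exists_isPotential {V : Sob ν 1 →L[ℂ] Sob ν (-1)} {s : ℝ} (hs : 0 ≤ s) {T : Sob ν (-1)}
    (h : ∀ φ : 𝓢(X ν, ℂ), HasCompactSupport φ →
      (V (ofSchwartz 1 (SchwartzMap.smulLeftCLM ℂ (wtC s) φ))).toDistr =
        TemperedDistribution.smulLeftCLM ℂ φ T.toDistr) :
    ∃ v, IsMul (wt (-s)) T v ∧ IsPotential V v := by
  obtain ⟨K, -, H⟩ := ((isSymbol_wt (-s)).mono (neg_nonpos.2 hs)).exists_isMul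
  obtain ⟨v, hv, -⟩ := H T
  refine ⟨v, hv, isPotential_of_test fun φ hφ => ?_⟩
  have h1 := h (SchwartzMap.smulLeftCLM ℂ (wtC (-s)) φ) (by
    rw [SchwartzMap.smulLeftCLM_apply (hasTemperateGrowth_wtC (-s))]
    exact hφ.mono fun x hx hx' => by simp [hx'] at hx)
  have h2 : SchwartzMap.smulLeftCLM ℂ (wtC s) (SchwartzMap.smulLeftCLM ℂ (wtC (-s)) φ) = φ := by
    ext x
    rw [SchwartzMap.smulLeftCLM_apply_apply (hasTemperateGrowth_wtC _),
      SchwartzMap.smulLeftCLM_apply_apply (hasTemperateGrowth_wtC _), smul_smul, mul_comm,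
      wtC_neg_mul, one_smul]
  rw [h2] at h1
  rw [h1, hv]
  change _ = TemperedDistribution.smulLeftCLM ℂ φ
    (TemperedDistribution.smulLeftCLM ℂ (wtC (-s)) T.toDistr)
  rw [TemperedDistribution.smulLeftCLM_smulLeftCLM_apply (hasTemperateGrowth_wtC (-s))
    φ.hasTemperateGrowth, SchwartzMap.smulLeftCLM_apply (hasTemperateGrowth_wtC (-s))]
  rfl

theorem exists_of_weightedMem_jap {V : Sob ν 1 →L[ℂ] Sob ν (-1)} {s : ℝ}
    (h : WeightedMem (fun x => jap x ^ s) V) : ∃ T : Sob ν (-1),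
      ∀ φ : 𝓢(X ν, ℂ), HasCompactSupport φ →
        (V (ofSchwartz 1 (SchwartzMap.smulLeftCLM ℂ (wtC s) φ))).toDistr =
          TemperedDistribution.smulLeftCLM ℂ φ T.toDistr := by
  obtain ⟨T, hT⟩ := h
  refine ⟨T, fun φ hφ => hT φ ⟨φ.smooth ⊤, hφ⟩ _ _ ?_ (toDistr_ofSchwartz 1 _)⟩
  filter_upwards [SchwartzMap.coeFn_toLp (SchwartzMap.smulLeftCLM ℂ (wtC s) φ) 2 volume] with x hx
  rw [hx, SchwartzMap.smulLeftCLM_apply_apply (hasTemperateGrowth_wtC _), jap_rpow, wtC,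
    smul_eq_mul]

/-- For `0 < μ`, the distribution of `V` is `⟨x⟩^{-1-μ'} T` with `T ∈ H^{-1}`, `μ' = min μ 1`. -/
theorem exists_isPotential_of_weightedMem_jap {V : Sob ν 1 →L[ℂ] Sob ν (-1)} {μ : ℝ} (hμ : 0 < μ)
    (h : WeightedMem (fun x => jap x ^ (1 + μ)) V) :
    ∃ T v, IsMul (wt (-(1 + min μ 1))) T v ∧ IsPotential V v := by
  obtain ⟨T, hT⟩ := exists_of_weightedMem_jap h
  obtain ⟨v, hv, hV⟩ := exists_isPotential (by linarith) hT
  have hm : min μ 1 ≤ μ := min_le_left _ _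
  have hs := (isSymbol_wt (ν := ν) (min μ 1 - μ)).mono (by linarith : _ ≤ (0 : ℝ))
  obtain ⟨K, -, H⟩ := hs.exists_isMul
  obtain ⟨T', hT', -⟩ := H T
  refine ⟨T', v, hT'.of_mul hs.hasTemperateGrowth (hasTemperateGrowth_wt _) hv fun x => ?_, hV⟩
  rw [← wt_add]
  ring_nf

theorem IsSymbol.bddComp {y : X ν → ℝ} (hy : IsSymbol 0 y) {β : ℝ → ℝ} (hβ : ContDiff ℝ ∞ β)
    (hs : HasCompactSupport β) : Function.HasTemperateGrowth (fun x => β (y x)) ∧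
      ∃ A, (∀ x, |β (y x)| ≤ A) ∧ ∀ x, ‖_root_.fderiv ℝ (fun x => β (y x)) x‖ ≤ A := by
  obtain ⟨C, hC⟩ := hβ.continuous.bounded_above_of_compact_support hs
  obtain ⟨D, hD⟩ := (hβ.continuous_fderiv (by simp)).bounded_above_of_compact_support
    (hs.fderiv (𝕜 := ℝ))
  obtain ⟨E, hE⟩ := hy.fderiv.bounded
  refine ⟨(hs.hasTemperateGrowth hβ).comp hy.hasTemperateGrowth, max C (D * E), fun x =>
    (hC _).trans (le_max_left _ _), fun x => le_trans ?_ (le_max_right _ _)⟩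
  have h1 : HasFDerivAt (fun x => β (y x)) _ x :=
    (hβ.differentiable (by simp) (y x)).hasFDerivAt.comp x
      (hy.1.differentiable (by simp) x).hasFDerivAt
  rw [h1.fderiv]
  refine (ContinuousLinearMap.opNorm_comp_le _ _).trans ?_
  exact mul_le_mul (hD _) (hE _) (norm_nonneg _) ((norm_nonneg _).trans (hD 0))

/-- The function `|x|² / ⟨x⟩²`. -/
def japRatio (x : X ν) : ℝ := 1 + -wt (-2) x

theorem isSymbol_japRatio : IsSymbol 0 (japRatio : X ν → ℝ) :=
  (isSymbol_const 1).add (((isSymbol_wt (-2)).mono (by norm_num)).clm_comp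
    (-ContinuousLinearMap.id ℝ ℝ))

theorem japRatio_mul (x : X ν) : japRatio x * wt 1 x ^ 2 = ‖x‖ ^ 2 := by
  have h : wt (-2) x * wt 1 x ^ 2 = 1 := by
    rw [sq, ← wt_add, ← wt_add]
    norm_num
  rw [japRatio, add_mul, one_mul, neg_mul, h, wt_one_sq]
  ring

/-- For the weight `|x|`: the product `⟨x⟩ V` belongs to `H^{-1}`. -/
theorem exists_of_weightedMem_norm {V : Sob ν 1 →L[ℂ] Sob ν (-1)} (hV : IsMultiplication V)
    (h : WeightedMem (fun x => ‖x‖) V) : ∃ T : Sob ν (-1),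
      ∀ φ : 𝓢(X ν, ℂ), HasCompactSupport φ →
        (V (ofSchwartz 1 (SchwartzMap.smulLeftCLM ℂ (wtC 1) φ))).toDistr =
          TemperedDistribution.smulLeftCLM ℂ φ T.toDistr := by
  obtain ⟨T, hT⟩ := h
  -- Equal to 1 on `[1/2, 1]` and zero below `1/4`. Composed with `|x|²/⟨x⟩²`, it removes the
  -- neighbourhood of the origin where `|x|` is not smooth and cannot be divided out.
  let χ : ContDiffBump (1 : ℝ) := ⟨1 / 2, 3 / 4, by norm_num, by norm_num⟩
  have hχ0 : ∀ t ≤ (1 / 4 : ℝ), χ t = 0 := fun t ht =>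
    χ.zero_of_le_dist (by
      rw [Real.dist_eq, abs_sub_comm]
      exact le_trans (by change (3 / 4 : ℝ) ≤ 1 - t; linarith) (le_abs_self _))
  have hχ1 : ∀ t, 1 / 2 ≤ t → t ≤ 1 → χ t = 1 := fun t h1 h2 =>
    χ.one_of_mem_closedBall (by
      rw [Metric.mem_closedBall, Real.dist_eq, abs_sub_comm, abs_of_nonneg (by linarith)]
      change 1 - t ≤ 1 / 2
      linarith)
  -- Chosen so that `|x| β(|x|²/⟨x⟩²) = ⟨x⟩ χ(|x|²/⟨x⟩²)`.
  set β : ℝ → ℝ := fun t => χ t * (√t)⁻¹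
  have sβ : HasCompactSupport β := χ.hasCompactSupport.mul_right
  have cβ : ContDiff ℝ ∞ β := by
    rw [contDiff_iff_contDiffAt]
    intro t
    rcases lt_or_ge t (1 / 4) with ht | ht
    · have : β =ᶠ[𝓝 t] fun _ => 0 := by
        filter_upwards [Iio_mem_nhds ht] with r hr
        simp [β, hχ0 r (le_of_lt hr)]
      exact contDiffAt_const.congr_of_eventuallyEq this
    · have ht0 : t ≠ 0 := by
        intro h0
        norm_num [h0] at ht
      refine χ.contDiff.contDiffAt.mul ((Real.contDiffAt_sqrt ht0).inv ?_)
      rw [Real.sqrt_ne_zero']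
      linarith
  obtain ⟨tb, A, hA0, hA1⟩ := isSymbol_japRatio.bddComp (ν := ν) cβ sβ
  obtain ⟨S, hS, -⟩ := exists_isMul tb hA0 hA1 T
  have hr1 : ∀ x : X ν, japRatio x ≤ 1 := fun x => by
    have := wt_pos (-2) x
    rw [japRatio]
    linarith
  have hr0 : ∀ x : X ν, 0 ≤ japRatio x := fun x => by
    have h1 := japRatio_mul x
    have h2 : 0 < wt 1 x ^ 2 := pow_pos (wt_pos 1 x) 2
    exact nonneg_of_mul_nonneg_left (h1 ▸ sq_nonneg ‖x‖) h2
  -- the cutoff near the origin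
  set θ : X ν → ℂ := fun x => wtC 1 x * (1 - (χ (japRatio x) : ℂ))
  have hθ : IsTest θ := by
    refine ⟨?_, ?_⟩
    · have h1 : ContDiff ℝ ∞ fun x : X ν => (χ (japRatio x) : ℂ) :=
        Complex.ofRealCLM.contDiff.comp (χ.contDiff.comp isSymbol_japRatio.1)
      exact (hasTemperateGrowth_wtC 1).1.mul (contDiff_const.sub h1)
    -- For `|x| > 1` the ratio `|x|²/⟨x⟩²` is at least `1/2`, where `χ` equals 1.
    · refine HasCompactSupport.intro (isCompact_closedBall (0 : X ν) 1) fun x hx => ?_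
      have hx1 : 1 < ‖x‖ := by simpa using hx
      have h2 : 1 / 2 ≤ japRatio x := by
        have h3 := japRatio_mul x
        rw [wt_one_sq] at h3
        by_contra! h4
        nlinarith
      simp [θ, hχ1 _ h2 (hr1 x)]
  set Θ : 𝓢(X ν, ℂ) := hθ.2.toSchwartzMap hθ.1
  -- Split `⟨x⟩V` as `⟨x⟩(1-χ)V + β|x|V`. The first summand is `V` applied to a test function, by
  -- the multiplication property; the second is a bounded multiplier applied to the given `T`.
  refine ⟨V (ofSchwartz 1 Θ) + S, fun φ hφ => ?_⟩
  have tφ := φ.hasTemperateGrowth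
  have tb' := hasTemperateGrowth_coe tb
  set φb : 𝓢(X ν, ℂ) := SchwartzMap.smulLeftCLM ℂ (fun x => (β (japRatio x) : ℂ)) φ
  set g₁ := ofSchwartz (ν := ν) 1 (SchwartzMap.smulLeftCLM ℂ φ Θ)
  set g := ofSchwartz (ν := ν) 1 (SchwartzMap.smulLeftCLM ℂ (wtC 1) φ)
  have sφb : HasCompactSupport φb := by
    rw [SchwartzMap.smulLeftCLM_apply tb']
    exact hφ.mono fun x hx hx' => by simp [hx'] at hx
  have h1 : (V g₁).toDistr =
      TemperedDistribution.smulLeftCLM ℂ φ (V (ofSchwartz 1 Θ)).toDistr := by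
    refine hV φ ⟨φ.smooth ⊤, hφ⟩ (ofSchwartz 1 Θ) g₁ ?_
    ext ψ
    rw [TemperedDistribution.smulLeftCLM_apply_apply, toDistr_ofSchwartz, toDistr_ofSchwartz,
      Lp.toTemperedDistribution_toLp_eq, Lp.toTemperedDistribution_toLp_eq]
    simp only [SchwartzMap.toTemperedDistributionCLM_apply_apply]
    congr 1
    ext x
    rw [SchwartzMap.smulLeftCLM_apply_apply tφ, SchwartzMap.smulLeftCLM_apply_apply tφ]
    simp only [smul_eq_mul]
    ring
  have h2 : (V (g - g₁)).toDistr = TemperedDistribution.smulLeftCLM ℂ φb T.toDistr := by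
    refine hT φb ⟨φb.smooth ⊤, sφb⟩ (g - g₁) ((SchwartzMap.smulLeftCLM ℂ (wtC 1) φ).toLp 2 volume -
      (SchwartzMap.smulLeftCLM ℂ φ Θ).toLp 2 volume) ?_ ?_
    · filter_upwards [Lp.coeFn_sub ((SchwartzMap.smulLeftCLM ℂ (wtC 1) φ).toLp 2 volume)
        ((SchwartzMap.smulLeftCLM ℂ φ Θ).toLp 2 volume),
        SchwartzMap.coeFn_toLp (SchwartzMap.smulLeftCLM ℂ (wtC 1) φ) 2 volume,
        SchwartzMap.coeFn_toLp (SchwartzMap.smulLeftCLM ℂ φ Θ) 2 volume] with x k1 k2 k3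
      rw [k1, Pi.sub_apply, k2, k3, SchwartzMap.smulLeftCLM_apply_apply (hasTemperateGrowth_wtC _),
        SchwartzMap.smulLeftCLM_apply_apply tφ, SchwartzMap.smulLeftCLM_apply_apply tb']
      have k4 : χ (japRatio x) * wt 1 x = ‖x‖ * β (japRatio x) := by
        have h3 : ‖x‖ = √(japRatio x) * wt 1 x := by
          rw [← Real.sqrt_sq (norm_nonneg x), ← japRatio_mul, Real.sqrt_mul (hr0 x),
            Real.sqrt_sq (wt_pos 1 x).le]
        rcases lt_or_ge (japRatio x) (1 / 4) with h4 | h4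
        · simp [β, hχ0 _ h4.le]
        · have h5 : √(japRatio x) ≠ 0 := by
            rw [Real.sqrt_ne_zero']
            linarith
          simp only [β]
          rw [h3]
          field_simp
      have k5 : (χ (japRatio x) : ℂ) * wtC 1 x = (‖x‖ : ℂ) * (β (japRatio x) : ℂ) := by
        rw [wtC]
        exact_mod_cast k4
      simp only [smul_eq_mul, Θ, HasCompactSupport.toSchwartzMap_toFun, θ]
      linear_combination φ x * k5
    · rw [map_sub, toDistr_ofSchwartz, toDistr_ofSchwartz]
      exact (map_sub (Lp.toTemperedDistributionCLM ℂ (volume : Measure (X ν)) 2) _ _).symm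
  have h3 : V g = V g₁ + V (g - g₁) := by rw [← map_add, add_sub_cancel]
  rw [h3, map_add, h1, h2, map_add, map_add, hS, TemperedDistribution.smulLeftCLM_smulLeftCLM_apply
    tb' tφ, SchwartzMap.smulLeftCLM_apply tb']
  rfl

/-- For the weight `|x|`: the distribution of `V` and its products with the coordinates belong
to `H^{-1}`. -/
theorem exists_isPotential_of_weightedMem_norm {V : Sob ν 1 →L[ℂ] Sob ν (-1)}
    (hV : IsMultiplication V) (h : WeightedMem (fun x => ‖x‖) V) :
    ∃ (v : Sob ν (-1)) (x : Fin ν → Sob ν (-1)), IsPotential V v ∧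
      ∀ j, IsMul (fun x => x j) v (x j) := by
  obtain ⟨T, hT⟩ := exists_of_weightedMem_norm hV h
  obtain ⟨v, hv, hP⟩ := exists_isPotential zero_le_one hT
  have hs := isSymbol_wt (ν := ν) (-1)
  choose K hK H using fun j =>
    ((isSymbol_coord_mul hs j).mono (by norm_num : (1 + -1 : ℝ) ≤ 0)).exists_isMul
  choose x hx nx using fun j => H j T
  exact ⟨v, x, hP, fun j => hv.of_mul (hs.mono (by norm_num)).hasTemperateGrowth
    (hasTemperateGrowth_coord j) (hx j) fun _ => rfl⟩

end

section

/-! ### The form of a multiplication operator on the frequency side -/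

open FourierTransform

variable {ν : ℕ}

/-- An operator `H^1 → H^{-1}`, on the frequency side. -/
def freqOp (V : Sob ν 1 →L[ℂ] Sob ν (-1)) : L2 ν →L[ℂ] L2 ν :=
  (freq (-1)).toContinuousLinearEquiv.toContinuousLinearMap ∘L V ∘L
    (freq 1).symm.toContinuousLinearEquiv.toContinuousLinearMap

theorem freqOp_apply (V : Sob ν 1 →L[ℂ] Sob ν (-1)) (F : L2 ν) :
    freqOp V F = freq (-1) (V ((freq 1).symm F)) := rfl

theorem kint_eq_integral (S : L2 ν) {Ψ : X ν × X ν → ℂ} (hc : Continuous Ψ)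
    (hs : HasCompactSupport Ψ) :
    kint S Ψ = ∫ ζ, (wt 1 ζ : ℂ) * S ζ * ∫ η, Ψ (ζ + η, η) := by
  have hmp : MeasurePreserving (fun p : X ν × X ν => (p.1 + p.2, p.2)) (volume.prod volume)
      (volume.prod volume) := measurePreserving_add_prod volume volume
  have hi := integrable_convKer_mul S hc hs
  have h1 := integral_map hmp.measurable.aemeasurable
    (f := fun p => convKer S p * Ψ p) (by rw [hmp.map_eq]; exact hi.1)
  rw [hmp.map_eq] at h1
  have h2 : Integrable (fun p : X ν × X ν => convKer S (p.1 + p.2, p.2) * Ψ (p.1 + p.2, p.2))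
      (volume.prod volume) := (hmp.integrable_comp hi.1).2 hi
  rw [kint, h1, integral_prod _ h2]
  congr 1
  ext1 ζ
  rw [← integral_const_mul]
  congr 1
  ext1 η
  rw [convKer, add_sub_cancel_right]

theorem freq_symm_wt_mul {g : X ν → ℂ} (hg : IsAnnular g) :
    (freq 1).symm (hg.wt_mul 1).toL2 =
      ofSchwartz 1 (𝓕⁻ (hg.hasCompactSupport.toSchwartzMap hg.contDiff)) := by
  rw [LinearIsometryEquiv.symm_apply_eq, freq_ofSchwartz, fourier_fourierInv_eq]
  ext1
  filter_upwards [(hg.wt_mul 1).coeFn_toL2, SchwartzMap.coeFn_toLp (SchwartzMap.smulLeftCLM ℂ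
    (wtC 1) (hg.hasCompactSupport.toSchwartzMap hg.contDiff)) 2 volume] with ξ h1 h2
  rw [h1, h2, SchwartzMap.smulLeftCLM_apply_apply (hasTemperateGrowth_wtC _)]
  rfl

theorem inner_wt_mul {f : X ν → ℂ} (hf : IsAnnular f) (R : Sob ν (-1)) {b : 𝓢(X ν, ℂ)}
    (hb : ∀ ξ, b ξ = (starRingEnd ℂ) (f ξ)) :
    inner ℂ (hf.wt_mul 1).toL2 (freq (-1) R) = R.toDistr (𝓕 b) := by
  rw [toDistr_fourier_apply, L2.inner_def, neg_neg]
  apply integral_congr_ae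
  filter_upwards [(hf.wt_mul 1).coeFn_toL2] with ξ h1
  rw [h1, hb, freq_apply, wtC]
  simp only [RCLike.inner_apply, map_mul, Complex.conj_ofReal]
  ring

/-- On the frequency side, the product with a distribution is a convolution. -/
theorem represents_freqOp {V : Sob ν 1 →L[ℂ] Sob ν (-1)} {v : Sob ν (-1)}
    (h : IsPotential V v) : Represents (freqOp V) (cform (freq (-1) v) fun _ => 1) := by
  intro f g hf hg
  have cb : ContDiff ℝ ∞ fun ξ => (starRingEnd ℂ) (f ξ) := Complex.conjCLE.contDiff.comp hf.contDiff
  have sb : HasCompactSupport fun ξ => (starRingEnd ℂ) (f ξ) :=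
    hf.hasCompactSupport.mono fun x hx => by simpa using hx
  have sa : HasCompactSupport fun ξ => g (-ξ) :=
    hg.hasCompactSupport.comp_homeomorph (Homeomorph.neg (X ν))
  set b : 𝓢(X ν, ℂ) := sb.toSchwartzMap cb
  set a : 𝓢(X ν, ℂ) := sa.toSchwartzMap (hg.contDiff.comp contDiff_neg)
  set γ : 𝓢(X ν, ℂ) := hg.hasCompactSupport.toSchwartzMap hg.contDiff
  -- The product of two transforms is the transform of a convolution. The reflection in `a` appears
  -- because an inverse transform is a transform of the reflected function.
  have hconv : SchwartzMap.smulLeftCLM ℂ (𝓕⁻ γ : 𝓢(X ν, ℂ)) (𝓕 b) =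
      𝓕 (SchwartzMap.convolution (ContinuousLinearMap.mul ℂ ℂ) a b) := by
    ext x
    rw [SchwartzMap.smulLeftCLM_apply_apply (SchwartzMap.hasTemperateGrowth _),
      SchwartzMap.fourier_convolution_apply,
      Real.fourier_bilin_convolution_eq _ a.integrable b.integrable,
      ContinuousLinearMap.mul_apply', smul_eq_mul, SchwartzMap.fourier_coe,
      SchwartzMap.fourierInv_coe, Real.fourierInv_eq_fourier_comp_neg]
    rfl
  rw [freqOp_apply, freq_symm_wt_mul hg, inner_wt_mul hf _ (b := b) fun _ => rfl, h,
    TemperedDistribution.smulLeftCLM_apply_apply, hconv, toDistr_fourier_apply, neg_neg, cform,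
    kint_eq_integral _ (by
      have := (contDiff_tensor hf.contDiff hg.contDiff).continuous
      simpa using this) (by
      simpa using hasCompactSupport_tensor hf.hasCompactSupport hg.hasCompactSupport)]
  congr 1
  ext1 ζ
  rw [freq_apply, wtC, SchwartzMap.convolution_apply, convolution_def,
    ← integral_neg_eq_self]
  congr 2
  ext1 η
  simp only [ContinuousLinearMap.mul_apply', a, b, HasCompactSupport.toSchwartzMap_toFun, neg_neg,
    sub_neg_eq_add, Complex.ofReal_one, one_mul]
  ring

end

section

/-! ### Commutators of a multiplication operator with the conjugate operator -/

variable {ν : ℕ}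

theorem cform_add_left (S₁ S₂ : L2 ν) {c : X ν × X ν → ℝ} (hc : Continuous c) {f g : X ν → ℂ}
    (hf : IsAnnular f) (hg : IsAnnular g) :
    cform (S₁ + S₂) c f g = cform S₁ c f g + cform S₂ c f g := by
  have h1 := (contDiff_tensor hf.contDiff hg.contDiff).continuous
  have h2 := hasCompactSupport_tensor hf.hasCompactSupport hg.hasCompactSupport
  exact kint_add_left S₁ S₂ ((Complex.continuous_ofReal.comp hc).mul h1) h2.mul_left

theorem Represents.lieForm_one_add {S₁ S₂ : L2 ν} {S₁' S₂' : Fin ν → L2 ν}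
    {B₁ B₂ : L2 ν →L[ℂ] L2 ν} (h₁ : Represents B₁ (lieForm S₁ S₁' fun _ => 1))
    (h₂ : Represents B₂ (lieForm S₂ S₂' fun _ => 1)) :
    Represents (B₁ + B₂) (lieForm (S₁ + S₂) (fun j => S₁' j + S₂' j) fun _ => 1) := by
  intro f g hf hg
  rw [h₁.add h₂ f g hf hg]
  dsimp only
  rw [lieForm_one, lieForm_one, lieForm_one,
    cform_add_left S₁ S₂ isCoef_divCoef.1.continuous hf hg]
  simp only [cform_add_left _ _ (isCoef_fieldCoef _).1.continuous hf hg, Finset.sum_add_distrib]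
  ring

theorem norm_two_pi_I_smul (F : L2 ν) :
    ‖(2 * Real.pi * Complex.I) • F‖ = 2 * Real.pi * ‖F‖ := by
  rw [norm_smul, norm_mul, norm_mul, Complex.norm_I, Complex.norm_real,
    Real.norm_of_nonneg Real.pi_pos.le]
  simp

theorem exists_hasCommutator [NeZero ν] {V : Sob ν 1 →L[ℂ] Sob ν (-1)} {v : Sob ν (-1)}
    {x : Fin ν → Sob ν (-1)} (hV : IsPotential V v) (hx : ∀ j, IsMul (fun x => x j) v (x j)) :
    ∃ B, HasCommutator (freqOp V) B := by
  obtain ⟨M, -, H⟩ := exists_operator_lieForm_one (NeZero.pos ν)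
  obtain ⟨B, -, hB⟩ := H (freq (-1) v) fun j => (2 * Real.pi * Complex.I) • freq (-1) (x j)
  exact ⟨B, hasCommutator_lieForm_one (fun j => isWeakDeriv_freq j (hx j)) (represents_freqOp hV)
    hB⟩

/-- The commutator constants do not depend on the decomposition parameter, so for each `τ` the
parameter `ε = τ` may be used: `‖B₂‖` and `τ‖D‖` are then both `O(τ^μ)`. -/
theorem exists_norm_second_difference_le [NeZero ν] {V : Sob ν 1 →L[ℂ] Sob ν (-1)} {μ : ℝ}
    (hμ : 0 < μ) (hμ1 : μ ≤ 1) {T v : Sob ν (-1)} (hv : IsMul (wt (-(1 + μ))) T v)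
    (hV : IsPotential V v) :
    ∃ C : ℝ, ∀ τ : ℝ, 0 < τ → τ ≤ 1 →
      ‖sandwich (freqOp V) τ + sandwich (freqOp V) (-τ) - (2 : ℂ) • freqOp V‖ ≤
        C * τ ^ (1 + μ) := by
  obtain ⟨C, hC, H⟩ := exists_decomposition hμ hμ1 hv
  obtain ⟨M₁, hM₁, H₁⟩ := exists_operator_lieForm_one (NeZero.pos ν)
  obtain ⟨M₂, hM₂, H₂⟩ := exists_second_commutator (NeZero.pos ν)
  have hp := Real.pi_pos
  set p : ℝ := 2 * Real.pi with hpd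
  have hp0 : 0 < p := by positivity
  set n : ℝ := (ν : ℝ)
  have hn : 0 ≤ n := Nat.cast_nonneg ν
  refine ⟨2 * Real.exp 2 * (M₁ * (C + n * (p * C)) +
    M₂ * (C + n * (p * C) + n * (n * (p * (p * C))))), fun τ hτ hτ1 => ?_⟩
  obtain ⟨v₁, v₂, x₁, x₂, y₁, hsum, hx₁, hx₂, hy₁, nv₁, nx₁, ny₁, nv₂, nx₂⟩ := H τ hτ hτ1
  set a : ℂ := 2 * Real.pi * Complex.I
  have w₁ := fun j => isWeakDeriv_freq j (hx₁ j)
  have w₂ := fun j => isWeakDeriv_freq j (hx₂ j)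
  have w₃ : ∀ i j, IsWeakDeriv j (a • freq (-1) (x₁ i)) (a • a • freq (-1) (y₁ i j)) := by
    intro i j
    have h := isWeakDeriv_freq j (S := a • x₁ i) (S' := a • y₁ i j) (by
      rw [map_smul, map_smul, map_smul, hy₁ i j])
    rwa [map_smul, map_smul] at h
  obtain ⟨B₁, -, hB₁⟩ := H₁ (freq (-1) v₁) fun j => a • freq (-1) (x₁ j)
  obtain ⟨B₂, nB₂, hB₂⟩ := H₁ (freq (-1) v₂) fun j => a • freq (-1) (x₂ j)
  obtain ⟨D, nD, hD⟩ := H₂ (freq (-1) v₁) (fun j => a • freq (-1) (x₁ j))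
    (fun i j => a • a • freq (-1) (y₁ i j)) w₁ w₃ B₁ hB₁
  have hA : Represents (freqOp V) (cform (freq (-1) v₁ + freq (-1) v₂) fun _ => 1) := by
    rw [← map_add, ← hsum]
    exact represents_freqOp hV
  have hw : ∀ j, IsWeakDeriv j (freq (-1) v₁ + freq (-1) v₂)
      (a • freq (-1) (x₁ j) + a • freq (-1) (x₂ j)) := by
    intro j
    have h := isWeakDeriv_freq j (S := v₁ + v₂) (S' := x₁ j + x₂ j) (by
      rw [map_add, map_add, map_add, hx₁ j, hx₂ j])
    rwa [map_add, map_add, smul_add] at h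
  have hcomm := hasCommutator_lieForm_one hw hA (hB₁.lieForm_one_add hB₂)
  refine (norm_second_difference_le hcomm rfl hD hτ.le hτ1).trans ?_
  have e1 : τ ^ (1 + μ) = τ ^ μ * τ := by
    rw [add_comm, Real.rpow_add_one hτ.ne']
  have e2 : τ * τ ^ (μ - 1) = τ ^ μ := by
    rw [← Real.rpow_one_add' hτ.le (by linarith)]
    ring_nf
  have t0 : 0 ≤ τ ^ μ := by positivity
  have b₂ : ‖B₂‖ ≤ M₁ * (C + n * (p * C)) * τ ^ μ := by
    refine nB₂.trans ?_
    rw [mul_assoc]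
    refine mul_le_mul_of_nonneg_left ?_ hM₁
    simp only [a, norm_two_pi_I_smul, LinearIsometryEquiv.norm_map]
    have hs : ∑ j, 2 * Real.pi * ‖x₂ j‖ ≤ n * (p * (C * τ ^ μ)) := by
      refine (Finset.sum_le_sum fun j _ => mul_le_mul_of_nonneg_left (nx₂ j) hp0.le).trans ?_
      simp [n, hpd]
    calc _ ≤ C * τ ^ μ + n * (p * (C * τ ^ μ)) := add_le_add nv₂ hs
      _ = _ := by ring
  have d : τ * ‖D‖ ≤ M₂ * (C + n * (p * C) + n * (n * (p * (p * C)))) * τ ^ μ := by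
    rw [← e2]
    have hD' : ‖D‖ ≤ M₂ * ((C + n * (p * C) + n * (n * (p * (p * C)))) * τ ^ (μ - 1)) := by
      refine nD.trans ?_
      refine mul_le_mul_of_nonneg_left ?_ hM₂
      simp only [a, norm_two_pi_I_smul, LinearIsometryEquiv.norm_map]
      have hs : ∑ j, 2 * Real.pi * ‖x₁ j‖ ≤ n * (p * (C * τ ^ (μ - 1))) := by
        refine (Finset.sum_le_sum fun j _ => mul_le_mul_of_nonneg_left (nx₁ j) hp0.le).trans ?_
        simp [n, hpd]
      have hs' : ∑ i, ∑ j, 2 * Real.pi * (2 * Real.pi * ‖y₁ i j‖) ≤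
          n * (n * (p * (p * (C * τ ^ (μ - 1))))) := by
        refine (Finset.sum_le_sum fun i _ => Finset.sum_le_sum fun j _ =>
          mul_le_mul_of_nonneg_left (mul_le_mul_of_nonneg_left (ny₁ i j) hp0.le) hp0.le).trans ?_
        simp [n, hpd]
      calc _ ≤ C * τ ^ (μ - 1) + n * (p * (C * τ ^ (μ - 1))) +
            n * (n * (p * (p * (C * τ ^ (μ - 1))))) := add_le_add (add_le_add nv₁ hs) hs'
        _ = _ := by ring
    calc τ * ‖D‖ ≤ τ * _ := mul_le_mul_of_nonneg_left hD' hτ.le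
      _ = _ := by ring
  rw [e1]
  calc _ ≤ 2 * Real.exp 2 * (M₁ * (C + n * (p * C)) * τ ^ μ +
        M₂ * (C + n * (p * C) + n * (n * (p * (p * C)))) * τ ^ μ) * τ := by gcongr
    _ = _ := by ring

end

section

/-! ### The generator of the transport group in `L²` -/

variable {ν : ℕ}

theorem toL2_genWt_zero {F : X ν → ℂ} (hF : IsAnnular F) :
    (hF.genWt 0).toL2 = hF.genFun.toL2 := by
  congr 1
  exact genWt_zero F

/-- The weak form of `G = iA F` on the frequency side. -/
def IsWeakGen (F G : L2 ν) : Prop :=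
  ∀ (H : X ν → ℂ) (hH : IsAnnular H), inner ℂ hH.genFun.toL2 F = -inner ℂ hH.toL2 G

theorem isClosed_isWeakGen : IsClosed {p : L2 ν × L2 ν | IsWeakGen p.1 p.2} := by
  simp only [IsWeakGen, Set.ofPred_forall]
  refine isClosed_iInter fun H => isClosed_iInter fun hH => isClosed_eq ?_ ?_
  · exact continuous_const.inner continuous_fst
  · exact (continuous_const.inner continuous_snd).neg

section

variable [NeZero ν]

/-- Paired with an annular `H`, the unitary transport moves onto `H`, which stays annular. The weak
relation then gives the derivative of the pairing at every time. -/
theorem IsWeakGen.transport_sub_eq_integral {F G : L2 ν} (h : IsWeakGen F G) (τ : ℝ) :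
    transport 0 τ F - F = ∫ t in (0 : ℝ)..τ, transport 0 t G := by
  rw [← sub_eq_zero]
  refine eq_zero_of_inner_annular fun H hH => ?_
  have hc := continuous_transport 0 G
  have hd : ∀ t, HasDerivAt (fun t => inner ℂ hH.toL2 (transport 0 t F))
      (inner ℂ hH.toL2 (transport 0 t G)) t := by
    intro t
    have e : ∀ (K : L2 ν) (t : ℝ), inner ℂ hH.toL2 (transport 0 t K) =
        inner ℂ (transport 0 (-t) hH.toL2) K := by
      intro K t
      rw [inner_transport, neg_zero, neg_neg]
    simp only [e]
    have h1 := hasDerivAt_transport_gen 0 (-t) hH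
    have h2 := HasDerivAt.scomp (h := fun τ : ℝ => -τ) (x := t) (h' := -1)
      (g₁ := fun τ => transport 0 τ hH.toL2) h1 (hasDerivAt_neg t)
    have h3 := h2.inner ℂ (hasDerivAt_const t F)
    rw [inner_zero_right, zero_add, neg_smul, one_smul, inner_neg_left,
      toL2_genWt_zero (hH.transportFun 0 (-t)), h _ (hH.transportFun 0 (-t)), neg_neg,
      ← transport_toL2 0 (-t) hH] at h3
    exact h3
  have hi : ∫ t in (0 : ℝ)..τ, inner ℂ hH.toL2 (transport 0 t G) =
      inner ℂ hH.toL2 (transport 0 τ F) - inner ℂ hH.toL2 (transport 0 0 F) :=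
    intervalIntegral.integral_eq_sub_of_hasDerivAt (fun t _ => hd t)
      ((continuous_const.inner hc).intervalIntegrable _ _)
  have h4 := (innerSL ℂ hH.toL2).intervalIntegral_comp_comm
    (hc.intervalIntegrable (μ := volume) 0 τ)
  simp only [innerSL_apply_apply] at h4
  rw [inner_sub_right, inner_sub_right, ← h4, hi, transport_zero]
  simp

theorem IsWeakGen.hasDerivAt {F G : L2 ν} (h : IsWeakGen F G) :
    HasDerivAt (fun τ => transport 0 τ F) G 0 := by
  have h1 := ((continuous_transport 0 G).integral_hasStrictDerivAt 0 0).hasDerivAt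
  rw [transport_zero, ContinuousLinearMap.id_apply] at h1
  refine (h1.const_add F).congr_of_eventuallyEq (Eventually.of_forall fun τ => ?_)
  simp only
  rw [← h.transport_sub_eq_integral, add_sub_cancel]

/-- The annular functions are a core of the generator. -/
theorem mem_of_hasDerivAt_transport {K : Submodule ℂ (L2 ν × L2 ν)}
    (hK : IsClosed (K : Set (L2 ν × L2 ν)))
    (h : ∀ (F : X ν → ℂ) (hF : IsAnnular F), (hF.toL2, hF.genFun.toL2) ∈ K) {F G : L2 ν}
    (hFG : HasDerivAt (fun τ => transport 0 τ F) G 0) : (F, G) ∈ K := by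
  -- Time averages of orbits lie in the closed relation `K`: for annular data the orbit itself stays
  -- in `K`, and the general case follows by density.
  have hint : ∀ (τ : ℝ) (F : L2 ν),
      (∫ t in (0 : ℝ)..τ, transport 0 t F, transport 0 τ F - F) ∈ K := by
    intro τ F
    have hcl : IsClosed {F : L2 ν |
        (∫ t in (0 : ℝ)..τ, transport 0 t F, transport 0 τ F - F) ∈ K} := by
      refine hK.preimage (Continuous.prodMk ?_ (by fun_prop))
      refine LipschitzWith.continuous (K := Real.nnabs τ)
        (LipschitzWith.of_dist_le_mul fun F F' => ?_)
      rw [dist_eq_norm, dist_eq_norm, ← intervalIntegral.integral_sub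
        ((continuous_transport 0 F).intervalIntegrable _ _)
        ((continuous_transport 0 F').intervalIntegrable _ _)]
      have hb : ∀ t ∈ Set.uIoc 0 τ, ‖transport 0 t F - transport 0 t F'‖ ≤ ‖F - F'‖ :=
        fun t _ => by rw [← map_sub, norm_transport_zero]
      refine (intervalIntegral.norm_integral_le_of_norm_le_const hb).trans ?_
      rw [sub_zero, mul_comm]
      rfl
    refine hcl.closure_subset_iff.2 ?_ (dense_annularSet F)
    rintro _ ⟨H, hH, rfl⟩
    let k : ℝ → K := fun t =>
      ⟨(transport 0 t hH.toL2, ((hH.transportFun 0 t).genWt 0).toL2), by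
        rw [transport_toL2, toL2_genWt_zero (hH.transportFun 0 t)]
        exact h _ _⟩
    -- Two expressions for the derivative of the same orbit: the generator commutes with the group.
    -- The second component of `k` is therefore continuous.
    have e : ∀ t, ((hH.transportFun 0 t).genWt 0).toL2 = transport 0 t (hH.genWt 0).toL2 :=
      fun t => (hasDerivAt_transport_gen 0 t hH).unique (hasDerivAt_transport 0 t hH)
    have hk : Continuous k := by
      refine Continuous.subtype_mk ((continuous_transport 0 _).prodMk ?_) _
      simp only [e]
      exact continuous_transport 0 _
    have hKc : CompleteSpace K := hK.completeSpace_coe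
    have h1 := K.subtypeL.intervalIntegral_comp_comm (hk.intervalIntegrable (μ := volume) 0 τ)
    have h2 : ∫ t in (0 : ℝ)..τ, K.subtypeL (k t) = (∫ t in (0 : ℝ)..τ, transport 0 t hH.toL2,
        transport 0 τ hH.toL2 - hH.toL2) := by
      have hi : IntervalIntegrable (fun t => K.subtypeL (k t)) volume 0 τ :=
        (K.subtypeL.continuous.comp hk).intervalIntegrable _ _
      have h3 := (ContinuousLinearMap.fst ℂ (L2 ν) (L2 ν)).intervalIntegral_comp_comm hi
      have h4 := (ContinuousLinearMap.snd ℂ (L2 ν) (L2 ν)).intervalIntegral_comp_comm hi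
      refine Prod.ext h3.symm (h4.symm.trans ?_)
      have h5 : ∫ t in (0 : ℝ)..τ, transport 0 t (hH.genWt 0).toL2 =
          transport 0 τ hH.toL2 - transport 0 0 hH.toL2 :=
        intervalIntegral.integral_eq_sub_of_hasDerivAt (fun t _ => hasDerivAt_transport 0 t hH)
          ((continuous_transport 0 _).intervalIntegrable _ _)
      rw [transport_zero, ContinuousLinearMap.id_apply] at h5
      rw [← h5]
      congr 1
      ext1 t
      exact e t
    change _ ∈ K
    rw [← h2, h1]
    exact (∫ t in (0 : ℝ)..τ, k t).2
  -- Averages over shrinking intervals converge to `(F, G)` in the graph norm, since `F` is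
  -- differentiable along the group.
  have hlim : Tendsto (fun τ : ℝ => ((τ⁻¹ : ℝ) : ℂ) •
      (∫ t in (0 : ℝ)..τ, transport 0 t F, transport 0 τ F - F)) (𝓝[≠] 0) (𝓝 (F, G)) := by
    have h1 := ((continuous_transport 0 F).integral_hasStrictDerivAt 0 0).hasDerivAt
    rw [transport_zero, ContinuousLinearMap.id_apply] at h1
    have h2 := hasDerivAt_iff_tendsto_slope_zero.1 h1
    have h3 := hasDerivAt_iff_tendsto_slope_zero.1 hFG
    have h4 := h2.prodMk_nhds h3
    refine h4.congr fun τ => ?_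
    rw [zero_add, intervalIntegral.integral_same, sub_zero, transport_zero]
    refine Prod.ext ?_ ?_
    · exact (Complex.coe_smul τ⁻¹ (∫ t in (0 : ℝ)..τ, transport 0 t F)).symm
    · exact (Complex.coe_smul τ⁻¹ (transport 0 τ F - F)).symm
  exact hK.mem_of_tendsto hlim (Eventually.of_forall fun τ => K.smul_mem _ (hint τ F))

end

theorem integral_div_field {Θ : X ν → ℂ} (hΘ : IsTest Θ) :
    ∫ ξ, (fderiv ℝ Θ ξ (field ξ) + (divField ξ : ℂ) * Θ ξ) = 0 := by
  have hc : ∀ j : Fin ν, ContDiff ℝ ∞ fun ξ : X ν => field ξ j • Θ ξ := fun j =>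
    (contDiff_field_apply j).smul hΘ.1
  have hs : ∀ j : Fin ν, HasCompactSupport fun ξ : X ν => field ξ j • Θ ξ := fun j =>
    hΘ.2.mono fun ξ hξ h => by simp [h] at hξ
  have hcd : ∀ j : Fin ν, Continuous fun ξ =>
      fderiv ℝ (fun ξ : X ν => field ξ j • Θ ξ) ξ (unitVec j) := fun j =>
    ((hc j).continuous_fderiv (by simp)).clm_apply continuous_const
  have hi : ∀ j : Fin ν, Integrable (fun ξ =>
      fderiv ℝ (fun ξ : X ν => field ξ j • Θ ξ) ξ (unitVec j)) volume := fun j =>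
    (hcd j).integrable_of_hasCompactSupport ((hs j).fderiv_apply (𝕜 := ℝ) _)
  have h0 : ∀ j : Fin ν, ∫ ξ, fderiv ℝ (fun ξ : X ν => field ξ j • Θ ξ) ξ (unitVec j) = 0 := by
    intro j
    have h := integral_mul_fderiv_eq_neg_fderiv_mul_of_integrable (μ := (volume : Measure (X ν)))
      (f := fun _ => (1 : ℂ)) (g := fun ξ : X ν => field ξ j • Θ ξ) (v := unitVec j)
      (by simp) (by simpa using hi j)
      (by simpa using (hc j).continuous.integrable_of_hasCompactSupport (hs j))
      (fun _ _ => by fun_prop) fun ξ _ => (hc j).differentiable (by simp) ξ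
    simpa using h
  have e : ∀ ξ, fderiv ℝ Θ ξ (field ξ) + (divField ξ : ℂ) * Θ ξ =
      ∑ j : Fin ν, fderiv ℝ (fun ξ : X ν => field ξ j • Θ ξ) ξ (unitVec j) := by
    intro ξ
    have h1 : ∀ j : Fin ν, fderiv ℝ (fun ξ : X ν => field ξ j • Θ ξ) ξ (unitVec j) =
        field ξ j • fderiv ℝ Θ ξ (unitVec j) +
          (fderiv ℝ (fun ξ : X ν => field ξ j) ξ (unitVec j)) • Θ ξ := by
      intro j
      have h2 : HasFDerivAt (fun ξ : X ν => field ξ j • Θ ξ) _ ξ :=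
        ((contDiff_field_apply j).differentiable (by simp) ξ).hasFDerivAt.fun_smul
          (hΘ.1.differentiable (by simp) ξ).hasFDerivAt
      rw [h2.fderiv]
      simp
    rw [Finset.sum_congr rfl fun j _ => h1 j, Finset.sum_add_distrib, ← Finset.sum_smul,
      sum_fderiv_field, Complex.real_smul]
    simp only [← map_smul]
    rw [← map_sum, sum_unitVec]
  simp only [e]
  rw [integral_finsetSum _ fun j _ => hi j]
  exact Finset.sum_eq_zero fun j _ => h0 j

/-- Integration by parts along `b`. No decay of `ψ` is needed, because `H` has compact support. -/
theorem isWeakGen_of_contDiff {ψ : X ν → ℂ} (hψ : ContDiff ℝ ∞ ψ) {F G : L2 ν}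
    (hF : F =ᵐ[volume] ψ) (hG : G =ᵐ[volume] genFun ψ) : IsWeakGen F G := by
  intro H hH
  have cH : ContDiff ℝ ∞ fun ξ => (starRingEnd ℂ) (H ξ) := Complex.conjCLE.contDiff.comp hH.contDiff
  have hΘ : IsTest fun ξ => (starRingEnd ℂ) (H ξ) * ψ ξ :=
    ⟨cH.mul hψ, hH.hasCompactSupport.mono fun ξ hξ h => by simp [h] at hξ⟩
  have h0 := integral_div_field hΘ
  rw [eq_neg_iff_add_eq_zero, L2.inner_def, L2.inner_def, ← integral_add
    (L2.integrable_inner _ _) (L2.integrable_inner _ _), ← neg_eq_zero, ← integral_neg, ← h0]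
  apply integral_congr_ae
  filter_upwards [hF, hG, hH.coeFn_toL2, hH.genFun.coeFn_toL2] with ξ h1 h2 h3 h4
  rw [h1, h2, h3, h4]
  have h5 : HasFDerivAt (fun ξ => (starRingEnd ℂ) (H ξ))
      ((Complex.conjCLE : ℂ →L[ℝ] ℂ).comp (fderiv ℝ H ξ)) ξ :=
    Complex.conjCLE.toContinuousLinearMap.hasFDerivAt.comp ξ
      (hH.contDiff.differentiable (by simp) ξ).hasFDerivAt
  have h6 : HasFDerivAt (fun ξ => (starRingEnd ℂ) (H ξ) * ψ ξ) _ ξ :=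
    h5.fun_mul (hψ.differentiable (by simp) ξ).hasFDerivAt
  rw [h6.fderiv]
  have h7 : (starRingEnd ℂ) (1 / 2) = 1 / 2 := by simp [Complex.ext_iff]
  simp only [h7, RCLike.inner_apply, genFun, map_neg, map_add, map_mul, Complex.conj_ofReal,
    _root_.add_apply, _root_.smul_apply, ContinuousLinearMap.comp_apply, smul_eq_mul]
  simp
  ring

end

section

/-! ### The conjugate operator on the frequency side -/

open FourierTransform
open scoped LineDeriv

variable {ν : ℕ}

theorem hasTemperateGrowth_uField_coord (j : Fin ν) : Function.HasTemperateGrowth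
    fun ξ : X ν => ((uField ν ((2 * Real.pi) • ξ) j : ℝ) : ℂ) :=
  hasTemperateGrowth_coe (((isSymbol_uField (ν := ν)).comp_clm
    ((2 * Real.pi) • ContinuousLinearMap.id ℝ (X ν))).clm_comp
      (EuclideanSpace.proj j : X ν →L[ℝ] ℝ)).hasTemperateGrowth

theorem uField_two_pi_smul (ξ : X ν) (j : Fin ν) :
    uField ν ((2 * Real.pi) • ξ) j = 2 * Real.pi * field ξ j := by
  have hp := Real.pi_pos
  rw [field_eq, PiLp.smul_apply, smul_eq_mul, ← mul_assoc, mul_inv_cancel₀ (by positivity), one_mul]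

theorem fourier_uOp (j : Fin ν) (φ : 𝓢(X ν, ℂ)) (ξ : X ν) :
    (𝓕 (uOp (uField ν) j φ) : 𝓢(X ν, ℂ)) ξ =
      2 * Real.pi * (field ξ j • (𝓕 φ : 𝓢(X ν, ℂ)) ξ) := by
  rw [uOp, SchwartzMap.fourierMultiplierCLM_apply, fourier_fourierInv_eq,
    SchwartzMap.smulLeftCLM_apply_apply (hasTemperateGrowth_uField_coord j), uField_two_pi_smul,
    smul_eq_mul, Complex.real_smul]
  push_cast
  ring

theorem fourier_qOp (j : Fin ν) (φ : 𝓢(X ν, ℂ)) (ξ : X ν) :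
    2 * Real.pi * (𝓕 (qOp j φ) : 𝓢(X ν, ℂ)) ξ =
      Complex.I * fderiv ℝ (𝓕 φ : 𝓢(X ν, ℂ)) ξ (unitVec j) := by
  have h := SchwartzMap.lineDerivOp_fourier_eq φ (unitVec j)
  have e : SchwartzMap.smulLeftCLM ℂ (fun x : X ν => inner ℝ x (unitVec j)) φ = qOp j φ := by
    ext x
    rw [SchwartzMap.smulLeftCLM_apply_apply (hasTemperateGrowth_inner _), inner_unitVec, qOp,
      SchwartzMap.smulLeftCLM_apply_apply (hasTemperateGrowth_coe (hasTemperateGrowth_coord j)),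
      Complex.real_smul, smul_eq_mul]
  rw [e, FourierTransform.fourier_smul] at h
  have h1 := congrArg (fun ψ : 𝓢(X ν, ℂ) => ψ ξ) h
  simp only [SchwartzMap.lineDerivOp_apply_eq_fderiv, _root_.smul_apply, smul_eq_mul] at h1
  rw [h1]
  linear_combination (2 * Real.pi * (𝓕 (qOp j φ) : 𝓢(X ν, ℂ)) ξ) * Complex.I_sq

/-- With `u_j(p) = 2πb_j` and `q_j = (i/2π)∂_j` the factors `2π` cancel. Symmetrizing gives `i(b·∇ +
½ div b)`, that is, `-i` times the generator. -/
theorem fourier_conjExpr (φ : 𝓢(X ν, ℂ)) (ξ : X ν) :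
    (𝓕 (conjExpr (uField ν) φ) : 𝓢(X ν, ℂ)) ξ =
      -Complex.I * genFun (𝓕 φ : 𝓢(X ν, ℂ)) ξ := by
  have hp : (2 * Real.pi : ℂ) ≠ 0 := by
    exact_mod_cast (by positivity : (2 * Real.pi : ℝ) ≠ 0)
  set F : 𝓢(X ν, ℂ) := 𝓕 φ with hF
  have h1 : ∀ j : Fin ν, (𝓕 (uOp (uField ν) j (qOp j φ)) : 𝓢(X ν, ℂ)) ξ =
      Complex.I * (field ξ j • fderiv ℝ F ξ (unitVec j)) := by
    intro j
    rw [fourier_uOp, Complex.real_smul, Complex.real_smul]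
    linear_combination (field ξ j : ℂ) * fourier_qOp j φ ξ
  have h2 : ∀ j : Fin ν, (𝓕 (qOp j (uOp (uField ν) j φ)) : 𝓢(X ν, ℂ)) ξ =
      Complex.I * (field ξ j • fderiv ℝ F ξ (unitVec j) +
        fderiv ℝ (fun ξ : X ν => field ξ j) ξ (unitVec j) • F ξ) := by
    intro j
    have e : ⇑(𝓕 (uOp (uField ν) j φ) : 𝓢(X ν, ℂ)) =
        fun ξ => (2 * Real.pi : ℂ) * (field ξ j • F ξ) := funext fun ξ => fourier_uOp j φ ξ
    have hd : HasFDerivAt (fun ξ => (2 * Real.pi : ℂ) * (field ξ j • F ξ)) _ ξ :=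
      ((hasFDerivAt_field_apply j ξ).fun_smul (SchwartzMap.hasFDerivAt F ξ)).const_mul _
    have h3 := fourier_qOp j (uOp (uField ν) j φ) ξ
    rw [e, hd.fderiv] at h3
    simp only [_root_.smul_apply, _root_.add_apply, ContinuousLinearMap.smulRight_apply,
      smul_eq_mul] at h3
    refine mul_left_cancel₀ hp (h3.trans ?_)
    ring
  have h4 : 𝓕 (conjExpr (uField ν) φ) = (1 / 2 : ℂ) • ∑ j : Fin ν,
      (𝓕 (uOp (uField ν) j (qOp j φ)) + 𝓕 (qOp j (uOp (uField ν) j φ)) : 𝓢(X ν, ℂ)) := by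
    have h5 : ∀ ψ : 𝓢(X ν, ℂ), 𝓕 ψ = fourierCLM ℂ 𝓢(X ν, ℂ) ψ := fun _ => rfl
    simp only [h5, conjExpr, _root_.smul_apply, _root_.sum_apply, _root_.add_apply,
      ContinuousLinearMap.comp_apply, map_smul, map_sum, map_add]
  rw [h4, _root_.smul_apply, _root_.sum_apply]
  simp only [_root_.add_apply, h1, h2]
  rw [← Finset.sum_congr rfl fun j _ => mul_add _ _ _, ← Finset.mul_sum]
  simp only [Finset.sum_add_distrib]
  rw [← Finset.sum_smul, sum_fderiv_field]
  simp only [← map_smul]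
  rw [← map_sum, sum_unitVec, genFun, Complex.real_smul, smul_eq_mul]
  ring

theorem mem_graph_conjOpMin (u : X ν → X ν) (p : L2 ν × L2 ν) : p ∈ (conjOpMin u).graph ↔
    ∃ φ : 𝓢(X ν, ℂ), HasCompactSupport φ ∧
      p = (φ.toLp 2 volume, (conjExpr u φ).toLp 2 volume) := by
  have key : ∀ (φ : testSubmodule ν) (h : testToL2 ν φ ∈ (conjOpMin u).domain),
      conjOpMin u ⟨testToL2 ν φ, h⟩ = (conjExpr u φ.1).toLp 2 volume := by
    intro φ h
    have e : (LinearEquiv.ofInjective (testToL2 ν) (testToL2_injective ν)).symm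
        ⟨testToL2 ν φ, h⟩ = φ := by
      rw [LinearEquiv.symm_apply_eq]
      rfl
    change (conjExpr u ((LinearEquiv.ofInjective (testToL2 ν)
      (testToL2_injective ν)).symm ⟨testToL2 ν φ, h⟩).1).toLp 2 volume = _
    rw [e]
  rw [LinearPMap.mem_graph_iff']
  constructor
  · rintro ⟨⟨y, φ, rfl⟩, rfl⟩
    exact ⟨φ.1, φ.2, Prod.ext rfl (key φ _)⟩
  · rintro ⟨φ, hφ, rfl⟩
    exact ⟨⟨testToL2 ν ⟨φ, hφ⟩, ⟨φ, hφ⟩, rfl⟩, Prod.ext rfl (key ⟨φ, hφ⟩ _)⟩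

/-- The graph of `½ (u(p)·q + q·u(p))` on Schwartz functions is in the closure of that on
`C_c^∞`. -/
theorem mem_closure_graph_conjOpMin (u : X ν → X ν) (φ : 𝓢(X ν, ℂ)) :
    ((φ.toLp 2 volume : L2 ν), ((conjExpr u φ).toLp 2 volume : L2 ν)) ∈
      (conjOpMin u).graph.topologicalClosure := by
  obtain ⟨f, hf, hlim⟩ := exists_tendsto_test φ
  have hc : Continuous fun φ : 𝓢(X ν, ℂ) =>
      (SchwartzMap.toLpCLM ℂ ℂ 2 (volume : Measure (X ν)) φ,
        SchwartzMap.toLpCLM ℂ ℂ 2 (volume : Measure (X ν)) (conjExpr u φ)) := by fun_prop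
  exact mem_closure_of_tendsto ((hc.tendsto φ).comp hlim) (Eventually.of_forall fun n =>
    (mem_graph_conjOpMin u _).2 ⟨f n, hf n, rfl⟩)

/-- A closed relation that is single valued is the graph of an operator, so identifying the closure
of the graph gives closability as well. -/
theorem graph_conjOp {u : X ν → X ν} {K : Submodule ℂ (L2 ν × L2 ν)}
    (hK : (conjOpMin u).graph.topologicalClosure = K) (h : ∀ p ∈ K, p.1 = 0 → p.2 = 0) :
    (conjOp u).graph = K := by
  have hc : (conjOpMin u).IsClosable :=
    ⟨K.toLinearPMap, by rw [Submodule.toLinearPMap_graph_eq _ h, hK]⟩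
  rw [conjOp, ← hc.graph_closure_eq_closure_graph, hK]

end

section

/-! ### The unitary group of the conjugate operator -/

open FourierTransform

variable {ν : ℕ}

/-- The Fourier transform in `L²`. -/
def fourierL2 (ν : ℕ) : L2 ν ≃ₗᵢ[ℂ] L2 ν := Lp.fourierTransformₗᵢ (X ν) ℂ

theorem fourierL2_toLp (φ : 𝓢(X ν, ℂ)) :
    fourierL2 ν (φ.toLp 2 volume) = (𝓕 φ : 𝓢(X ν, ℂ)).toLp 2 volume :=
  SchwartzMap.toLp_fourier_eq φ

/-- The pairs with `G = iA F`, in the weak sense on the frequency side. -/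
def weakGenSubmodule (ν : ℕ) : Submodule ℂ (L2 ν × L2 ν) where
  carrier := {p | IsWeakGen p.1 p.2}
  add_mem' := fun {p q} hp hq H hH => by
    rw [Prod.fst_add, Prod.snd_add, inner_add_right, inner_add_right, hp H hH, hq H hH, neg_add]
  zero_mem' := fun H hH => by simp
  smul_mem' := fun c p hp H hH => by
    rw [Prod.smul_fst, Prod.smul_snd, inner_smul_right, inner_smul_right, hp H hH, mul_neg]

theorem IsAnnular.isWeakGen {F : X ν → ℂ} (hF : IsAnnular F) :
    IsWeakGen hF.toL2 hF.genFun.toL2 :=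
  isWeakGen_of_contDiff hF.contDiff hF.coeFn_toL2 hF.genFun.coeFn_toL2

/-- The weak relation is closed and contains the core, hence the graph of the strong generator;
conversely it gives the integrated equation. -/
theorem hasDerivAt_transport_iff [NeZero ν] {F G : L2 ν} :
    HasDerivAt (fun τ => transport 0 τ F) G 0 ↔ IsWeakGen F G :=
  ⟨fun h => mem_of_hasDerivAt_transport (K := weakGenSubmodule ν) isClosed_isWeakGen
    (fun _ hF => hF.isWeakGen) h, IsWeakGen.hasDerivAt⟩

/-- The pairs `(F, G)` such that `(𝓕⁻ F, -i 𝓕⁻ G)` is given. -/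
def freqPair (ν : ℕ) : L2 ν × L2 ν →L[ℂ] L2 ν × L2 ν :=
  ((fourierL2 ν).symm.toContinuousLinearEquiv.toContinuousLinearMap.comp
    (ContinuousLinearMap.fst ℂ (L2 ν) (L2 ν))).prod
  ((-Complex.I) • (fourierL2 ν).symm.toContinuousLinearEquiv.toContinuousLinearMap.comp
    (ContinuousLinearMap.snd ℂ (L2 ν) (L2 ν)))

theorem freqPair_apply (p : L2 ν × L2 ν) :
    freqPair ν p = ((fourierL2 ν).symm p.1, (-Complex.I) • (fourierL2 ν).symm p.2) := rfl

/-- The inverse of `freqPair`. -/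
def freqPairInv (ν : ℕ) : L2 ν × L2 ν →L[ℂ] L2 ν × L2 ν :=
  ((fourierL2 ν).toContinuousLinearEquiv.toContinuousLinearMap.comp
    (ContinuousLinearMap.fst ℂ (L2 ν) (L2 ν))).prod
  (Complex.I • (fourierL2 ν).toContinuousLinearEquiv.toContinuousLinearMap.comp
    (ContinuousLinearMap.snd ℂ (L2 ν) (L2 ν)))

theorem freqPairInv_apply (p : L2 ν × L2 ν) :
    freqPairInv ν p = (fourierL2 ν p.1, Complex.I • fourierL2 ν p.2) := rfl

theorem freqPair_freqPairInv (p : L2 ν × L2 ν) : freqPair ν (freqPairInv ν p) = p := by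
  rw [freqPair_apply, freqPairInv_apply]
  refine Prod.ext (LinearIsometryEquiv.symm_apply_apply _ _) ?_
  simp only [map_smul, LinearIsometryEquiv.symm_apply_apply, smul_smul]
  simp

theorem isWeakGen_fourierL2_conjExpr (φ : 𝓢(X ν, ℂ)) :
    IsWeakGen (fourierL2 ν (φ.toLp 2 volume))
      (Complex.I • fourierL2 ν ((conjExpr (uField ν) φ).toLp 2 volume)) := by
  rw [fourierL2_toLp, fourierL2_toLp]
  refine isWeakGen_of_contDiff (SchwartzMap.smooth (𝓕 φ : 𝓢(X ν, ℂ)) ⊤)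
    (SchwartzMap.coeFn_toLp _ _ _) ?_
  filter_upwards [Lp.coeFn_smul Complex.I ((𝓕 (conjExpr (uField ν) φ) : 𝓢(X ν, ℂ)).toLp 2 volume),
    SchwartzMap.coeFn_toLp (𝓕 (conjExpr (uField ν) φ) : 𝓢(X ν, ℂ)) 2 volume] with ξ h1 h2
  rw [h1, Pi.smul_apply, h2, fourier_conjExpr, smul_eq_mul, ← mul_assoc, mul_neg,
    Complex.I_mul_I, neg_neg, one_mul]

theorem closure_graph_conjOpMin_le :
    (conjOpMin (uField ν)).graph.topologicalClosure ≤
      (weakGenSubmodule ν).comap (freqPairInv ν).toLinearMap := by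
  refine Submodule.topologicalClosure_minimal _ (fun p hp => ?_)
    (isClosed_isWeakGen.preimage (freqPairInv ν).continuous)
  obtain ⟨φ, -, rfl⟩ := (mem_graph_conjOpMin _ _).1 hp
  exact isWeakGen_fourierL2_conjExpr φ

theorem freqPair_mem_closure_graph {F : X ν → ℂ} (hF : IsAnnular F) :
    freqPair ν (hF.toL2, hF.genFun.toL2) ∈ (conjOpMin (uField ν)).graph.topologicalClosure := by
  obtain ⟨φ, e0⟩ : ∃ φ : 𝓢(X ν, ℂ), 𝓕 φ = hF.hasCompactSupport.toSchwartzMap hF.contDiff :=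
    ⟨_, fourier_fourierInv_eq _⟩
  have e0' : ∀ ξ, (𝓕 φ : 𝓢(X ν, ℂ)) ξ = F ξ := fun ξ => by rw [e0]; rfl
  have e1 : (fourierL2 ν).symm hF.toL2 = φ.toLp 2 volume := by
    rw [LinearIsometryEquiv.symm_apply_eq, fourierL2_toLp]
    ext1
    filter_upwards [hF.coeFn_toL2, SchwartzMap.coeFn_toLp (𝓕 φ : 𝓢(X ν, ℂ)) 2 volume] with ξ h1 h2
    rw [h1, h2, e0']
  have e2 : (-Complex.I) • (fourierL2 ν).symm hF.genFun.toL2 =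
      (conjExpr (uField ν) φ).toLp 2 volume := by
    rw [← map_smul, LinearIsometryEquiv.symm_apply_eq, fourierL2_toLp]
    ext1
    filter_upwards [Lp.coeFn_smul (-Complex.I) hF.genFun.toL2, hF.genFun.coeFn_toL2,
      SchwartzMap.coeFn_toLp (𝓕 (conjExpr (uField ν) φ) : 𝓢(X ν, ℂ)) 2 volume] with ξ h1 h2 h3
    rw [h1, h3, Pi.smul_apply, h2, fourier_conjExpr, funext e0', smul_eq_mul]
  rw [freqPair_apply, e1, e2]
  exact mem_closure_graph_conjOpMin _ φ

theorem IsWeakGen.map_mem [NeZero ν] {K : Submodule ℂ (L2 ν × L2 ν)}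
    (hK : IsClosed (K : Set (L2 ν × L2 ν))) (T : L2 ν × L2 ν →L[ℂ] L2 ν × L2 ν)
    (h : ∀ (F : X ν → ℂ) (hF : IsAnnular F), T (hF.toL2, hF.genFun.toL2) ∈ K) {F G : L2 ν}
    (hFG : IsWeakGen F G) : T (F, G) ∈ K :=
  mem_of_hasDerivAt_transport (K := K.comap T.toLinearMap) (hK.preimage T.continuous) h
    hFG.hasDerivAt

theorem mem_comap_weakGenSubmodule {p : L2 ν × L2 ν} :
    p ∈ (weakGenSubmodule ν).comap (freqPairInv ν).toLinearMap ↔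
      IsWeakGen (freqPairInv ν p).1 (freqPairInv ν p).2 :=
  Iff.rfl

theorem le_closure_graph_conjOpMin [NeZero ν] :
    (weakGenSubmodule ν).comap (freqPairInv ν).toLinearMap ≤
      (conjOpMin (uField ν)).graph.topologicalClosure := by
  intro p hp
  have h := (mem_comap_weakGenSubmodule.1 hp).map_mem (Submodule.isClosed_topologicalClosure _)
    (freqPair ν) fun F hF => freqPair_mem_closure_graph hF
  rwa [Prod.mk.eta, freqPair_freqPairInv] at h

/-- The weak relation is closed and contains the image of the test functions. Annular functions have
Schwartz inverse transforms, so the core lies in the closure of the graph. Uniqueness of the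
derivative at the zero vector gives single-valuedness. -/
theorem graph_conjOp_uField [NeZero ν] :
    (conjOp (uField ν)).graph = (weakGenSubmodule ν).comap (freqPairInv ν).toLinearMap := by
  refine graph_conjOp (le_antisymm closure_graph_conjOpMin_le le_closure_graph_conjOpMin)
    fun p hp h0 => ?_
  have h : HasDerivAt (fun τ => transport 0 τ (fourierL2 ν p.1)) (Complex.I • fourierL2 ν p.2) 0 :=
    IsWeakGen.hasDerivAt hp
  rw [h0, map_zero] at h
  simp only [map_zero] at h
  have h1 := h.unique (hasDerivAt_const (0 : ℝ) (0 : L2 ν))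
  rw [smul_eq_zero_iff_right Complex.I_ne_zero, LinearIsometryEquiv.map_eq_zero_iff] at h1
  exact h1

/-- The group `e^{iτA}` in `L²`. -/
def unitaryGroup [NeZero ν] (τ : ℝ) : L2 ν →L[ℂ] L2 ν :=
  (fourierL2 ν).symm.toContinuousLinearEquiv.toContinuousLinearMap ∘L transport 0 τ ∘L
    (fourierL2 ν).toContinuousLinearEquiv.toContinuousLinearMap

theorem unitaryGroup_apply [NeZero ν] (τ : ℝ) (f : L2 ν) :
    unitaryGroup τ f = (fourierL2 ν).symm (transport 0 τ (fourierL2 ν f)) := rfl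

theorem isUnitaryGroup_unitaryGroup [NeZero ν] :
    IsUnitaryGroup (conjOp (uField ν)) unitaryGroup where
  map_zero := by
    ext1 f
    rw [unitaryGroup_apply, transport_zero, ContinuousLinearMap.id_apply,
      LinearIsometryEquiv.symm_apply_apply, ContinuousLinearMap.id_apply]
  map_add σ τ := by
    ext1 f
    rw [ContinuousLinearMap.comp_apply, unitaryGroup_apply, unitaryGroup_apply, unitaryGroup_apply,
      LinearIsometryEquiv.apply_symm_apply, transport_add, ContinuousLinearMap.comp_apply]
  norm_map τ f := by
    rw [unitaryGroup_apply, LinearIsometryEquiv.norm_map, norm_transport_zero,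
      LinearIsometryEquiv.norm_map]
  continuous f := (fourierL2 ν).symm.continuous.comp (continuous_transport 0 _)
  generator f g := by
    rw [graph_conjOp_uField]
    change IsWeakGen (fourierL2 ν f) (Complex.I • fourierL2 ν g) ↔ _
    rw [← hasDerivAt_transport_iff]
    constructor
    · intro h
      have h1 := ((fourierL2 ν).symm.toContinuousLinearEquiv.toContinuousLinearMap.restrictScalars
        ℝ).hasFDerivAt.comp_hasDerivAt (0 : ℝ) h
      convert! h1 using 1
      change _ = (fourierL2 ν).symm (Complex.I • fourierL2 ν g)
      rw [map_smul, LinearIsometryEquiv.symm_apply_apply]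
    · intro h
      have h1 := ((fourierL2 ν).toContinuousLinearEquiv.toContinuousLinearMap.restrictScalars
        ℝ).hasFDerivAt.comp_hasDerivAt (0 : ℝ) h
      convert! h1 using 1
      · ext1 τ
        exact ((fourierL2 ν).apply_symm_apply _).symm
      · exact (map_smul (fourierL2 ν) _ _).symm

/-- The group induced by `e^{iτA}` in `H^s`. -/
def inducedGroup [NeZero ν] (s τ : ℝ) : Sob ν s →L[ℂ] Sob ν s :=
  (freq s).symm.toContinuousLinearEquiv.toContinuousLinearMap ∘L transport s τ ∘L
    (freq s).toContinuousLinearEquiv.toContinuousLinearMap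

theorem inducedGroup_apply [NeZero ν] (s τ : ℝ) (f : Sob ν s) :
    inducedGroup s τ f = (freq s).symm (transport s τ (freq s f)) := rfl

theorem transportFun_wt_mul (s τ : ℝ) (F : X ν → ℂ) (ξ : X ν) :
    transportFun s τ (fun ξ => (wt s ξ : ℂ) * F ξ) ξ = (wt s ξ : ℂ) * transportFun 0 τ F ξ := by
  have h := (wt_pos s (flow (-τ) ξ)).ne'
  have e : ratio s τ ξ * wt s (flow (-τ) ξ) = wt s ξ * ratio 0 τ ξ := by
    rw [ratio, ratio, cobWeight, cobWeight, cobWeight, cobWeight, wt_zero, wt_zero]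
    -- Where the density vanishes, division by zero gives the value 0 to both multipliers.
    rcases eq_or_ne √(dens (flow (-τ) ξ)) 0 with h0 | h0
    · simp [h0]
    · field_simp
  rw [transportFun, transportFun, ← mul_assoc, ← mul_assoc, ← Complex.ofReal_mul, e,
    Complex.ofReal_mul]

theorem isInducedGroup_inducedGroup [NeZero ν] (s : ℝ) :
    IsInducedGroup s unitaryGroup (inducedGroup (ν := ν) s) where
  agree τ f g h := by
    rw [toDistr_eq_coe_iff] at h ⊢
    rw [inducedGroup_apply, LinearIsometryEquiv.apply_symm_apply]
    have e : 𝓕 (unitaryGroup τ g) = transport 0 τ (𝓕 g : L2 ν) :=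
      (fourierL2 ν).apply_symm_apply _
    rw [e]
    filter_upwards [coeFn_transport s τ (freq s f), coeFn_transport 0 τ (𝓕 g : L2 ν),
      transportFun_congr s τ h] with ξ h1 h2 h3
    rw [h1, h2, h3, transportFun_wt_mul]
  continuous f := (freq s).symm.continuous.comp (continuous_transport s _)

/-- The group `e^{iτA}` in `L²` and in `H^{±1}`. -/
def conjGroup (ν : ℕ) [NeZero ν] : GroupOf (conjOp (uField ν)) where
  U := unitaryGroup
  Wpos := inducedGroup 1
  Wneg := inducedGroup (-1)
  isUnitaryGroup := isUnitaryGroup_unitaryGroup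
  isInduced_pos := isInducedGroup_inducedGroup 1
  isInduced_neg := isInducedGroup_inducedGroup (-1)

/-- The time is reversed: in `V_τ` the operator `e^{-iτA}` acts first, while `sandwich` at `τ`
starts with transport by `+τ`. Neither the class `C^1` nor the symmetric second difference is
affected. -/
theorem conjGroup_conj [NeZero ν] (V : Sob ν 1 →L[ℂ] Sob ν (-1)) (τ : ℝ) (f : Sob ν 1) :
    (conjGroup ν).conj V τ f = (freq (-1)).symm (sandwich (freqOp V) (-τ) (freq 1 f)) := by
  change inducedGroup (-1) τ (V (inducedGroup 1 (-τ) f)) = _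
  rw [inducedGroup_apply, inducedGroup_apply, sandwich_apply, freqOp_apply, neg_neg]

/-! ### The regularity classes -/

theorem isClassC1_of_isPotential [NeZero ν] {V : Sob ν 1 →L[ℂ] Sob ν (-1)} {v : Sob ν (-1)}
    {x : Fin ν → Sob ν (-1)} (hV : IsPotential V v) (hx : ∀ j, IsMul (fun x => x j) v (x j)) :
    IsClassC1 (conjOp (uField ν)) V := by
  refine ⟨conjGroup ν, fun f => ?_⟩
  obtain ⟨B, hB⟩ := exists_hasCommutator hV hx
  have h1 := (contDiff_sandwich hB (freq 1 f)).comp (contDiff_neg (𝕜 := ℝ) (F := ℝ))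
  have h2 := ((freq (-1) :
    Sob ν (-1) ≃ₗᵢ[ℂ] L2 ν).symm.toContinuousLinearEquiv.toContinuousLinearMap.restrictScalars ℝ).contDiff.comp h1
  convert! h2 using 1
  ext1 τ
  exact conjGroup_conj V τ f

theorem lintegral_rpow_lt_top {μ : ℝ} (hμ : 0 < μ) (C : ℝ) :
    ∫⁻ τ in Set.Ioc (0 : ℝ) 1, ENNReal.ofReal (C * τ ^ (μ - 1)) < ⊤ := by
  have h := intervalIntegral.intervalIntegrable_rpow' (a := 0) (b := 1) (by linarith : -1 < μ - 1)
  rw [intervalIntegrable_iff_integrableOn_Ioc_of_le zero_le_one] at h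
  exact (h.const_mul C).lintegral_lt_top

theorem isClassC11_of_isPotential [NeZero ν] {V : Sob ν 1 →L[ℂ] Sob ν (-1)} {μ : ℝ} (hμ : 0 < μ)
    (hμ1 : μ ≤ 1) {T v : Sob ν (-1)} (hv : IsMul (wt (-(1 + μ))) T v) (hV : IsPotential V v) :
    IsClassC11 (conjOp (uField ν)) V := by
  refine ⟨conjGroup ν, ?_⟩
  obtain ⟨C, hC⟩ := exists_norm_second_difference_le hμ hμ1 hv hV
  refine lt_of_le_of_lt (setLIntegral_mono' measurableSet_Ioc fun τ hτ => ?_)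
    (lintegral_rpow_lt_top hμ C)
  refine ENNReal.ofReal_le_ofReal ?_
  have hτ0 := hτ.1
  rw [div_le_iff₀ (by positivity)]
  -- The bound `τ^{1+μ}` divided by `τ²` is `τ^{μ-1}`, integrable at zero for `μ > 0`.
  have e : C * τ ^ (μ - 1) * τ ^ 2 = C * τ ^ (1 + μ) := by
    rw [mul_assoc, ← Real.rpow_two, ← Real.rpow_add hτ0]
    ring_nf
  rw [e]
  have hC0 := hC τ hτ.1 hτ.2
  refine ContinuousLinearMap.opNorm_le_bound _ ((norm_nonneg _).trans hC0) fun f => ?_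
  have e2 : ((conjGroup ν).conj V τ + (conjGroup ν).conj V (-τ) - (2 : ℂ) • V) f =
      (freq (-1)).symm ((sandwich (freqOp V) τ + sandwich (freqOp V) (-τ) -
        (2 : ℂ) • freqOp V) (freq 1 f)) := by
    simp only [_root_.add_apply, _root_.sub_apply, _root_.smul_apply, conjGroup_conj, neg_neg,
      map_add, map_sub, map_smul, freqOp_apply, LinearIsometryEquiv.symm_apply_apply]
    rw [add_comm]
  rw [e2, LinearIsometryEquiv.norm_map, ← (freq 1).norm_map f]
  exact ContinuousLinearMap.le_of_opNorm_le _ hC0 _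

/-! ### Dimension zero -/

/-- The sum over coordinates is empty, so the operator vanishes on test functions and its closure is
zero on all of `L²`. -/
theorem graph_conjOp_dim_zero (p : L2 0 × L2 0) : p ∈ (conjOp (uField 0)).graph ↔ p.2 = 0 := by
  have h0 : ∀ φ : 𝓢(X 0, ℂ), conjExpr (uField 0) φ = 0 := fun φ => by simp [conjExpr]
  have hz : ((0 : 𝓢(X 0, ℂ)).toLp 2 volume : L2 0) = 0 :=
    map_zero (SchwartzMap.toLpCLM ℂ ℂ 2 (volume : Measure (X 0)))
  have hK : (conjOp (uField 0)).graph = LinearMap.ker (LinearMap.snd ℂ (L2 0) (L2 0)) := by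
    refine graph_conjOp (le_antisymm ?_ ?_) fun p hp _ => hp
    · refine Submodule.topologicalClosure_minimal _ (fun p hp => ?_)
        (isClosed_eq continuous_snd continuous_const)
      obtain ⟨φ, -, rfl⟩ := (mem_graph_conjOpMin _ _).1 hp
      change ((conjExpr (uField 0) φ).toLp 2 volume : L2 0) = 0
      rw [h0, hz]
    · rintro ⟨f, g⟩ (rfl : g = 0)
      have hc : IsClosed {f : L2 0 | (f, (0 : L2 0)) ∈
          (conjOpMin (uField 0)).graph.topologicalClosure} :=
        (Submodule.isClosed_topologicalClosure _).preimage (by fun_prop)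
      have hd : DenseRange (SchwartzMap.toLpCLM ℂ ℂ 2 (volume : Measure (X 0))) :=
        SchwartzMap.denseRange_toLpCLM ENNReal.ofNat_ne_top
      refine hc.closure_subset_iff.2 ?_ (hd f)
      rintro _ ⟨φ, rfl⟩
      have h := mem_closure_graph_conjOpMin (uField 0) φ
      rw [h0, hz] at h
      exact h
  rw [hK]
  rfl

/-- In dimension zero, the group is trivial. -/
def conjGroupZero : GroupOf (conjOp (uField 0)) where
  U _ := ContinuousLinearMap.id ℂ _
  Wpos _ := ContinuousLinearMap.id ℂ _
  Wneg _ := ContinuousLinearMap.id ℂ _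
  isUnitaryGroup :=
    { map_zero := rfl
      map_add := fun _ _ => rfl
      norm_map := fun _ _ => rfl
      continuous := fun _ => continuous_const
      generator := fun f g => by
        rw [graph_conjOp_dim_zero]
        constructor
        · rintro (rfl : g = 0)
          rw [smul_zero]
          exact hasDerivAt_const _ _
        · intro h
          have h1 := h.unique (hasDerivAt_const (0 : ℝ) f)
          rwa [smul_eq_zero_iff_right Complex.I_ne_zero] at h1 }
  isInduced_pos := ⟨fun _ _ _ h => h, fun _ => continuous_const⟩
  isInduced_neg := ⟨fun _ _ _ h => h, fun _ => continuous_const⟩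

theorem isClassC1_dim_zero (V : Sob 0 1 →L[ℂ] Sob 0 (-1)) : IsClassC1 (conjOp (uField 0)) V :=
  ⟨conjGroupZero, fun f => (contDiff_const : ContDiff ℝ 1 fun _ : ℝ => V f)⟩

theorem isClassC11_dim_zero (V : Sob 0 1 →L[ℂ] Sob 0 (-1)) : IsClassC11 (conjOp (uField 0)) V := by
  refine ⟨conjGroupZero, ?_⟩
  have h : ∀ τ, conjGroupZero.conj V τ = V := fun _ => rfl
  simp [h, two_smul]

end

end ConjClass

end

/-! ### Conclusion: assembly of the two regularity statements. -/

theorem lemmal (ν : ℕ) :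
    ConjClass.IsClassU (ConjClass.uField ν) ∧
    ∀ V : ConjClass.Sob ν 1 →L[ℂ] ConjClass.Sob ν (-1),
      ConjClass.IsSymm V → ConjClass.IsMultiplication V →
        (ConjClass.WeightedMem (fun x => ‖x‖) V →
          ConjClass.IsClassC1 (ConjClass.conjOp (ConjClass.uField ν)) V) ∧
        (∀ μ : ℝ, 0 < μ → ConjClass.WeightedMem (fun x => ConjClass.jap x ^ (1 + μ)) V →
          ConjClass.IsClassC11 (ConjClass.conjOp (ConjClass.uField ν)) V) := by
  refine ⟨ConjClass.isClassU_uField, fun V _ hV => ?_⟩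
  -- In dimension zero the origin has positive measure and the transport construction does not
  -- apply; there the group is trivial.
  rcases Nat.eq_zero_or_pos ν with rfl | hν
  · exact ⟨fun _ => ConjClass.isClassC1_dim_zero V, fun _ _ _ => ConjClass.isClassC11_dim_zero V⟩
  have : NeZero ν := ⟨hν.ne'⟩
  refine ⟨fun h => ?_, fun μ hμ h => ?_⟩
  · obtain ⟨v, x, hP, hx⟩ := ConjClass.exists_isPotential_of_weightedMem_norm hV h
    exact ConjClass.isClassC1_of_isPotential hP hx
  · obtain ⟨T, v, hv, hP⟩ := ConjClass.exists_isPotential_of_weightedMem_jap hμ h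
    exact ConjClass.isClassC11_of_isPotential (lt_min hμ one_pos) (min_le_right _ _) hv hP
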